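/- All graphs are finite, simple and undirected. The spectrum of a graph $G$ is the multiset of eigenvalues of its adjacency matrix $A(G)$, i.e. of roots of $\det(\lambda I-A(G))$. Two non-isomorphic graphs are cospectral mates if they have the same spectrum; a graph is determined by its (adjacency) spectrum if it has no cospectral mate. Let $P_r$ and $C_r$ be the path and the cycle on the vertices $0,1,\dots,r-1$, consecutive integers being adjacent (and, in $C_r$, also $r-1$ and $0$). For $0<m_1<\dots<m_t<r-1$, let $P_{n_1,\dots,n_t;r}^{m_1,\dots,m_t}$ be the graph obtained from $P_r$ by attaching at the vertex $m_i$ a pendant path with $n_i$ edges, for each $i=1,\dots,t$; for $0\le m_1<\dots<m_t\le r-1$, let $C_{n_1,\dots,n_t;r}^{m_1,\dots,m_t}$ be obtained from $C_r$ in the same way. For $n\ge 10$ put $H_n=P_{2,2;n-4}^{2,n-7}$, a tree of order $n$. Theorem. For every integer $n\ge 10$, the tree $H_n$ is determined by its adjacency spectrum if and only if $n\notin\{10,13,15\}$. Moreover, with $\sqcup$ denoting disjoint union, 1. $H_{10}$ and $P_2\sqcup C_{1,1;6}^{0,3}$ are cospectral mates; 2. $H_{13}$ and $P_{2;4}^{1}\sqcup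 C_{1;6}^{0}$ are cospectral mates; 3. $H_{15}$ and $P_{1,2;6}^{1,3}\sqcup C_6$ are cospectral mates. -/

import Mathlib

/-- The spectrum of a finite simple graph: the multiset of (real) eigenvalues of its adjacency
matrix, i.e. the roots, with multiplicity, of its characteristic polynomial. -/
noncomputable def adjSpectrum {V : Type*} [Fintype V] (G : SimpleGraph V) : Multiset ℝ :=
  open Classical in (G.adjMatrix ℝ).charpoly.roots

/-- Two non-isomorphic graphs are cospectral mates if they have the same spectrum. -/
def CospectralMates {V W : Type*} [Fintype V] [Fintype W]
    (G : SimpleGraph V) (H : SimpleGraph W) : Prop :=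
  IsEmpty (G ≃g H) ∧ adjSpectrum G = adjSpectrum H

/-- A finite graph `G` is determined by its spectrum (DS) if every finite graph with the same
spectrum is isomorphic to `G`. (Every finite graph is isomorphic to one with vertices in `Type`.) -/
def IsDS {V : Type*} [Fintype V] (G : SimpleGraph V) : Prop :=
  ∀ (W : Type) [Fintype W] (H : SimpleGraph W), adjSpectrum G = adjSpectrum H → Nonempty (G ≃g H)

/-- The graph obtained from a graph `B` on the vertices `0, …, r - 1` by attaching, for each `i`,
a pendant path with `n i` edges at the vertex `m i`. The new vertices of the `i`-th pendant path are
`⟨i, 0⟩, …, ⟨i, n i - 1⟩`, with `⟨i, 0⟩` adjacent to `m i`. -/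
def attachPaths {r t : ℕ} (B : SimpleGraph (Fin r)) (m n : Fin t → ℕ) :
    SimpleGraph (Fin r ⊕ (Σ i : Fin t, Fin (n i))) where
  Adj
    | .inl u, .inl v => B.Adj u v
    | .inl u, .inr p => (u : ℕ) = m p.1 ∧ (p.2 : ℕ) = 0
    | .inr p, .inl u => (u : ℕ) = m p.1 ∧ (p.2 : ℕ) = 0
    | .inr p, .inr q => p.1 = q.1 ∧ ((p.2 : ℕ) + 1 = q.2 ∨ (q.2 : ℕ) + 1 = p.2)
  symm := ⟨by
    rintro (u | p) (v | q) h
    · exact h.symm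
    · exact h
    · exact h
    · exact ⟨h.1.symm, h.2.symm⟩⟩
  loopless := ⟨by
    rintro (u | p) h
    · exact B.loopless.irrefl u h
    · rcases h with ⟨-, h | h⟩ <;> omega⟩

/-- The open quipu `P_{n₁,…,n_t; r}^{m₁,…,m_t}` (meant for `0 < m₁ < ⋯ < m_t < r - 1`). -/
def openQuipu (r : ℕ) {t : ℕ} (m n : Fin t → ℕ) :
    SimpleGraph (Fin r ⊕ (Σ i : Fin t, Fin (n i))) :=
  attachPaths (SimpleGraph.pathGraph r) m n

/-- The closed quipu `C_{n₁,…,n_t; r}^{m₁,…,m_t}` (meant for `r ≥ 3` and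
`0 ≤ m₁ < ⋯ < m_t ≤ r - 1`). -/
def closedQuipu (r : ℕ) {t : ℕ} (m n : Fin t → ℕ) :
    SimpleGraph (Fin r ⊕ (Σ i : Fin t, Fin (n i))) :=
  attachPaths (SimpleGraph.cycleGraph r) m n

/-- The H-shape tree `H_n = P_{2,2; n-4}^{2, n-7}` (meant for `n ≥ 10`). -/
def hTree (n : ℕ) : SimpleGraph (Fin (n - 4) ⊕ (Σ i : Fin 2, Fin (![2, 2] i))) :=
  openQuipu (n - 4) ![2, n - 7] ![2, 2]

/-!
Every graph `G` cospectral with `hTree n` is shown to be isomorphic to it when `n ≥ 11` and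
`n ≠ 13, 15`, and for `n = 10, 13, 15` a cospectral mate is verified.

*The exceptional orders.* The adjacency matrices of `hTree n` and of its mate are intertwined by an
explicit invertible integer matrix (`adjSpectrum_eq_of_intertwiner`), so they are similar. The mate
is disconnected, hence not isomorphic to the tree.

*Tools for the other orders.* The spectrum determines the order, the traces of the powers of the
adjacency matrix, and the eigenvalues. The second, fourth and sixth traces express the number of
edges, the sum of the squares of the degrees together with the number of 4-cycles, and the numbers
of hexagons and of edges with prescribed degrees at their ends; the odd traces exclude odd cycles.
The eigenvalues enter in three ways:

* The largest eigenvalue of `hTree n` is `t + t⁻¹`, where `t` is an explicit algebraic number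
  (`exists_hTree_root`, `nbSum_hVec`). It decreases with `n` and exceeds `2`. A subgraph of `G`
  carrying a positive subsolution of the eigenvalue equation for `μ` forces the largest eigenvalue
  of `G` to be at least `μ`; if it is equal to `μ`, then the subgraph is a union of components
  (`EigLe.le_of_subsolution`, `EigLe.neighborFinset_eq_image`).
* `2` is not an eigenvalue (this is where `n = 15` is excluded), so that no component of `G` is a
  cycle.
* The largest eigenvalue of a hexagon with one pendant vertex is too large if `n ≥ 14`, and no
  eigenvalue of `hTree 11` and `hTree 12`, so that this graph is no component of `G`.

*The argument.* The traces show that all degrees of `G` are at most `3`, that `G` has no cycle of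
length less than `8` other than hexagons, and that `G` has either the degrees of `hTree n`, or only
one vertex of degree `3` (`HMate.degree_cases`). In the former case the number of hexagons is
determined by the adjacencies between vertices of odd degree (`HMate.hexDefect_eq`).

If `G` has a cycle, a shortest one contains a branch vertex, as `2` is not an eigenvalue, and the
neighbour of that vertex off the cycle is a leaf, since a cycle with a pendant path of two vertices
has too large an eigenvalue (`HMate.false_of_tail`). Counting hexagons, each of the remaining
possibilities exhibits a hexagon with one pendant vertex as a component, or a cycle with two close
pendant vertices, or another cycle with a pendant path of two vertices, which are all excluded
(`HMate.not_cycIn`).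

So `G` is a tree with two branch vertices, without hexagons. If these are adjacent, then `G`
contains a tree on nine vertices with the largest eigenvalue of `hTree 11`, which is impossible
(`HMate.false_of_adj_branches`). Otherwise no leaf is adjacent to a branch vertex, so that `G`
contains a copy of `hTree m` for some `m`
(`HMate.exists_embedding`), and comparing the largest eigenvalues gives `m = n` and
`G ≃g hTree n` (`HMate.nonempty_iso_of_embedding`).
-/

/-! ### Eigenvalues, subsolutions and supersolutions -/

section Spectral

open scoped Classical
open Matrix

variable {V W : Type*} [Fintype V] [Fintype W]

/-- The sum of a function over the neighbours of a vertex, i.e. the action of the adjacency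
matrix. -/
noncomputable def nbSum (G : SimpleGraph V) (x : V → ℝ) (v : V) : ℝ :=
  ∑ w, if G.Adj v w then x w else 0

lemma adjMatrix_mulVec_eq_nbSum (G : SimpleGraph V) (x : V → ℝ) (v : V) :
    (G.adjMatrix ℝ *ᵥ x) v = nbSum G x v := by
  rw [SimpleGraph.adjMatrix_mulVec_apply, nbSum, SimpleGraph.neighborFinset_eq_filter,
    Finset.sum_filter]

lemma isHermitian_adjMatrix {V : Type*} (G : SimpleGraph V) : (G.adjMatrix ℝ).IsHermitian := by
  rw [Matrix.IsHermitian, Matrix.conjTranspose_eq_transpose_of_trivial,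
    SimpleGraph.transpose_adjMatrix]

lemma charpoly_eq_of_adjSpectrum_eq {G : SimpleGraph V} {H : SimpleGraph W}
    (h : adjSpectrum G = adjSpectrum H) :
    (G.adjMatrix ℝ).charpoly = (H.adjMatrix ℝ).charpoly := by
  have hG := (isHermitian_adjMatrix G).splits_charpoly.eq_prod_roots_of_monic
    (Matrix.charpoly_monic _)
  have hH := (isHermitian_adjMatrix H).splits_charpoly.eq_prod_roots_of_monic
    (Matrix.charpoly_monic _)
  rw [hG, hH]
  have : (G.adjMatrix ℝ).charpoly.roots = (H.adjMatrix ℝ).charpoly.roots := by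
    simpa only [adjSpectrum] using h
  rw [this]

lemma card_eq_of_adjSpectrum_eq {G : SimpleGraph V} {H : SimpleGraph W}
    (h : adjSpectrum G = adjSpectrum H) : Fintype.card V = Fintype.card W := by
  have := congrArg Polynomial.natDegree (charpoly_eq_of_adjSpectrum_eq h)
  rwa [Matrix.charpoly_natDegree_eq_dim, Matrix.charpoly_natDegree_eq_dim] at this

lemma trace_pow_eq_sum_roots {A : Matrix V V ℝ} (hA : A.IsHermitian) (k : ℕ) :
    (A ^ k).trace = (A.charpoly.roots.map (fun r => r ^ k)).sum := by
  rw [hA.roots_charpoly_eq_eigenvalues, Multiset.map_map]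
  conv_lhs => rw [hA.spectral_theorem, ← map_pow, Unitary.conjStarAlgAut_apply,
    Matrix.trace_mul_cycle, Matrix.diagonal_pow]
  simp [Matrix.trace_diagonal]

lemma trace_pow_eq_of_adjSpectrum_eq {G : SimpleGraph V} {H : SimpleGraph W}
    (h : adjSpectrum G = adjSpectrum H) (k : ℕ) :
    ((G.adjMatrix ℝ) ^ k).trace = ((H.adjMatrix ℝ) ^ k).trace := by
  rw [trace_pow_eq_sum_roots (isHermitian_adjMatrix G),
    trace_pow_eq_sum_roots (isHermitian_adjMatrix H), charpoly_eq_of_adjSpectrum_eq h]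

/-- `μ` is an eigenvalue of the adjacency matrix of `G`. -/
def IsEig (G : SimpleGraph V) (μ : ℝ) : Prop :=
  ∃ x : V → ℝ, x ≠ 0 ∧ ∀ v, nbSum G x v = μ * x v

lemma isEig_iff_isRoot (G : SimpleGraph V) (μ : ℝ) :
    IsEig G μ ↔ (G.adjMatrix ℝ).charpoly.IsRoot μ := by
  rw [Polynomial.IsRoot, Matrix.eval_charpoly, ← Matrix.exists_mulVec_eq_zero_iff, IsEig]
  refine exists_congr fun x => and_congr_right fun _ => ?_
  rw [Matrix.sub_mulVec, sub_eq_zero, funext_iff]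
  refine forall_congr' fun v => ?_
  rw [adjMatrix_mulVec_eq_nbSum]
  simp only [Matrix.scalar_apply, Matrix.mulVec_diagonal]
  exact eq_comm

lemma IsEig.of_adjSpectrum_eq {G : SimpleGraph V} {H : SimpleGraph W}
    (h : adjSpectrum G = adjSpectrum H) {μ : ℝ} (hG : IsEig G μ) : IsEig H μ := by
  rw [isEig_iff_isRoot] at hG ⊢
  rwa [← charpoly_eq_of_adjSpectrum_eq h]

lemma sum_nbSum_mul_comm (G : SimpleGraph V) (x y : V → ℝ) :
    ∑ v, nbSum G x v * y v = ∑ v, x v * nbSum G y v := by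
  simp only [nbSum, Finset.sum_mul, Finset.mul_sum]
  rw [Finset.sum_comm]
  refine Finset.sum_congr rfl fun v _ => Finset.sum_congr rfl fun w _ => ?_
  by_cases h : G.Adj v w
  · simp [h, h.symm]
  · rw [if_neg h, if_neg fun h' : G.Adj w v => h h'.symm, zero_mul, mul_zero]

lemma nbSum_nonneg (G : SimpleGraph V) {x : V → ℝ} (h : ∀ v, 0 ≤ x v) (v : V) :
    0 ≤ nbSum G x v := by
  refine Finset.sum_nonneg fun w _ => ?_
  split_ifs
  exacts [h w, le_rfl]

lemma abs_nbSum_le (G : SimpleGraph V) (x : V → ℝ) (v : V) :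
    |nbSum G x v| ≤ nbSum G (fun w => |x w|) v := by
  refine (Finset.abs_sum_le_sum_abs _ _).trans (le_of_eq ?_)
  refine Finset.sum_congr rfl fun w _ => ?_
  split_ifs <;> simp

/-- A positive supersolution of the eigenvalue equation bounds all eigenvalues. -/
lemma IsEig.le_of_supersolution {G : SimpleGraph V} {μ ν : ℝ} (hν : IsEig G ν) {z : V → ℝ}
    (hz : ∀ v, 0 < z v) (hle : ∀ v, nbSum G z v ≤ μ * z v) : ν ≤ μ := by
  obtain ⟨x, hx0, hx⟩ := hν
  obtain ⟨a, ha⟩ := Function.ne_iff.mp hx0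
  have hpos : 0 < ∑ v, |x v| * z v :=
    Finset.sum_pos' (fun v _ => mul_nonneg (abs_nonneg _) (hz v).le)
      ⟨a, Finset.mem_univ _, mul_pos (abs_pos.mpr ha) (hz a)⟩
  refine le_of_mul_le_mul_right ?_ hpos
  calc ν * ∑ v, |x v| * z v = ∑ v, (ν * |x v|) * z v := by
        rw [Finset.mul_sum]; exact Finset.sum_congr rfl fun v _ => (mul_assoc _ _ _).symm
    _ ≤ ∑ v, nbSum G (fun w => |x w|) v * z v := by
        refine Finset.sum_le_sum fun v _ => mul_le_mul_of_nonneg_right ?_ (hz v).le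
        refine le_trans ?_ (abs_nbSum_le G x v)
        rw [hx v, abs_mul]
        exact mul_le_mul_of_nonneg_right (le_abs_self ν) (abs_nonneg _)
    _ = ∑ v, |x v| * nbSum G z v := sum_nbSum_mul_comm G _ _
    _ ≤ ∑ v, |x v| * (μ * z v) :=
        Finset.sum_le_sum fun v _ => mul_le_mul_of_nonneg_left (hle v) (abs_nonneg _)
    _ = μ * ∑ v, |x v| * z v := by
        rw [Finset.mul_sum]; exact Finset.sum_congr rfl fun v _ => by ring

/-- All eigenvalues of the adjacency matrix of `G` are at most `μ`. -/
def EigLe (G : SimpleGraph V) (μ : ℝ) : Prop := ∀ ν, IsEig G ν → ν ≤ μ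

lemma EigLe.of_adjSpectrum_eq {G : SimpleGraph V} {H : SimpleGraph W}
    (h : adjSpectrum G = adjSpectrum H) {μ : ℝ} (hH : EigLe H μ) : EigLe G μ :=
  fun ν hν => hH ν (hν.of_adjSpectrum_eq h)

lemma EigLe.posSemidef {G : SimpleGraph V} {μ : ℝ} (h : EigLe G μ) :
    (μ • (1 : Matrix V V ℝ) - G.adjMatrix ℝ).PosSemidef := by
  have hH : (μ • (1 : Matrix V V ℝ) - G.adjMatrix ℝ).IsHermitian :=
    (Matrix.isHermitian_one.smul (by simp [IsSelfAdjoint])).sub (isHermitian_adjMatrix G)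
  rw [hH.posSemidef_iff_eigenvalues_nonneg]
  intro i
  have he := hH.mulVec_eigenvectorBasis i
  have hne : (hH.eigenvectorBasis i).ofLp ≠ 0 := by
    intro h0
    have := hH.eigenvectorBasis.orthonormal.ne_zero i
    exact this (by ext j; simpa using congrFun h0 j)
  have := h (μ - hH.eigenvalues i) ⟨_, hne, fun v => ?_⟩
  · simpa using this
  · have hv := congrFun he v
    rw [Matrix.sub_mulVec, Pi.sub_apply, adjMatrix_mulVec_eq_nbSum, Matrix.smul_mulVec,
      Matrix.one_mulVec, Pi.smul_apply, Pi.smul_apply, smul_eq_mul, smul_eq_mul] at hv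
    linarith

/-- A nonnegative subsolution for the largest eigenvalue is an eigenvector. -/
lemma EigLe.nbSum_eq {G : SimpleGraph V} {μ : ℝ} (h : EigLe G μ) {x : V → ℝ}
    (hx : ∀ v, 0 ≤ x v) (hsub : ∀ v, μ * x v ≤ nbSum G x v) (v : V) :
    nbSum G x v = μ * x v := by
  have hP := h.posSemidef
  have hz : star x ⬝ᵥ (μ • (1 : Matrix V V ℝ) - G.adjMatrix ℝ) *ᵥ x = 0 := by
    refine le_antisymm ?_ ((Matrix.posSemidef_iff_dotProduct_mulVec.mp hP).2 x)
    refine Finset.sum_nonpos fun w _ => ?_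
    rw [Matrix.sub_mulVec, Pi.sub_apply, adjMatrix_mulVec_eq_nbSum, Matrix.smul_mulVec,
      Matrix.one_mulVec, Pi.smul_apply, smul_eq_mul]
    exact mul_nonpos_of_nonneg_of_nonpos (by simpa using hx w) (by linarith [hsub w])
  have := congrFun ((hP.dotProduct_mulVec_zero_iff x).mp hz) v
  rw [Matrix.sub_mulVec, Pi.sub_apply, adjMatrix_mulVec_eq_nbSum, Matrix.smul_mulVec,
    Matrix.one_mulVec, Pi.smul_apply, smul_eq_mul, Pi.zero_apply] at this
  linarith

variable {U : Type*} [Fintype U]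

/-- A function on `U` carried to `V` along an injection `f`, and extended by zero. -/
noncomputable def push {V : Type*} (f : U → V) (x : U → ℝ) (v : V) : ℝ :=
  ∑ a, if f a = v then x a else 0

lemma push_apply {V : Type*} {f : U → V} (hf : Function.Injective f) (x : U → ℝ) (a : U) :
    push f x (f a) = x a := by
  simp [push, hf.eq_iff]

lemma push_of_notMem {V : Type*} {f : U → V} (x : U → ℝ) {v : V} (hv : ∀ a, f a ≠ v) :
    push f x v = 0 := by
  simp [push, hv]

lemma push_nonneg {V : Type*} {f : U → V} {x : U → ℝ} (hx : ∀ a, 0 ≤ x a) (v : V) :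
    0 ≤ push f x v :=
  Finset.sum_nonneg fun a _ => by split_ifs; exacts [hx a, le_rfl]

lemma sum_le_nbSum_push {G : SimpleGraph V} {f : U → V} (hf : Function.Injective f)
    {N : U → Finset U} (hN : ∀ a, ∀ b ∈ N a, G.Adj (f a) (f b)) {x : U → ℝ}
    (hx : ∀ a, 0 ≤ x a) (a : U) : ∑ b ∈ N a, x b ≤ nbSum G (push f x) (f a) := by
  calc ∑ b ∈ N a, x b = ∑ v ∈ (N a).image f, push f x v := by
        rw [Finset.sum_image fun _ _ _ _ h => hf h]
        exact Finset.sum_congr rfl fun b _ => (push_apply hf x b).symm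
    _ = ∑ v ∈ (N a).image f, if G.Adj (f a) v then push f x v else 0 := by
        refine Finset.sum_congr rfl fun v hv => ?_
        obtain ⟨b, hb, rfl⟩ := Finset.mem_image.mp hv
        rw [if_pos (hN a b hb)]
    _ ≤ nbSum G (push f x) (f a) := by
        refine Finset.sum_le_sum_of_subset_of_nonneg (Finset.subset_univ _) fun v _ _ => ?_
        split_ifs
        exacts [push_nonneg hx v, le_rfl]

/-- If `G` contains a copy of a graph having a positive subsolution for `μ`, and `μ` bounds the
eigenvalues of `G`, then the copy is a union of components of `G` and the subsolution is an
eigenvector. -/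
lemma EigLe.nbSum_push_eq {G : SimpleGraph V} {μ : ℝ} (h : EigLe G μ) {f : U → V}
    (hf : Function.Injective f) {N : U → Finset U} (hN : ∀ a, ∀ b ∈ N a, G.Adj (f a) (f b))
    {x : U → ℝ} (hx : ∀ a, 0 < x a) (hsub : ∀ a, μ * x a ≤ ∑ b ∈ N a, x b) (v : V) :
    nbSum G (push f x) v = μ * push f x v := by
  refine h.nbSum_eq (push_nonneg fun a => (hx a).le) (fun v => ?_) v
  by_cases hv : ∃ a, f a = v
  · obtain ⟨a, rfl⟩ := hv
    rw [push_apply hf]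
    exact (hsub a).trans (sum_le_nbSum_push hf hN (fun a => (hx a).le) a)
  · rw [push_of_notMem x (not_exists.mp hv), mul_zero]
    exact nbSum_nonneg G (push_nonneg fun a => (hx a).le) v

/-- In the situation of `EigLe.nbSum_push_eq`, the vertices of the copy have no neighbours in `G`
besides those prescribed by `N`. -/
lemma EigLe.neighborFinset_eq_image {G : SimpleGraph V} {μ : ℝ} (h : EigLe G μ) {f : U → V}
    (hf : Function.Injective f) {N : U → Finset U} (hN : ∀ a, ∀ b ∈ N a, G.Adj (f a) (f b))
    {x : U → ℝ} (hx : ∀ a, 0 < x a) (hsub : ∀ a, μ * x a ≤ ∑ b ∈ N a, x b) (a : U) :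
    G.neighborFinset (f a) = (N a).image f := by
  have heq := h.nbSum_push_eq hf hN hx hsub
  have hnn : ∀ v, 0 ≤ push f x v := push_nonneg fun a => (hx a).le
  refine Finset.Subset.antisymm (fun v hv => ?_) (fun v hv => ?_)
  · rw [SimpleGraph.mem_neighborFinset] at hv
    by_cases hr : ∃ b, f b = v
    · obtain ⟨b, rfl⟩ := hr
      by_contra hb
      have hsum : ∑ w ∈ insert (f b) ((N a).image f), push f x w ≤ nbSum G (push f x) (f a) := by
        calc ∑ w ∈ insert (f b) ((N a).image f), push f x w
            = ∑ w ∈ insert (f b) ((N a).image f), if G.Adj (f a) w then push f x w else 0 := by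
              refine Finset.sum_congr rfl fun w hw => ?_
              rw [Finset.mem_insert, Finset.mem_image] at hw
              obtain rfl | ⟨c, hc, rfl⟩ := hw
              · rw [if_pos hv]
              · rw [if_pos (hN a c hc)]
          _ ≤ _ := by
              refine Finset.sum_le_sum_of_subset_of_nonneg (Finset.subset_univ _) fun w _ _ => ?_
              split_ifs
              exacts [hnn w, le_rfl]
      rw [Finset.sum_insert hb, Finset.sum_image fun _ _ _ _ h => hf h, heq, push_apply hf,
        push_apply hf, Finset.sum_congr rfl fun b _ => push_apply hf x b] at hsum
      linarith [hsub a, hx b]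
    · -- the pushed function vanishes at `v`, hence at all its neighbours
      have h0 := heq v
      rw [push_of_notMem x (not_exists.mp hr), mul_zero] at h0
      have h1 := (Finset.sum_eq_zero_iff_of_nonneg fun w _ => by
        split_ifs; exacts [hnn w, le_rfl]).mp h0 (f a) (Finset.mem_univ _)
      rw [if_pos hv.symm, push_apply hf] at h1
      exact absurd h1 (hx a).ne'
  · obtain ⟨b, hb, rfl⟩ := Finset.mem_image.mp hv
    rw [SimpleGraph.mem_neighborFinset]
    exact hN a b hb

/-- A copy in `G` of a graph with a positive subsolution for `μ` forces an eigenvalue `≥ μ`. -/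
lemma EigLe.le_of_subsolution {G : SimpleGraph V} {μ ν : ℝ} (h : EigLe G ν) [Nonempty U]
    {f : U → V} (hf : Function.Injective f) {N : U → Finset U}
    (hN : ∀ a, ∀ b ∈ N a, G.Adj (f a) (f b))
    {x : U → ℝ} (hx : ∀ a, 0 < x a) (hsub : ∀ a, μ * x a ≤ ∑ b ∈ N a, x b) : μ ≤ ν := by
  by_contra! hlt
  have h' : EigLe G μ := fun κ hκ => (h κ hκ).trans hlt.le
  obtain ⟨a⟩ := ‹Nonempty U›
  have := h μ ⟨push f x, fun h0 => (hx a).ne' ?_, h'.nbSum_push_eq hf hN hx hsub⟩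
  · linarith
  · rw [← push_apply hf x a, h0, Pi.zero_apply]

/-- A positive eigenvector of a union of components of `G` extends by zero. -/
lemma isEig_of_closed {G : SimpleGraph V} {μ : ℝ} [Nonempty U] {f : U → V}
    (hf : Function.Injective f) {N : U → Finset U}
    (hN : ∀ a v, G.Adj (f a) v ↔ ∃ b ∈ N a, f b = v) {x : U → ℝ} (hx : ∀ a, 0 < x a)
    (heq : ∀ a, ∑ b ∈ N a, x b = μ * x a) : IsEig G μ := by
  obtain ⟨a0⟩ := ‹Nonempty U›
  refine ⟨push f x, fun h0 => (hx a0).ne' ?_, fun v => ?_⟩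
  · rw [← push_apply hf x a0, h0, Pi.zero_apply]
  by_cases hv : ∃ a, f a = v
  · obtain ⟨a, rfl⟩ := hv
    rw [push_apply hf, ← heq, nbSum, ← Finset.sum_filter]
    have : Finset.univ.filter (fun w => G.Adj (f a) w) = (N a).image f := by
      ext w
      simp [hN]
    rw [this, Finset.sum_image fun _ _ _ _ h => hf h]
    exact Finset.sum_congr rfl fun b _ => push_apply hf x b
  · rw [push_of_notMem x (not_exists.mp hv), mul_zero]
    refine Finset.sum_eq_zero fun w _ => ?_
    split_ifs with hvw
    · by_cases hw : ∃ a, f a = w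
      · obtain ⟨a, rfl⟩ := hw
        obtain ⟨b, -, rfl⟩ := (hN a v).mp hvw.symm
        exact absurd ⟨b, rfl⟩ hv
      · exact push_of_notMem x (not_exists.mp hw)
    · rfl

/-- A nonempty union of components all of whose vertices have degree `2` carries the
eigenvalue `2`. -/
lemma isEig_two_of_closed {G : SimpleGraph V} {S : Finset V} (hS : S.Nonempty)
    (hdeg : ∀ v ∈ S, G.degree v = 2) (hcl : ∀ v ∈ S, ∀ w, G.Adj v w → w ∈ S) : IsEig G 2 := by
  obtain ⟨a, ha⟩ := hS
  refine ⟨fun v => if v ∈ S then 1 else 0, fun h0 => ?_, fun v => ?_⟩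
  · have := congrFun h0 a
    simp [ha] at this
  · rw [nbSum, ← Finset.sum_filter, ← SimpleGraph.neighborFinset_eq_filter]
    by_cases hv : v ∈ S
    · rw [Finset.sum_congr rfl fun w hw => if_pos (hcl v hv w (by simpa using hw))]
      simp [hv, hdeg v hv]
    · rw [Finset.sum_congr rfl fun w hw => if_neg fun hw' => hv (hcl w hw' v
        (by simpa using (SimpleGraph.mem_neighborFinset _ _ _).mp hw |>.symm))]
      simp [hv]

end Spectral

/-! ### Cycles and forests -/

section Cycles

variable {V : Type*}

/-- `c 0, …, c (g - 1)` are the successive vertices of a cycle of length `g` in `G`. The values of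
`c` from `g` on are irrelevant. -/
structure CycIn (G : SimpleGraph V) (g : ℕ) (c : ℕ → V) : Prop where
  three_le : 3 ≤ g
  inj : ∀ i < g, ∀ j < g, c i = c j → i = j
  adj : ∀ i, i + 1 < g → G.Adj (c i) (c (i + 1))
  close : G.Adj (c (g - 1)) (c 0)

lemma CycIn.adj_mod {G : SimpleGraph V} {g : ℕ} {c : ℕ → V} (h : CycIn G g c) {i : ℕ}
    (hi : i < g) : G.Adj (c i) (c ((i + 1) % g)) := by
  rcases Nat.lt_or_ge (i + 1) g with h1 | h1
  · rw [Nat.mod_eq_of_lt h1]; exact h.adj i h1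
  · obtain rfl : g = i + 1 := by omega
    simpa using h.close

lemma CycIn.rotate {G : SimpleGraph V} {g : ℕ} {c : ℕ → V} (h : CycIn G g c) (k : ℕ) :
    CycIn G g (fun i => c ((i + k) % g)) := by
  have h3 := h.three_le
  refine ⟨h3, fun i hi j hj hij => ?_, fun i hi => ?_, ?_⟩
  · have := h.inj _ (Nat.mod_lt _ (by omega)) _ (Nat.mod_lt _ (by omega)) hij
    have h2 : i ≡ j [MOD g] := Nat.ModEq.add_right_cancel' k this
    rwa [Nat.ModEq, Nat.mod_eq_of_lt hi, Nat.mod_eq_of_lt hj] at h2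
  · have := h.adj_mod (i := (i + k) % g) (Nat.mod_lt _ (by omega))
    rwa [Nat.mod_add_mod, show i + k + 1 = i + 1 + k by ring] at this
  · have := h.adj_mod (i := (g - 1 + k) % g) (Nat.mod_lt _ (by omega))
    rwa [Nat.mod_add_mod, show g - 1 + k + 1 = 0 + k + g by omega, Nat.add_mod_right] at this

lemma CycIn.exists_rotate {G : SimpleGraph V} {g : ℕ} {c : ℕ → V} (h : CycIn G g c) {k : ℕ}
    (hk : k < g) : ∃ c', CycIn G g c' ∧ c' 0 = c k ∧
      ∀ v, (∃ i < g, c' i = v) ↔ ∃ i < g, c i = v := by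
  refine ⟨_, h.rotate k, by simp [Nat.mod_eq_of_lt hk], fun v => ⟨?_, ?_⟩⟩
  · rintro ⟨i, hi, rfl⟩
    exact ⟨_, Nat.mod_lt _ (by omega), rfl⟩
  · rintro ⟨i, hi, rfl⟩
    refine ⟨(i + (g - k)) % g, Nat.mod_lt _ (by omega), ?_⟩
    simp only [Nat.mod_add_mod]
    rw [show i + (g - k) + k = i + g by omega, Nat.add_mod_right, Nat.mod_eq_of_lt hi]

lemma CycIn.reverse {G : SimpleGraph V} {g : ℕ} {c : ℕ → V} (h : CycIn G g c) :
    CycIn G g (fun i => if i = 0 then c 0 else c (g - i)) := by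
  have h3 := h.three_le
  refine ⟨h3, fun i hi j hj hij => ?_, fun i hi => ?_, ?_⟩
  · split_ifs at hij with h1 h2 h2
    · omega
    · have := h.inj _ (by omega) _ (by omega) hij; omega
    · have := h.inj _ (by omega) _ (by omega) hij; omega
    · have := h.inj _ (by omega) _ (by omega) hij; omega
  · rw [if_neg (Nat.succ_ne_zero i)]
    split_ifs with h1
    · subst h1; exact h.close.symm
    · have := h.adj (g - (i + 1)) (by omega)
      rw [show g - (i + 1) + 1 = g - i by omega] at this
      exact this.symm
  · rw [if_neg (by omega), if_pos rfl, show g - (g - 1) = 0 + 1 by omega]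
    exact (h.adj 0 (by omega)).symm

lemma exists_cycIn_of_not_isAcyclic {G : SimpleGraph V} (h : ¬ G.IsAcyclic) :
    ∃ g c, CycIn G g c := by
  unfold SimpleGraph.IsAcyclic at h
  push Not at h
  obtain ⟨a, w, hw⟩ := h
  have h3 := hw.three_le_length
  refine ⟨w.length, w.getVert, h3, fun i hi j hj hij => ?_, fun i hi => ?_, ?_⟩
  · exact hw.getVert_injOn' (by simp; omega) (by simp; omega) hij
  · exact w.adj_getVert_succ (by omega)
  · have := w.adj_getVert_succ (i := w.length - 1) (by omega)
    rw [show w.length - 1 + 1 = w.length by omega, w.getVert_length] at this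
    simpa using this

/-- A chord of a cycle cuts off a shorter cycle. -/
lemma CycIn.chord {G : SimpleGraph V} {g : ℕ} {c : ℕ → V} (h : CycIn G g c) {j : ℕ}
    (hj2 : 2 ≤ j) (hj : j < g) (hadj : G.Adj (c 0) (c j)) : CycIn G (j + 1) c where
  three_le := by omega
  inj i hi k hk := h.inj i (by omega) k (by omega)
  adj i hi := h.adj i (by omega)
  close := by simpa using hadj.symm

/-- A vertex off a cycle with two neighbours on it closes up another cycle. -/
lemma CycIn.detour {G : SimpleGraph V} {g : ℕ} {c : ℕ → V} (h : CycIn G g c) {j : ℕ}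
    (hj1 : 1 ≤ j) (hj : j < g) {w : V} (hw : ∀ i < g, c i ≠ w) (h0 : G.Adj (c 0) w)
    (hjw : G.Adj (c j) w) : CycIn G (j + 2) (fun i => if i ≤ j then c i else w) where
  three_le := by omega
  inj i hi k hk hik := by
    split_ifs at hik with h1 h2 h2
    · exact h.inj i (by omega) k (by omega) hik
    · exact absurd hik (hw i (by omega))
    · exact absurd hik.symm (hw k (by omega))
    · omega
  adj i hi := by
    rw [if_pos (by omega)]
    split_ifs with h1
    · exact h.adj i (by omega)
    · obtain rfl : i = j := by omega
      exact hjw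
  close := by
    rw [if_neg (by omega), if_pos (by omega)]
    exact h0.symm

/-- If no cycle exists, a sequence of vertices without immediate backtracking is injective. -/
lemma injOn_of_nonbacktracking {G : SimpleGraph V} (hG : ∀ g c, ¬ CycIn G g c) {L : ℕ}
    {p : ℕ → V} (hadj : ∀ i, i + 1 < L → G.Adj (p i) (p (i + 1)))
    (hnb : ∀ i, i + 2 < L → p i ≠ p (i + 2)) : ∀ i < L, ∀ j < L, p i = p j → i = j := by
  have key : ∀ k, ∀ i, i + k < L → 0 < k → p i ≠ p (i + k) := by
    intro k
    induction k using Nat.strong_induction_on with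
    | _ k ih =>
      intro i hi hk heq
      rcases Nat.lt_or_ge k 3 with h3 | h3
      · interval_cases k
        · exact (hadj i hi).ne heq
        · exact hnb i hi heq
      · refine hG k (fun j => p (i + j)) ⟨h3, fun a ha b hb hab => ?_, fun a ha => ?_, ?_⟩
        · by_contra hne
          rcases Nat.lt_or_gt_of_ne hne with hlt | hlt
          · refine ih (b - a) (by omega) (i + a) (by omega) (by omega) ?_
            rwa [show i + a + (b - a) = i + b by omega]
          · refine ih (a - b) (by omega) (i + b) (by omega) (by omega) ?_
            rw [show i + b + (a - b) = i + a by omega]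
            exact hab.symm
        · exact hadj (i + a) (by omega)
        · have := hadj (i + (k - 1)) (by omega)
          rw [show i + (k - 1) + 1 = i + k by omega, ← heq] at this
          exact this
  intro i hi j hj hij
  by_contra hne
  rcases Nat.lt_or_gt_of_ne hne with hlt | hlt
  · refine key (j - i) i (by omega) (by omega) ?_
    rwa [show i + (j - i) = j by omega]
  · refine key (i - j) j (by omega) (by omega) ?_
    rw [show j + (i - j) = i by omega]
    exact hij.symm

/-- A graph has no cycle if its vertices carry levels such that adjacent vertices have different
levels and no vertex has two neighbours of lower level. -/
lemma not_cycIn_of_level {G : SimpleGraph V} (l : V → ℕ)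
    (hne : ∀ a b, G.Adj a b → l a ≠ l b)
    (huniq : ∀ a b b', G.Adj a b → G.Adj a b' → l b < l a → l b' < l a → b = b')
    (g : ℕ) (c : ℕ → V) : ¬ CycIn G g c := by
  intro h
  have h3 := h.three_le
  obtain ⟨k, hk, hmax⟩ := Finset.exists_max_image (Finset.range g) (fun i => l (c i))
    ⟨0, by simp; omega⟩
  rw [Finset.mem_range] at hk
  obtain ⟨c', hc', h0, hmem⟩ := h.exists_rotate hk
  have hmax' : ∀ i < g, l (c' i) ≤ l (c' 0) := by
    intro i hi
    obtain ⟨j, hj, hji⟩ := (hmem (c' i)).mp ⟨i, hi, rfl⟩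
    rw [← hji, h0]
    exact hmax j (by simpa using hj)
  have h1 := hc'.adj 0 (by omega)
  have h2 := hc'.close.symm
  have := huniq _ _ _ h1 h2 (lt_of_le_of_ne (hmax' _ (by omega)) (hne _ _ h1).symm)
    (lt_of_le_of_ne (hmax' _ (by omega)) (hne _ _ h2).symm)
  have := hc'.inj _ (by omega) _ (by omega) this
  omega

end Cycles

section Forests

open scoped Classical

variable {V : Type*} [Fintype V]

lemma isAcyclic_of_not_cycIn {V : Type*} {G : SimpleGraph V} (hG : ∀ g c, ¬ CycIn G g c) :
    G.IsAcyclic := by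
  by_contra h
  obtain ⟨g, c, hc⟩ := exists_cycIn_of_not_isAcyclic h
  exact hG g c hc

/-- A forest has fewer edges than vertices. -/
lemma sum_degree_lt_of_not_cycIn [Nonempty V] {G : SimpleGraph V} (hG : ∀ g c, ¬ CycIn G g c) :
    ∑ v, G.degree v + 2 ≤ 2 * Fintype.card V := by
  obtain ⟨T, hle, -, hT⟩ := SimpleGraph.Connected.exists_isTree_le_of_le_of_isAcyclic
    SimpleGraph.connected_top (le_top : G ≤ ⊤) (isAcyclic_of_not_cycIn hG)
  have hc := hT.card_edgeFinset
  have hs := Finset.card_le_card (SimpleGraph.edgeFinset_mono hle)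
  rw [G.sum_degrees_eq_twice_card_edges]
  omega

/-- A forest with one edge less than vertices is a tree. -/
lemma connected_of_not_cycIn [Nonempty V] {G : SimpleGraph V} (hG : ∀ g c, ¬ CycIn G g c)
    (hd : ∑ v, G.degree v + 2 = 2 * Fintype.card V) : G.Connected := by
  obtain ⟨T, hle, -, hT⟩ := SimpleGraph.Connected.exists_isTree_le_of_le_of_isAcyclic
    SimpleGraph.connected_top (le_top : G ≤ ⊤) (isAcyclic_of_not_cycIn hG)
  have hc := hT.card_edgeFinset
  have hs := SimpleGraph.edgeFinset_mono hle
  rw [G.sum_degrees_eq_twice_card_edges] at hd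
  have := SimpleGraph.edgeFinset_inj.mp (Finset.eq_of_subset_of_card_le hs (by omega))
  rw [this]
  exact hT.connected

/-- A nonempty union of components with at least as many edges as vertices contains a cycle. -/
lemma exists_cycIn_of_closed {G : SimpleGraph V} {S : Finset V} (hS : S.Nonempty)
    (hcl : ∀ v ∈ S, ∀ w, G.Adj v w → w ∈ S) (hd : 2 * S.card ≤ ∑ v ∈ S, G.degree v) :
    ∃ g c, CycIn G g c ∧ ∀ i < g, c i ∈ S := by
  by_contra! hno
  have hne : Nonempty S := hS.to_subtype
  have hG : ∀ g c, ¬ CycIn (G.induce (S : Set V)) g c := by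
    intro g c hc
    obtain ⟨i, hi, hiS⟩ := hno g (fun i => (c i : V)) ⟨hc.three_le,
      fun i hi j hj hij => hc.inj i hi j hj (Subtype.ext hij), fun i hi => hc.adj i hi, hc.close⟩
    exact hiS (c i).2
  have hdeg : ∀ v : S, (G.induce (S : Set V)).degree v = G.degree (v : V) := by
    intro v
    rw [← SimpleGraph.card_neighborFinset_eq_degree, ← SimpleGraph.card_neighborFinset_eq_degree]
    refine Finset.card_bij (fun w _ => (w : V)) (fun w hw => ?_) (fun w _ w' _ h => Subtype.ext h)
      (fun w hw => ?_)
    · simpa using hw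
    · rw [SimpleGraph.mem_neighborFinset] at hw
      exact ⟨⟨w, hcl v v.2 w hw⟩, by simpa using hw, rfl⟩
  have h1 : ∑ v : S, (G.induce (S : Set V)).degree v + 2 ≤ 2 * Fintype.card S := by
    convert sum_degree_lt_of_not_cycIn hG
    simp
  rw [Finset.sum_congr rfl fun v _ => hdeg v, Finset.sum_coe_sort S (fun v => G.degree v),
    Fintype.card_coe] at h1
  omega

end Forests

/-! ### Traces of powers of the adjacency matrix -/

section Traces

open scoped Classical
open Matrix

variable {V : Type*} [Fintype V] (G : SimpleGraph V)

/-- The number of common neighbours of two vertices. -/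
noncomputable def cn (i j : V) : ℕ := (G.neighborFinset i ∩ G.neighborFinset j).card

/-- The number of walks of length `3` from `i` to `j`. -/
noncomputable def walks3 (i j : V) : ℕ := ∑ k ∈ G.neighborFinset j, cn G i k

/-- The number of ordered pairs of distinct common neighbours, summed over all ordered pairs of
distinct vertices; it vanishes if and only if `G` has no `4`-cycle. -/
noncomputable def quadDefect : ℝ :=
  ∑ i, ∑ j, if i = j then 0 else (cn G i j : ℝ) * (cn G i j - 1)

/-- The number of ordered pairs of distinct walks of length `3` with the same end vertices, summed
over all ordered pairs of non-adjacent end vertices; in the absence of cycles of length `3` and `4`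
it vanishes if and only if `G` has no `6`-cycle. -/
noncomputable def hexDefect : ℝ :=
  ∑ i, ∑ j, if G.Adj i j then 0 else (walks3 G i j : ℝ) * (walks3 G i j - 1)

/-- The sum of `(d i - 2) * (d j - 2)` over all ordered pairs of adjacent vertices. -/
noncomputable def edgeExcess : ℝ :=
  ∑ i, ∑ j, if G.Adj i j then ((G.degree i : ℝ) - 2) * (G.degree j - 2) else 0

variable {G}

lemma cn_self (i : V) : cn G i i = G.degree i := by simp [cn]

lemma cn_comm (i j : V) : cn G i j = cn G j i := by rw [cn, cn, Finset.inter_comm]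

lemma nat_mul_sub_one_nonneg (k : ℕ) : (0 : ℝ) ≤ k * (k - 1) := by
  rcases Nat.eq_zero_or_pos k with rfl | hk
  · simp
  · exact mul_nonneg k.cast_nonneg (sub_nonneg.mpr (by exact_mod_cast hk))

lemma adjMatrix_sq_apply (i j : V) : (G.adjMatrix ℝ ^ 2) i j = cn G i j := by
  rw [pow_two, SimpleGraph.adjMatrix_mul_apply, cn, ← Finset.filter_mem_eq_inter]
  simp only [SimpleGraph.adjMatrix_apply, SimpleGraph.mem_neighborFinset]
  rw [Finset.sum_boole]
  simp only [SimpleGraph.adj_comm]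

lemma adjMatrix_cube_apply (i j : V) : (G.adjMatrix ℝ ^ 3) i j = walks3 G i j := by
  rw [pow_succ, SimpleGraph.mul_adjMatrix_apply, walks3, Nat.cast_sum]
  exact Finset.sum_congr rfl fun k _ => adjMatrix_sq_apply i k

lemma adjMatrix_pow_symm (k : ℕ) (i j : V) :
    (G.adjMatrix ℝ ^ k) i j = (G.adjMatrix ℝ ^ k) j i := by
  have : (G.adjMatrix ℝ ^ k)ᵀ = G.adjMatrix ℝ ^ k := by
    rw [Matrix.transpose_pow, SimpleGraph.transpose_adjMatrix]
  exact (congrFun (congrFun this j) i).trans rfl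

lemma adjMatrix_pow_nonneg (k : ℕ) (i j : V) : 0 ≤ (G.adjMatrix ℝ ^ k) i j := by
  rw [SimpleGraph.adjMatrix_pow_apply_eq_card_walk]
  exact Nat.cast_nonneg _

/-- `tr A ^ (2 k)` is the sum of the squares of the entries of `A ^ k`. -/
lemma trace_adjMatrix_pow_add (k : ℕ) :
    (G.adjMatrix ℝ ^ (k + k)).trace = ∑ i, ∑ j, (G.adjMatrix ℝ ^ k) i j ^ 2 := by
  rw [pow_add, Matrix.trace]
  refine Finset.sum_congr rfl fun i _ => ?_
  rw [Matrix.diag_apply, Matrix.mul_apply]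
  refine Finset.sum_congr rfl fun j _ => ?_
  rw [adjMatrix_pow_symm k j i, pow_two]

lemma trace_adjMatrix_sq : (G.adjMatrix ℝ ^ 2).trace = ∑ i, (G.degree i : ℝ) := by
  rw [Matrix.trace]
  exact Finset.sum_congr rfl fun i _ => by rw [Matrix.diag_apply, adjMatrix_sq_apply, cn_self]

lemma CycIn.trace_pow_pos {g : ℕ} {c : ℕ → V} (h : CycIn G g c) :
    0 < (G.adjMatrix ℝ ^ g).trace := by
  have h3 := h.three_le
  have hwalk : ∀ k, k < g → 0 < (G.adjMatrix ℝ ^ k) (c 0) (c k) := by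
    intro k
    induction k with
    | zero => simp
    | succ k ih =>
      intro hk
      rw [pow_succ, SimpleGraph.mul_adjMatrix_apply]
      exact Finset.sum_pos' (fun _ _ => adjMatrix_pow_nonneg _ _ _)
        ⟨c k, by simpa using (h.adj k hk).symm, ih (by omega)⟩
  rw [Matrix.trace]
  refine Finset.sum_pos' (fun i _ => adjMatrix_pow_nonneg _ _ _) ⟨c 0, Finset.mem_univ _, ?_⟩
  rw [Matrix.diag_apply, show g = g - 1 + 1 by omega, pow_succ, SimpleGraph.mul_adjMatrix_apply]
  exact Finset.sum_pos' (fun _ _ => adjMatrix_pow_nonneg _ _ _)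
    ⟨c (g - 1), by simpa using h.close.symm, hwalk _ (by omega)⟩

lemma sum_sum_adj_left (f : V → ℝ) :
    ∑ i, ∑ j, (if G.Adj i j then f i else 0) = ∑ i, G.degree i * f i := by
  refine Finset.sum_congr rfl fun i _ => ?_
  rw [← Finset.sum_filter, ← SimpleGraph.neighborFinset_eq_filter, Finset.sum_const,
    SimpleGraph.card_neighborFinset_eq_degree, nsmul_eq_mul]

lemma sum_sum_adj_right (f : V → ℝ) :
    ∑ i, ∑ j, (if G.Adj i j then f j else 0) = ∑ i, G.degree i * f i := by
  rw [Finset.sum_comm, ← sum_sum_adj_left]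
  simp only [SimpleGraph.adj_comm]

lemma sum_cn_right (k : V) : ∑ i, (cn G i k : ℝ) = ∑ l ∈ G.neighborFinset k, (G.degree l : ℝ) := by
  simp only [cn, ← Finset.filter_mem_eq_inter, Finset.card_filter, Nat.cast_sum]
  have : ∀ i, ∑ a ∈ G.neighborFinset i, ((if a ∈ G.neighborFinset k then 1 else 0 : ℕ) : ℝ)
      = ∑ a ∈ G.neighborFinset k, if G.Adj a i then 1 else 0 := by
    intro i
    rw [SimpleGraph.neighborFinset_eq_filter, SimpleGraph.neighborFinset_eq_filter,
      Finset.sum_filter, Finset.sum_filter]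
    refine Finset.sum_congr rfl fun a _ => ?_
    by_cases h1 : G.Adj i a
    · by_cases h2 : G.Adj k a <;> simp [h1, h2, h1.symm]
    · rw [if_neg h1, if_neg fun h : G.Adj a i => h1 h.symm, ite_self]
  simp only [this]
  rw [Finset.sum_comm]
  refine Finset.sum_congr rfl fun l _ => ?_
  rw [Finset.sum_boole, ← SimpleGraph.neighborFinset_eq_filter,
    SimpleGraph.card_neighborFinset_eq_degree]

lemma sum_sum_cn : ∑ i, ∑ j, (cn G i j : ℝ) = ∑ i, (G.degree i : ℝ) ^ 2 := by
  rw [Finset.sum_comm]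
  simp only [sum_cn_right, SimpleGraph.neighborFinset_eq_filter, Finset.sum_filter]
  rw [sum_sum_adj_right]
  exact Finset.sum_congr rfl fun i _ => (pow_two _).symm

lemma trace_adjMatrix_pow_four :
    (G.adjMatrix ℝ ^ 4).trace
      = 2 * ∑ i, (G.degree i : ℝ) ^ 2 - ∑ i, (G.degree i : ℝ) + quadDefect G := by
  have h : ∀ i, ∑ j, (G.adjMatrix ℝ ^ 2) i j ^ 2 = ∑ j, (cn G i j : ℝ)
      + ((G.degree i : ℝ) ^ 2 - G.degree i)
      + ∑ j, if i = j then 0 else (cn G i j : ℝ) * (cn G i j - 1) := by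
    intro i
    have : ((G.degree i : ℝ) ^ 2 - G.degree i)
        = ∑ j, if i = j then ((G.degree i : ℝ) ^ 2 - G.degree i) else 0 := by simp
    rw [this, ← Finset.sum_add_distrib, ← Finset.sum_add_distrib]
    refine Finset.sum_congr rfl fun j _ => ?_
    rw [adjMatrix_sq_apply]
    split_ifs with hij
    · subst hij; rw [cn_self]; ring
    · ring
  rw [show 4 = 2 + 2 from rfl, trace_adjMatrix_pow_add, Finset.sum_congr rfl fun i _ => h i,
    Finset.sum_add_distrib, Finset.sum_add_distrib, sum_sum_cn, Finset.sum_sub_distrib, quadDefect]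
  ring

lemma two_le_cn_iff {i j : V} : 2 ≤ cn G i j ↔
    ∃ k l, k ≠ l ∧ G.Adj i k ∧ G.Adj j k ∧ G.Adj i l ∧ G.Adj j l := by
  rw [cn, ← Nat.lt_iff_add_one_le, Finset.one_lt_card]
  simp only [Finset.mem_inter, SimpleGraph.mem_neighborFinset]
  constructor
  · rintro ⟨k, ⟨h1, h2⟩, l, ⟨h3, h4⟩, h⟩
    exact ⟨k, l, h, h1, h2, h3, h4⟩
  · rintro ⟨k, l, h, h1, h2, h3, h4⟩
    exact ⟨k, ⟨h1, h2⟩, l, ⟨h3, h4⟩, h⟩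

lemma exists_two_le_cn_of_quadDefect_ne_zero (h : quadDefect G ≠ 0) :
    ∃ i j, i ≠ j ∧ 2 ≤ cn G i j := by
  by_contra! hno
  refine h (Finset.sum_eq_zero fun i _ => Finset.sum_eq_zero fun j _ => ?_)
  split_ifs with hij
  · rfl
  · have := hno i j hij
    interval_cases cn G i j <;> simp

/-- Each `4`-cycle has two diagonals, each of them counted in both directions. -/
lemma eight_le_quadDefect (h : quadDefect G ≠ 0) : 8 ≤ quadDefect G := by
  obtain ⟨i, j, hij, hcn⟩ := exists_two_le_cn_of_quadDefect_ne_zero h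
  obtain ⟨k, l, hkl, hik, hjk, hil, hjl⟩ := two_le_cn_iff.mp hcn
  have hcn' : 2 ≤ cn G k l := two_le_cn_iff.mpr ⟨i, j, hij, hik.symm, hil.symm, hjk.symm, hjl.symm⟩
  set φ : V × V → ℝ := fun p => if p.1 = p.2 then 0 else (cn G p.1 p.2 : ℝ) * (cn G p.1 p.2 - 1)
    with hφ
  have hnn : ∀ p, 0 ≤ φ p := by
    intro p
    simp only [hφ]
    split_ifs
    exacts [le_rfl, nat_mul_sub_one_nonneg _]
  have h2 : ∀ a b, a ≠ b → 2 ≤ cn G a b → 2 ≤ φ (a, b) := by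
    intro a b hab hc
    simp only [hφ, if_neg hab]
    have : (2 : ℝ) ≤ cn G a b := by exact_mod_cast hc
    nlinarith
  have hq : quadDefect G = ∑ p, φ p := (Fintype.sum_prod_type φ).symm
  have hsub : ∑ p ∈ ({(i, j), (j, i), (k, l), (l, k)} : Finset (V × V)), φ p ≤ quadDefect G := by
    rw [hq]
    exact Finset.sum_le_sum_of_subset_of_nonneg (Finset.subset_univ _) fun p _ _ => hnn p
  have hik' := hik.ne
  have hjk' := hjk.ne
  have hil' := hil.ne
  have hjl' := hjl.ne
  rw [Finset.sum_insert, Finset.sum_insert, Finset.sum_insert, Finset.sum_singleton] at hsub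
  · have := h2 i j hij hcn
    have := h2 j i hij.symm (by rwa [cn_comm])
    have := h2 k l hkl hcn'
    have := h2 l k hkl.symm (by rwa [cn_comm])
    linarith
  all_goals simp only [Finset.mem_insert, Finset.mem_singleton, Prod.mk.injEq]
  all_goals grind

lemma cycIn_four_iff_two_le_cn :
    (∃ c, CycIn G 4 c) ↔ ∃ i j, i ≠ j ∧ 2 ≤ cn G i j := by
  constructor
  · rintro ⟨c, hc⟩
    refine ⟨c 0, c 2, fun h => by have := hc.inj _ (by omega) _ (by omega) h; omega,
      two_le_cn_iff.mpr ⟨c 1, c 3, fun h => by have := hc.inj _ (by omega) _ (by omega) h; omega,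
        hc.adj 0 (by omega), (hc.adj 1 (by omega)).symm, hc.close.symm, hc.adj 2 (by omega)⟩⟩
  · rintro ⟨i, j, hij, hcn⟩
    obtain ⟨k, l, hkl, hik, hjk, hil, hjl⟩ := two_le_cn_iff.mp hcn
    have := hik.ne
    have := hjk.ne
    have := hil.ne
    have := hjl.ne
    refine ⟨fun n => match n with | 0 => i | 1 => k | 2 => j | _ => l, by omega, ?_, ?_, ?_⟩
    · intro a ha b hb hab
      interval_cases a <;> interval_cases b <;> simp_all
    · intro a ha
      have ha' : a < 3 := by omega
      interval_cases a
      exacts [hik, hjk.symm, hjl]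
    · exact hil.symm

lemma cn_le_one (h4 : ∀ c, ¬ CycIn G 4 c) {i j : V} (hij : i ≠ j) : cn G i j ≤ 1 := by
  by_contra! h
  obtain ⟨c, hc⟩ := cycIn_four_iff_two_le_cn.mpr ⟨i, j, hij, h⟩
  exact h4 c hc

/-- Without cycles of length `4`, a walk of length `3` between adjacent vertices runs through the
edge joining them, forth or back. -/
lemma walks3_of_adj (h4 : ∀ c, ¬ CycIn G 4 c) {i j : V} (hij : G.Adj i j) :
    (walks3 G i j : ℝ) = G.degree i + G.degree j - 1 := by
  have hi : i ∈ G.neighborFinset j := by simpa using hij.symm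
  have h1 : ∀ k ∈ (G.neighborFinset j).erase i, cn G i k = 1 := by
    intro k hk
    rw [Finset.mem_erase, SimpleGraph.mem_neighborFinset] at hk
    refine le_antisymm (cn_le_one h4 hk.1.symm) (Finset.card_pos.mpr ⟨j, ?_⟩)
    simp [hij, hk.2.symm]
  rw [walks3, ← Finset.add_sum_erase _ _ hi, Finset.sum_congr rfl h1, cn_self, Finset.sum_const,
    Finset.card_erase_of_mem hi, SimpleGraph.card_neighborFinset_eq_degree]
  have : 1 ≤ G.degree j := by
    rw [← SimpleGraph.card_neighborFinset_eq_degree]; exact Finset.card_pos.mpr ⟨i, hi⟩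
  push_cast [smul_eq_mul, Nat.cast_sub this]
  ring

lemma sum_sum_walks3 : ∑ i, ∑ j, (walks3 G i j : ℝ)
    = ∑ i, ∑ j, if G.Adj i j then (G.degree i : ℝ) * G.degree j else 0 := by
  rw [Finset.sum_comm]
  have h : ∀ j, ∑ i, (walks3 G i j : ℝ)
      = ∑ k, if G.Adj j k then ∑ l ∈ G.neighborFinset k, (G.degree l : ℝ) else 0 := by
    intro j
    simp only [walks3, Nat.cast_sum]
    rw [Finset.sum_comm, SimpleGraph.neighborFinset_eq_filter, Finset.sum_filter]
    exact Finset.sum_congr rfl fun k _ => by rw [sum_cn_right]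
  rw [Finset.sum_congr rfl fun j _ => h j, sum_sum_adj_right]
  refine Finset.sum_congr rfl fun i _ => ?_
  rw [SimpleGraph.neighborFinset_eq_filter, Finset.sum_filter, Finset.mul_sum]
  exact Finset.sum_congr rfl fun j _ => by split_ifs <;> simp

lemma trace_adjMatrix_pow_six (h4 : ∀ c, ¬ CycIn G 4 c) :
    (G.adjMatrix ℝ ^ 6).trace = 3 * edgeExcess G + 2 * ∑ i, (G.degree i : ℝ) ^ 3
      + 6 * ∑ i, (G.degree i : ℝ) ^ 2 - 10 * ∑ i, (G.degree i : ℝ) + hexDefect G := by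
  have hadj : ∑ i, ∑ j, (if G.Adj i j then ((G.degree i : ℝ) + G.degree j - 1) *
      (G.degree i + G.degree j - 2) else 0) = 2 * (∑ i, ∑ j, if G.Adj i j then
        (G.degree i : ℝ) * G.degree j else 0) + 2 * ∑ i, (G.degree i : ℝ) ^ 3
      - 6 * ∑ i, (G.degree i : ℝ) ^ 2 + 2 * ∑ i, (G.degree i : ℝ) := by
    have e1 := sum_sum_adj_left (G := G) (fun i => (G.degree i : ℝ) ^ 2 - 3 * G.degree i + 2)
    have e2 := sum_sum_adj_right (G := G) (fun i => (G.degree i : ℝ) ^ 2 - 3 * G.degree i)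
    have : ∀ i j, (if G.Adj i j then ((G.degree i : ℝ) + G.degree j - 1) *
        (G.degree i + G.degree j - 2) else 0)
        = 2 * (if G.Adj i j then (G.degree i : ℝ) * G.degree j else 0)
        + (if G.Adj i j then (G.degree i : ℝ) ^ 2 - 3 * G.degree i + 2 else 0)
        + (if G.Adj i j then (G.degree j : ℝ) ^ 2 - 3 * G.degree j else 0) := by
      intro i j
      split_ifs <;> ring
    have e3 : ∑ i, (G.degree i : ℝ) * ((G.degree i : ℝ) ^ 2 - 3 * G.degree i + 2)
        + ∑ i, (G.degree i : ℝ) * ((G.degree i : ℝ) ^ 2 - 3 * G.degree i)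
        = 2 * ∑ i, (G.degree i : ℝ) ^ 3 - 6 * ∑ i, (G.degree i : ℝ) ^ 2
          + 2 * ∑ i, (G.degree i : ℝ) := by
      simp only [Finset.mul_sum, ← Finset.sum_sub_distrib, ← Finset.sum_add_distrib]
      exact Finset.sum_congr rfl fun i _ => by ring
    simp only [this, Finset.sum_add_distrib, ← Finset.mul_sum, e1, e2]
    linarith
  have hW : edgeExcess G = (∑ i, ∑ j, if G.Adj i j then (G.degree i : ℝ) * G.degree j else 0)
      - 4 * ∑ i, (G.degree i : ℝ) ^ 2 + 4 * ∑ i, (G.degree i : ℝ) := by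
    have e1 := sum_sum_adj_left (G := G) (fun i => 4 - 2 * (G.degree i : ℝ))
    have e2 := sum_sum_adj_right (G := G) (fun i => 2 * (G.degree i : ℝ))
    have : ∀ i j, (if G.Adj i j then ((G.degree i : ℝ) - 2) * (G.degree j - 2) else 0)
        = (if G.Adj i j then (G.degree i : ℝ) * G.degree j else 0)
        + (if G.Adj i j then 4 - 2 * (G.degree i : ℝ) else 0)
        - (if G.Adj i j then 2 * (G.degree j : ℝ) else 0) := by
      intro i j
      split_ifs <;> ring
    simp only [edgeExcess, this, Finset.sum_add_distrib, Finset.sum_sub_distrib, e1, e2]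
    rw [add_sub_assoc, ← Finset.sum_sub_distrib, Finset.mul_sum, Finset.mul_sum, sub_add,
      ← Finset.sum_sub_distrib, sub_eq_add_neg, ← Finset.sum_neg_distrib]
    congr 1
    exact Finset.sum_congr rfl fun i _ => by ring
  have hsq : ∀ i j, (G.adjMatrix ℝ ^ 3) i j ^ 2 = (walks3 G i j : ℝ)
      + (if G.Adj i j then ((G.degree i : ℝ) + G.degree j - 1) *
        (G.degree i + G.degree j - 2) else 0)
      + (if G.Adj i j then 0 else (walks3 G i j : ℝ) * (walks3 G i j - 1)) := by
    intro i j
    rw [adjMatrix_cube_apply]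
    split_ifs with hij
    · rw [walks3_of_adj h4 hij]; ring
    · ring
  rw [show 6 = 3 + 3 from rfl, trace_adjMatrix_pow_add]
  simp only [hsq, Finset.sum_add_distrib]
  rw [sum_sum_walks3, hadj, hW, ← hexDefect]
  ring

lemma not_triangle {V : Type*} {G : SimpleGraph V} (h3 : ∀ c, ¬ CycIn G 3 c) {a b c : V}
    (hab : G.Adj a b) (hbc : G.Adj b c) (hca : G.Adj c a) : False := by
  have := hab.ne
  have := hbc.ne
  have := hca.ne
  refine h3 (fun n => match n with | 0 => a | 1 => b | _ => c) ⟨by omega, ?_, ?_, hca⟩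
  · intro i hi j hj hij
    interval_cases i <;> interval_cases j <;> simp_all
  · intro i hi
    have hi' : i < 2 := by omega
    interval_cases i
    exacts [hab, hbc]

/-- Two different walks of length `3` between non-adjacent vertices form a hexagon. -/
lemma cycIn_six_of_hexDefect_ne_zero (h3 : ∀ c, ¬ CycIn G 3 c) (h4 : ∀ c, ¬ CycIn G 4 c)
    (h : hexDefect G ≠ 0) : ∃ c, CycIn G 6 c := by
  obtain ⟨i, j, hij, hw⟩ : ∃ i j, ¬ G.Adj i j ∧ 2 ≤ walks3 G i j := by
    by_contra! hno
    refine h (Finset.sum_eq_zero fun i _ => Finset.sum_eq_zero fun j _ => ?_)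
    split_ifs with hij
    · rfl
    · have := hno i j hij
      interval_cases walks3 G i j <;> simp
  have hne : i ≠ j := by
    rintro rfl
    obtain ⟨k, hk, hpos⟩ : ∃ k ∈ G.neighborFinset i, 0 < cn G i k := by
      by_contra! hno
      have : walks3 G i i = 0 := Finset.sum_eq_zero fun k hk => by simpa using hno k hk
      omega
    obtain ⟨l, hl⟩ := Finset.card_pos.mp hpos
    simp only [Finset.mem_inter, SimpleGraph.mem_neighborFinset] at hl hk
    exact not_triangle h3 hk hl.2 hl.1.symm
  have hle : ∀ k ∈ G.neighborFinset j, cn G i k = if 0 < cn G i k then 1 else 0 := by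
    intro k hk
    have hki : i ≠ k := by
      rintro rfl
      exact hij (by simpa using ((SimpleGraph.mem_neighborFinset _ _ _).mp hk).symm)
    have := cn_le_one h4 hki
    split_ifs <;> omega
  rw [walks3, Finset.sum_congr rfl hle, ← Finset.card_filter, ← Nat.lt_iff_add_one_le,
    Finset.one_lt_card] at hw
  obtain ⟨k, hk, k', hk', hkk⟩ := hw
  simp only [Finset.mem_filter, SimpleGraph.mem_neighborFinset] at hk hk'
  obtain ⟨l, hl⟩ := Finset.card_pos.mp hk.2
  obtain ⟨l', hl'⟩ := Finset.card_pos.mp hk'.2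
  simp only [Finset.mem_inter, SimpleGraph.mem_neighborFinset] at hl hl'
  have hlj : l ≠ j := by rintro rfl; exact hij hl.1
  have hlj' : l' ≠ j := by rintro rfl; exact hij hl'.1
  have hik : i ≠ k := by rintro rfl; exact hij hk.1.symm
  have hik' : i ≠ k' := by rintro rfl; exact hij hk'.1.symm
  have hll : l ≠ l' := by
    rintro rfl
    have := cn_le_one h4 hlj
    have := two_le_cn_iff.mpr ⟨k, k', hkk, hl.2.symm, hk.1, hl'.2.symm, hk'.1⟩
    omega
  have hlk' : l ≠ k' := by
    rintro rfl
    exact not_triangle h3 hl.2 hk'.1.symm hk.1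
  have hlk : l' ≠ k := by
    rintro rfl
    exact not_triangle h3 hl'.2 hk.1.symm hk'.1
  have := hl.1.ne
  have := hl'.1.ne
  have := hl.2.ne
  have := hl'.2.ne
  have := hk.1.ne
  have := hk'.1.ne
  refine ⟨fun n => match n with | 0 => i | 1 => l | 2 => k | 3 => j | 4 => k' | _ => l',
    by omega, ?_, ?_, hl'.1.symm⟩
  · intro a ha b hb hab
    interval_cases a <;> interval_cases b <;> simp_all
  · intro a ha
    have ha' : a < 5 := by omega
    interval_cases a
    exacts [hl.1, hl.2.symm, hk.1.symm, hk'.1, hl'.2]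

end Traces

/-! ### The combinatorics of `hTree n` -/

section HTree

open scoped Classical

/-- The vertex set of the tree `hTree n`. -/
abbrev HVert (n : ℕ) : Type := Fin (n - 4) ⊕ (Σ i : Fin 2, Fin (![2, 2] i))

/-- The vertex `j` of the pendant path `i` of `hTree n`. -/
def hArm {n : ℕ} (i j : Fin 2) : HVert n :=
  .inr ⟨i, Fin.cast (by fin_cases i <;> rfl) j⟩

lemma sum_hVert {M : Type*} [AddCommMonoid M] {n : ℕ} (φ : HVert n → M) :
    ∑ v, φ v = ∑ k : Fin (n - 4), φ (.inl k)
      + ((φ (hArm 0 0) + φ (hArm 0 1)) + (φ (hArm 1 0) + φ (hArm 1 1))) := by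
  rw [Fintype.sum_sum_type, Fintype.sum_sigma, Fin.sum_univ_two]
  congr 2
  · exact Fin.sum_univ_two (fun j : Fin 2 => φ (hArm 0 j))
  · exact Fin.sum_univ_two (fun j : Fin 2 => φ (hArm 1 j))

lemma hVert_cases {n : ℕ} {P : HVert n → Prop} (hl : ∀ k (h : k < n - 4), P (.inl ⟨k, h⟩))
    (ha : ∀ i j, P (hArm i j)) (v : HVert n) : P v := by
  rcases v with ⟨k, h⟩ | ⟨i, j⟩
  · exact hl k h
  · fin_cases i
    · exact ha 0 j
    · exact ha 1 j

variable {n : ℕ}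

/-- The values of a function on the straight path of `hTree n`, extended by zero. -/
noncomputable def pathVal (z : HVert n → ℝ) (k : ℕ) : ℝ :=
  if h : k < n - 4 then z (.inl ⟨k, h⟩) else 0

lemma pathVal_of_lt (z : HVert n → ℝ) {k : ℕ} (h : k < n - 4) :
    pathVal z k = z (.inl ⟨k, h⟩) := dif_pos h

lemma nbSum_hTree_inl (z : HVert n → ℝ) {k : ℕ} (h : k < n - 4) :
    nbSum (hTree n) z (.inl ⟨k, h⟩) = (if k = 0 then 0 else pathVal z (k - 1))
      + pathVal z (k + 1) + (if k = 2 then z (hArm 0 0) else 0)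
      + (if k = n - 7 then z (hArm 1 0) else 0) := by
  rw [nbSum, sum_hVert]
  have h1 : ∑ j : Fin (n - 4), (if (hTree n).Adj (.inl ⟨k, h⟩) (.inl j) then z (.inl j) else 0)
      = (if k = 0 then 0 else pathVal z (k - 1)) + pathVal z (k + 1) := by
    have : ∀ j : Fin (n - 4), (if (hTree n).Adj (.inl ⟨k, h⟩) (.inl j) then z (.inl j) else 0)
        = (fun m : ℕ => (if m + 1 = k then pathVal z m else 0)
          + (if m = k + 1 then pathVal z m else 0)) j := by
      intro j
      have hadj : (hTree n).Adj (.inl ⟨k, h⟩) (.inl j) ↔ (k + 1 = j ∨ (j : ℕ) + 1 = k) :=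
        SimpleGraph.pathGraph_adj
      simp only [hadj, pathVal_of_lt z j.2]
      split_ifs <;> first | omega | simp
    rw [Finset.sum_congr rfl fun j _ => this j,
      Fin.sum_univ_eq_sum_range (fun m : ℕ => (if m + 1 = k then pathVal z m else 0)
        + (if m = k + 1 then pathVal z m else 0)), Finset.sum_add_distrib]
    congr 1
    · rcases k with _ | k
      · simp
      · simp only [Nat.add_right_cancel_iff, Finset.sum_ite_eq', Finset.mem_range]
        rw [if_pos (by omega)]
        simp
    · rw [Finset.sum_ite_eq']
      split_ifs with h2
      · rfl
      · rw [pathVal, dif_neg (by simpa using h2)]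
  rw [h1]
  have a0 : (hTree n).Adj (.inl ⟨k, h⟩) (hArm 0 0) ↔ k = 2 := by
    change (k = 2 ∧ (0 : ℕ) = 0) ↔ _
    simp
  have a1 : (hTree n).Adj (.inl ⟨k, h⟩) (hArm 1 0) ↔ k = n - 7 := by
    change (k = n - 7 ∧ (0 : ℕ) = 0) ↔ _
    simp
  have a2 : ¬ (hTree n).Adj (.inl ⟨k, h⟩) (hArm 0 1) := by
    change ¬ (k = 2 ∧ (1 : ℕ) = 0)
    simp
  have a3 : ¬ (hTree n).Adj (.inl ⟨k, h⟩) (hArm 1 1) := by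
    change ¬ (k = n - 7 ∧ (1 : ℕ) = 0)
    simp
  simp only [a0, a1, a2, a3, if_false, add_zero]
  ring

lemma hTree_adj_hArm_inl (i : Fin 2) (k : Fin (n - 4)) :
    (hTree n).Adj (hArm i 0) (.inl k) ↔ (k : ℕ) = (![2, n - 7] : Fin 2 → ℕ) i := by
  change ((k : ℕ) = (![2, n - 7] : Fin 2 → ℕ) i ∧ (0 : ℕ) = 0) ↔ _
  simp

lemma not_hTree_adj_hArm_one_inl (i : Fin 2) (k : Fin (n - 4)) :
    ¬ (hTree n).Adj (hArm i 1) (.inl k) := by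
  change ¬ ((k : ℕ) = (![2, n - 7] : Fin 2 → ℕ) i ∧ (1 : ℕ) = 0)
  simp

lemma hTree_adj_hArm_hArm (i j a b : Fin 2) :
    (hTree n).Adj (hArm i a) (hArm j b) ↔ i = j ∧ a ≠ b := by
  change (i = j ∧ ((a : ℕ) + 1 = b ∨ (b : ℕ) + 1 = a)) ↔ _
  revert i j a b
  decide

lemma nbSum_hTree_arm_zero (hn : 10 ≤ n) (z : HVert n → ℝ) (i : Fin 2) :
    nbSum (hTree n) z (hArm i 0)
      = pathVal z ((![2, n - 7] : Fin 2 → ℕ) i) + z (hArm i 1) := by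
  have hlt : (![2, n - 7] : Fin 2 → ℕ) i < n - 4 := by fin_cases i <;> simp <;> omega
  rw [nbSum, sum_hVert]
  congr 1
  · simp only [hTree_adj_hArm_inl]
    rw [Finset.sum_eq_single (⟨_, hlt⟩ : Fin (n - 4)), if_pos rfl, pathVal_of_lt z hlt]
    · intro k _ hk
      exact if_neg fun h => hk (Fin.ext h)
    · simp
  · simp only [hTree_adj_hArm_hArm]
    fin_cases i <;> simp

lemma nbSum_hTree_arm_one (z : HVert n → ℝ) (i : Fin 2) :
    nbSum (hTree n) z (hArm i 1) = z (hArm i 0) := by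
  rw [nbSum, sum_hVert]
  simp only [hTree_adj_hArm_hArm, not_hTree_adj_hArm_one_inl]
  fin_cases i <;> simp

lemma degree_eq_nbSum {V : Type*} [Fintype V] (G : SimpleGraph V) (v : V) :
    (G.degree v : ℝ) = nbSum G (fun _ => 1) v := by
  rw [nbSum, Finset.sum_boole, ← SimpleGraph.neighborFinset_eq_filter,
    SimpleGraph.card_neighborFinset_eq_degree]

lemma degree_hTree_inl (hn : 10 ≤ n) {k : ℕ} (h : k < n - 4) :
    (hTree n).degree (.inl ⟨k, h⟩)
      = if k = 0 ∨ k = n - 5 then 1 else if k = 2 ∨ k = n - 7 then 3 else 2 := by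
  have h1 : ∀ j, pathVal (fun _ : HVert n => (1 : ℝ)) j = if j < n - 4 then 1 else 0 := by
    intro j; simp [pathVal]
  have := degree_eq_nbSum (hTree n) (.inl ⟨k, h⟩)
  rw [nbSum_hTree_inl, h1, h1] at this
  rw [← Nat.cast_inj (R := ℝ), this]
  by_cases h0 : k = 0
  · rw [if_pos h0, if_pos (by omega), if_neg (by omega), if_neg (by omega), if_pos (Or.inl h0)]
    norm_num
  by_cases h5 : k = n - 5
  · rw [if_neg h0, if_pos (by omega), if_neg (by omega), if_neg (by omega), if_neg (by omega),
      if_pos (Or.inr h5)]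
    norm_num
  rw [if_neg h0, if_pos (by omega), if_pos (by omega), if_neg (by omega : ¬ (k = 0 ∨ k = n - 5))]
  by_cases h2 : k = 2
  · rw [if_pos h2, if_neg (by omega), if_pos (by omega)]
    norm_num
  · rw [if_neg h2]
    by_cases h7 : k = n - 7
    · rw [if_pos h7, if_pos (by omega)]
      norm_num
    · rw [if_neg h7, if_neg (by omega)]
      norm_num

lemma degree_hTree_arm_zero (hn : 10 ≤ n) (i : Fin 2) : (hTree n).degree (hArm i 0) = 2 := by
  have hlt : (![2, n - 7] : Fin 2 → ℕ) i < n - 4 := by fin_cases i <;> simp <;> omega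
  have := degree_eq_nbSum (hTree n) (hArm i 0)
  rw [nbSum_hTree_arm_zero hn, pathVal_of_lt _ hlt] at this
  rw [← Nat.cast_inj (R := ℝ), this]
  norm_num

lemma degree_hTree_arm_one (i : Fin 2) : (hTree n).degree (hArm i 1) = 1 := by
  have := degree_eq_nbSum (hTree n) (hArm i 1)
  rw [nbSum_hTree_arm_one] at this
  rw [← Nat.cast_inj (R := ℝ), this]
  norm_num

/-- `hTree n` has four vertices of degree `1`, two of degree `3`, and all others of degree `2`. -/
lemma sum_hTree_degree (hn : 10 ≤ n) (φ : ℕ → ℝ) :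
    ∑ v, φ ((hTree n).degree v) = 4 * φ 1 + 2 * φ 3 + (n - 6) * φ 2 := by
  rw [sum_hVert, degree_hTree_arm_zero hn, degree_hTree_arm_zero hn, degree_hTree_arm_one,
    degree_hTree_arm_one]
  have h : ∑ k : Fin (n - 4), φ ((hTree n).degree (.inl k)) = ∑ k ∈ Finset.range (n - 4), (φ 2
      + ((if k = 0 then φ 1 - φ 2 else 0) + (if k = n - 5 then φ 1 - φ 2 else 0)
      + (if k = 2 then φ 3 - φ 2 else 0) + (if k = n - 7 then φ 3 - φ 2 else 0))) := by
    rw [← Fin.sum_univ_eq_sum_range]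
    refine Finset.sum_congr rfl fun k _ => ?_
    obtain ⟨k, hk⟩ := k
    rw [degree_hTree_inl hn hk]
    dsimp only
    by_cases h0 : k = 0
    · rw [if_pos (Or.inl h0), if_pos h0, if_neg (by omega), if_neg (by omega), if_neg (by omega)]
      ring
    by_cases h5 : k = n - 5
    · rw [if_pos (Or.inr h5), if_neg h0, if_pos h5, if_neg (by omega), if_neg (by omega)]
      ring
    by_cases h2 : k = 2
    · rw [if_neg (by omega), if_pos (Or.inl h2), if_neg h0, if_neg h5, if_pos h2,
        if_neg (by omega)]
      ring
    by_cases h7 : k = n - 7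
    · rw [if_neg (by omega), if_pos (Or.inr h7), if_neg h0, if_neg h5, if_neg h2, if_pos h7]
      ring
    · rw [if_neg (by omega), if_neg (by omega), if_neg h0, if_neg h5, if_neg h2, if_neg h7]
      ring
  rw [h]
  simp only [Finset.sum_add_distrib, Finset.sum_ite_eq', Finset.mem_range, Finset.sum_const,
    Finset.card_range, nsmul_eq_mul]
  rw [if_pos (by omega), if_pos (by omega), if_pos (by omega), if_pos (by omega),
    Nat.cast_sub (by omega)]
  push_cast
  ring

lemma card_hVert (hn : 10 ≤ n) : Fintype.card (HVert n) = n := by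
  rw [Fintype.card_eq_sum_ones, sum_hVert]
  simp
  omega

/-- The distance of a vertex of `hTree n` to the end `0` of its straight path. -/
def hLevel : HVert n → ℕ
  | .inl k => k
  | .inr p => (![2, n - 7] : Fin 2 → ℕ) p.1 + 1 + p.2

lemma hTree_not_cycIn (g : ℕ) (c : ℕ → HVert n) : ¬ CycIn (hTree n) g c := by
  refine not_cycIn_of_level hLevel ?_ ?_ g c
  · rintro (a | ⟨i, a⟩) (b | ⟨j, b⟩) h
    · have := SimpleGraph.pathGraph_adj.mp h
      simp only [hLevel]; omega
    · have : (a : ℕ) = (![2, n - 7] : Fin 2 → ℕ) j ∧ (b : ℕ) = 0 := h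
      simp only [hLevel]; omega
    · have : (b : ℕ) = (![2, n - 7] : Fin 2 → ℕ) i ∧ (a : ℕ) = 0 := h
      simp only [hLevel]; omega
    · have : i = j ∧ ((a : ℕ) + 1 = b ∨ (b : ℕ) + 1 = a) := h
      obtain ⟨rfl, h⟩ := this
      simp only [hLevel]; omega
  · have key : ∀ a b : HVert n, (hTree n).Adj a b → hLevel b < hLevel a →
        (match a with
          | .inl k => ∃ j : Fin (n - 4), b = .inl j ∧ (j : ℕ) + 1 = k
          | .inr p => if (p.2 : ℕ) = 0
            then ∃ j : Fin (n - 4), b = .inl j ∧ (j : ℕ) = (![2, n - 7] : Fin 2 → ℕ) p.1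
            else ∃ j : Fin (![2, 2] p.1), b = .inr ⟨p.1, j⟩ ∧ (j : ℕ) + 1 = p.2) := by
      rintro (a | ⟨i, a⟩) (b | ⟨j, b⟩) h hl
      · have := SimpleGraph.pathGraph_adj.mp h
        simp only [hLevel] at hl
        exact ⟨b, rfl, by omega⟩
      · have : (a : ℕ) = (![2, n - 7] : Fin 2 → ℕ) j ∧ (b : ℕ) = 0 := h
        simp only [hLevel] at hl; omega
      · have : (b : ℕ) = (![2, n - 7] : Fin 2 → ℕ) i ∧ (a : ℕ) = 0 := h
        simp only [this.2, if_true]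
        exact ⟨b, rfl, this.1⟩
      · have : i = j ∧ ((a : ℕ) + 1 = b ∨ (b : ℕ) + 1 = a) := h
        obtain ⟨rfl, h⟩ := this
        simp only [hLevel] at hl
        simp only
        rw [if_neg (by omega)]
        exact ⟨b, rfl, by omega⟩
    intro a b b' hb hb' hl hl'
    have h1 := key a b hb hl
    have h2 := key a b' hb' hl'
    rcases a with a | ⟨i, a⟩
    · obtain ⟨j, rfl, hj⟩ := h1
      obtain ⟨j', rfl, hj'⟩ := h2
      exact congrArg _ (Fin.ext (by omega))
    · simp only at h1 h2
      split_ifs at h1 h2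
      · obtain ⟨j, rfl, hj⟩ := h1
        obtain ⟨j', rfl, hj'⟩ := h2
        exact congrArg _ (Fin.ext (by omega))
      · obtain ⟨j, rfl, hj⟩ := h1
        obtain ⟨j', rfl, hj'⟩ := h2
        have : j = j' := Fin.ext (by omega)
        rw [this]

lemma quadDefect_hTree : quadDefect (hTree n) = 0 := by
  by_contra h
  obtain ⟨c, hc⟩ := cycIn_four_iff_two_le_cn.mpr (exists_two_le_cn_of_quadDefect_ne_zero h)
  exact hTree_not_cycIn _ _ hc

lemma hexDefect_hTree : hexDefect (hTree n) = 0 := by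
  by_contra h
  obtain ⟨c, hc⟩ := cycIn_six_of_hexDefect_ne_zero (hTree_not_cycIn 3) (hTree_not_cycIn 4) h
  exact hTree_not_cycIn _ _ hc

/-- No two vertices of odd degree of `hTree n` are adjacent when its branch vertices are not. -/
lemma edgeExcess_hTree (hn : 11 ≤ n) : edgeExcess (hTree n) = 0 := by
  have key : ∀ a, (hTree n).degree a ≠ 2 → ∀ b, (hTree n).Adj a b → (hTree n).degree b = 2 := by
    have h10 : 10 ≤ n := by omega
    refine hVert_cases (fun k hk hd => ?_) (fun i a hd => ?_)
    · rw [degree_hTree_inl h10 hk] at hd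
      refine hVert_cases (fun j hj hadj => ?_) (fun i a hadj => ?_)
      · have : k + 1 = j ∨ j + 1 = k := SimpleGraph.pathGraph_adj.mp hadj
        rw [degree_hTree_inl h10 hj]
        split_ifs at hd ⊢ <;> omega
      · fin_cases a
        · exact degree_hTree_arm_zero h10 i
        · exact absurd hadj.symm (not_hTree_adj_hArm_one_inl i _)
    · fin_cases a
      · exact absurd (degree_hTree_arm_zero h10 i) hd
      · refine hVert_cases (fun j hj hadj => ?_) (fun j b hadj => ?_)
        · exact absurd hadj (not_hTree_adj_hArm_one_inl i _)
        · rcases (hTree_adj_hArm_hArm _ _ _ _).mp hadj with ⟨rfl, hb⟩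
          fin_cases b
          · exact degree_hTree_arm_zero h10 i
          · exact absurd rfl hb
  refine Finset.sum_eq_zero fun a _ => Finset.sum_eq_zero fun b _ => ?_
  split_ifs with hab
  · by_cases ha : (hTree n).degree a = 2
    · rw [ha]; norm_num
    · rw [key a ha b hab]; norm_num
  · rfl

end HTree

/-! ### Eigenvalues of `hTree n` -/

section HTreeSpectrum

open scoped Classical

variable {n : ℕ}

/-- The equation for the number `t` such that `t + t⁻¹` is the largest eigenvalue of `hTree n`,
where `d = n - 9` is the distance of the branch vertices. -/
lemma exists_hTree_root (d : ℕ) :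
    ∃ t : ℝ, 0 < t ∧ t < 1 ∧ 1 - t ^ 2 - t ^ 4 = t ^ d * (t ^ 2 * (1 + t ^ 2 - t ^ 4)) := by
  set f : ℝ → ℝ := fun t => 1 - t ^ 2 - t ^ 4 - t ^ d * (t ^ 2 * (1 + t ^ 2 - t ^ 4)) with hf
  have hc : ContinuousOn f (Set.Icc 0 1) := by
    apply Continuous.continuousOn
    fun_prop
  have h0 : f 0 = 1 := by simp [hf]
  have h1 : f 1 = -2 := by simp [hf]; norm_num
  obtain ⟨t, ⟨ht0, ht1⟩, ht⟩ := intermediate_value_Icc' zero_le_one hc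
    (show (0 : ℝ) ∈ Set.Icc (f 1) (f 0) by rw [h0, h1]; norm_num)
  refine ⟨t, lt_of_le_of_ne ht0 ?_, lt_of_le_of_ne ht1 ?_, sub_eq_zero.mp ht⟩
  · rintro rfl; rw [h0] at ht; norm_num at ht
  · rintro rfl; rw [h1] at ht; norm_num at ht

/-- The positive eigenvector of `hTree n` for the eigenvalue `t + t⁻¹`, where `t` is the root given
by `exists_hTree_root`. Between the branch vertices it is a combination of `t ^ k` and
`t ^ (-k)`. -/
noncomputable def hVec (n : ℕ) (t : ℝ) : HVert n → ℝ
  | .inl k => if (k : ℕ) = 0 ∨ (k : ℕ) = n - 5 then t ^ 2 * (1 + t ^ (n - 9))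
      else if (k : ℕ) = 1 ∨ (k : ℕ) = n - 6 then t * (1 + t ^ 2) * (1 + t ^ (n - 9))
      else (1 + t ^ 2 + t ^ 4) * (t ^ ((k : ℕ) - 2) + t ^ (n - 7 - k))
  | .inr p => if (p.2 : ℕ) = 0 then t * (1 + t ^ 2) * (1 + t ^ (n - 9))
      else t ^ 2 * (1 + t ^ (n - 9))

lemma hVec_pos {t : ℝ} (ht : 0 < t) (v : HVert n) : 0 < hVec n t v := by
  rcases v with k | p
  · simp only [hVec]
    split_ifs <;> positivity
  · simp only [hVec]
    split_ifs <;> positivity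

lemma nbSum_hVec (hn : 11 ≤ n) {t : ℝ} (ht0 : 0 < t)
    (ht : 1 - t ^ 2 - t ^ 4 = t ^ (n - 9) * (t ^ 2 * (1 + t ^ 2 - t ^ 4))) (v : HVert n) :
    nbSum (hTree n) (hVec n t) v = (t + t⁻¹) * hVec n t v := by
  have hscale : ∀ a b : ℝ, t * a = (1 + t ^ 2) * b → a = (t + t⁻¹) * b := by
    intro a b hab
    field_simp
    linarith
  set T := t ^ (n - 9) with hT
  have p0 : ∀ k, k = 0 ∨ k = n - 5 → pathVal (hVec n t) k = t ^ 2 * (1 + T) := by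
    intro k hk
    rw [pathVal_of_lt _ (by omega)]
    exact if_pos hk
  have p1 : ∀ k, k = 1 ∨ k = n - 6 → pathVal (hVec n t) k = t * (1 + t ^ 2) * (1 + T) := by
    intro k hk
    rw [pathVal_of_lt _ (by omega)]
    exact (if_neg (by simp only; omega)).trans (if_pos hk)
  have p2 : ∀ k, 2 ≤ k → k ≤ n - 7 →
      pathVal (hVec n t) k = (1 + t ^ 2 + t ^ 4) * (t ^ (k - 2) + t ^ (n - 7 - k)) := by
    intro k hk hk'
    rw [pathVal_of_lt _ (by omega)]
    exact (if_neg (by simp only; omega)).trans (if_neg (by simp only; omega))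
  have p4 : pathVal (hVec n t) (n - 4) = 0 := by simp [pathVal]
  have a0 : ∀ i, hVec n t (hArm i 0) = t * (1 + t ^ 2) * (1 + T) := fun i => rfl
  have a1 : ∀ i, hVec n t (hArm i 1) = t ^ 2 * (1 + T) := fun i => rfl
  have e2 : t ^ (n - 7 - 2) = T := by rw [hT]; congr 1
  have e3 : T = t * t ^ (n - 7 - 3) := by rw [hT, ← pow_succ']; congr 1; omega
  apply hscale
  revert v
  refine hVert_cases (fun k hk => ?_) (fun i j => ?_)
  · rw [← pathVal_of_lt (hVec n t) hk, nbSum_hTree_inl]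
    rcases (by omega : k = 0 ∨ k = 1 ∨ k = 2 ∨ (3 ≤ k ∧ k ≤ n - 8) ∨ k = n - 7 ∨ k = n - 6 ∨
      k = n - 5) with h | h | h | h | h | h | h
    · subst h
      rw [if_pos rfl, if_neg (by omega), if_neg (by omega), p1 (0 + 1) (by omega),
        p0 0 (by omega)]
      ring
    · subst h
      rw [if_neg (by omega), if_neg (by omega), if_neg (by omega), p1 1 (by omega),
        p0 (1 - 1) (by omega), p2 (1 + 1) (by omega) (by omega), e2]
      ring
    · subst h
      rw [if_neg (by omega), if_pos rfl, if_neg (by omega), p1 (2 - 1) (by omega), a0,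
        p2 (2 + 1) (by omega) (by omega), p2 2 (by omega) (by omega), e2,
        show 2 + 1 - 2 = 1 from rfl, show 2 - 2 = 0 from rfl, show 2 + 1 = 3 from rfl]
      linear_combination (-(1 + t ^ 2 + t ^ 4)) * e3 - ht
    · rw [if_neg (by omega), if_neg (by omega), if_neg (by omega),
        p2 (k - 1) (by omega) (by omega), p2 (k + 1) (by omega) (by omega),
        p2 k (by omega) (by omega)]
      obtain ⟨m, rfl⟩ : ∃ m, k = m + 3 := ⟨k - 3, by omega⟩
      obtain ⟨l, hl⟩ : ∃ l, n - 7 - (m + 3) = l + 1 := ⟨n - 7 - (m + 3) - 1, by omega⟩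
      rw [hl, show n - 7 - (m + 3 - 1) = l + 2 by omega, show n - 7 - (m + 3 + 1) = l by omega,
        show m + 3 - 1 - 2 = m by omega, show m + 3 + 1 - 2 = m + 2 by omega,
        show m + 3 - 2 = m + 1 by omega]
      ring
    · subst h
      rw [if_neg (by omega), if_neg (by omega), if_pos rfl, p1 (n - 7 + 1) (by omega), a0,
        p2 (n - 7 - 1) (by omega) (by omega), p2 (n - 7) (by omega) (by omega),
        show n - 7 - 1 - 2 = n - 7 - 3 by omega, show n - 7 - (n - 7 - 1) = 1 by omega, e2,
        show n - 7 - (n - 7) = 0 by omega]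
      linear_combination (-(1 + t ^ 2 + t ^ 4)) * e3 - ht
    · subst h
      rw [if_neg (by omega), if_neg (by omega), if_neg (by omega), p1 (n - 6) (by omega),
        p2 (n - 6 - 1) (by omega) (by omega), p0 (n - 6 + 1) (by omega),
        show n - 6 - 1 - 2 = n - 7 - 2 by omega, show n - 7 - (n - 6 - 1) = 0 by omega, e2]
      ring
    · subst h
      rw [if_neg (by omega), if_neg (by omega), if_neg (by omega), p1 (n - 5 - 1) (by omega),
        p0 (n - 5) (by omega), show n - 5 + 1 = n - 4 by omega, p4]
      ring
  · fin_cases j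
    · have hm : pathVal (hVec n t) ((![2, n - 7] : Fin 2 → ℕ) i)
          = (1 + t ^ 2 + t ^ 4) * (1 + T) := by
        fin_cases i
        · change pathVal (hVec n t) 2 = _
          rw [p2 2 (by omega) (by omega), e2]
          norm_num
        · change pathVal (hVec n t) (n - 7) = _
          rw [p2 (n - 7) (by omega) (by omega), e2, show n - 7 - (n - 7) = 0 by omega]
          ring
      change t * nbSum (hTree n) (hVec n t) (hArm i 0) = (1 + t ^ 2) * hVec n t (hArm i 0)
      rw [nbSum_hTree_arm_zero (by omega), hm, a0, a1]
      ring
    · change t * nbSum (hTree n) (hVec n t) (hArm i 1) = (1 + t ^ 2) * hVec n t (hArm i 1)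
      rw [nbSum_hTree_arm_one, a0, a1]
      ring

lemma isEig_hTree (hn : 11 ≤ n) {t : ℝ} (ht0 : 0 < t)
    (ht : 1 - t ^ 2 - t ^ 4 = t ^ (n - 9) * (t ^ 2 * (1 + t ^ 2 - t ^ 4))) :
    IsEig (hTree n) (t + t⁻¹) :=
  ⟨hVec n t, fun h => (hVec_pos ht0 (hArm 0 0)).ne' (by rw [h, Pi.zero_apply]),
    nbSum_hVec hn ht0 ht⟩

lemma eigLe_hTree (hn : 11 ≤ n) {t : ℝ} (ht0 : 0 < t)
    (ht : 1 - t ^ 2 - t ^ 4 = t ^ (n - 9) * (t ^ 2 * (1 + t ^ 2 - t ^ 4))) :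
    EigLe (hTree n) (t + t⁻¹) :=
  fun _ hν => hν.le_of_supersolution (hVec_pos ht0) fun v => (nbSum_hVec hn ht0 ht v).le

/-- The left side of the equation for `t` decreases and its right side increases with `t`, so a
number `s` at which the left side still exceeds the right one is a lower bound of the root. -/
lemma le_hTree_root {d e : ℕ} (hde : e ≤ d) {s t : ℝ} (hs0 : 0 < s) (hs1 : s < 1) (ht0 : 0 < t)
    (ht : 1 - t ^ 2 - t ^ 4 = t ^ d * (t ^ 2 * (1 + t ^ 2 - t ^ 4)))
    (hs : s ^ e * (s ^ 2 * (1 + s ^ 2 - s ^ 4)) ≤ 1 - s ^ 2 - s ^ 4) : s ≤ t := by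
  by_contra! hlt
  have h2 : t ^ 2 < s ^ 2 := pow_lt_pow_left₀ hlt ht0.le (by norm_num)
  have h4 : t ^ 4 < s ^ 4 := pow_lt_pow_left₀ hlt ht0.le (by norm_num)
  have hs2 : s ^ 2 < 1 := pow_lt_one₀ hs0.le hs1 (by norm_num)
  have ht2 : 0 < t ^ 2 := by positivity
  have hd : t ^ d ≤ s ^ e := (pow_le_pow_of_le_one ht0.le (hlt.trans hs1).le hde).trans
    (pow_le_pow_left₀ ht0.le hlt.le e)
  have hmono : t ^ 2 * (1 + t ^ 2 - t ^ 4) ≤ s ^ 2 * (1 + s ^ 2 - s ^ 4) := by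
    have h4t : t ^ 4 = (t ^ 2) ^ 2 := by ring
    have h4s : s ^ 4 = (s ^ 2) ^ 2 := by ring
    rw [h4t, h4s]
    generalize t ^ 2 = a at *
    generalize s ^ 2 = b at *
    -- the difference is `(b - a) * (1 + (a + b) - (a ^ 2 + a * b + b ^ 2))`
    nlinarith [mul_pos (sub_pos.mpr h2) ht2, mul_nonneg (sub_nonneg.mpr h2.le)
      (by nlinarith : (0 : ℝ) ≤ 1 + (a + b) - (a ^ 2 + a * b + b ^ 2))]
  have hnn : 0 ≤ t ^ 2 * (1 + t ^ 2 - t ^ 4) := by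
    have : t ^ 4 ≤ t ^ 2 := pow_le_pow_of_le_one ht0.le (hlt.trans hs1).le (by norm_num)
    exact mul_nonneg ht2.le (by linarith)
  have := mul_le_mul hd hmono hnn (by positivity)
  linarith

lemma add_inv_le_add_inv {s t : ℝ} (hs0 : 0 < s) (hst : s ≤ t) (ht1 : t < 1) :
    t + t⁻¹ ≤ s + s⁻¹ := by
  have ht0 : 0 < t := hs0.trans_le hst
  have h : s + s⁻¹ - (t + t⁻¹) = (t - s) * (1 - s * t) / (s * t) := by field_simp; ring
  have : 0 ≤ (t - s) * (1 - s * t) / (s * t) :=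
    div_nonneg (mul_nonneg (sub_nonneg.mpr hst) (by nlinarith)) (by positivity)
  linarith

/-- An eigenvector of `hTree n` is determined by its values between the branch vertices, where it
satisfies a linear recurrence with a boundary condition at each end. -/
lemma hTree_eigenvector (hn : 11 ≤ n) {ν : ℝ} (hν : ν ^ 2 ≠ 1) {z : HVert n → ℝ}
    (hz : ∀ v, nbSum (hTree n) z v = ν * z v) :
    (ν ^ 2 - 1) * pathVal z 3 = ν * (ν ^ 2 - 3) * pathVal z 2 ∧
    (ν ^ 2 - 1) * pathVal z (n - 8) = ν * (ν ^ 2 - 3) * pathVal z (n - 7) ∧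
    (∀ k, 3 ≤ k → k ≤ n - 8 → ν * pathVal z k = pathVal z (k - 1) + pathVal z (k + 1)) ∧
    ((∀ k, 2 ≤ k → k ≤ n - 7 → pathVal z k = 0) → z = 0) := by
  have hν' : ν ^ 2 - 1 ≠ 0 := sub_ne_zero.mpr hν
  have p : ∀ k (h : k < n - 4), ν * pathVal z k = (if k = 0 then 0 else pathVal z (k - 1))
      + pathVal z (k + 1) + (if k = 2 then z (hArm 0 0) else 0)
      + (if k = n - 7 then z (hArm 1 0) else 0) := by
    intro k h
    rw [pathVal_of_lt z h, ← hz, nbSum_hTree_inl]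
  have q0 := p 0 (by omega)
  rw [if_pos rfl, if_neg (by omega), if_neg (by omega)] at q0
  have q1 := p 1 (by omega)
  rw [if_neg (by omega), if_neg (by omega), if_neg (by omega)] at q1
  have q2 := p 2 (by omega)
  rw [if_neg (by omega), if_pos rfl, if_neg (by omega)] at q2
  have q7 := p (n - 7) (by omega)
  rw [if_neg (by omega), if_neg (by omega), if_pos rfl, show n - 7 - 1 = n - 8 by omega,
    show n - 7 + 1 = n - 6 by omega] at q7
  have q6 := p (n - 6) (by omega)
  rw [if_neg (by omega), if_neg (by omega), if_neg (by omega), show n - 6 - 1 = n - 7 by omega,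
    show n - 6 + 1 = n - 5 by omega] at q6
  have q5 := p (n - 5) (by omega)
  rw [if_neg (by omega), if_neg (by omega), if_neg (by omega), show n - 5 - 1 = n - 6 by omega,
    show pathVal z (n - 5 + 1) = 0 by rw [pathVal, dif_neg (by omega)]] at q5
  have a00 : ν * z (hArm 0 0) = pathVal z 2 + z (hArm 0 1) := by
    rw [← hz, nbSum_hTree_arm_zero (by omega)]; rfl
  have a10 : ν * z (hArm 1 0) = pathVal z (n - 7) + z (hArm 1 1) := by
    rw [← hz, nbSum_hTree_arm_zero (by omega)]; rfl
  have a01 : ν * z (hArm 0 1) = z (hArm 0 0) := by rw [← hz, nbSum_hTree_arm_one]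
  have a11 : ν * z (hArm 1 1) = z (hArm 1 0) := by rw [← hz, nbSum_hTree_arm_one]
  norm_num at q0 q1 q2 q5
  refine ⟨?_, ?_, fun k h3 h8 => ?_, fun h0 => ?_⟩
  · linear_combination (-(ν ^ 2 - 1)) * q2 - ν * q1 - q0 - ν * a00 - a01
  · linear_combination (-(ν ^ 2 - 1)) * q7 - ν * q6 - q5 - ν * a10 - a11
  · have := p k (by omega)
    rw [if_neg (by omega), if_neg (by omega), if_neg (by omega)] at this
    linarith
  · have h2 := h0 2 (by omega) (by omega)
    have h7 := h0 (n - 7) (by omega) (by omega)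
    rw [h2] at a00 q1
    rw [h7] at a10 q6
    have h1 : pathVal z 1 = 0 := by
      have : (ν ^ 2 - 1) * pathVal z 1 = 0 := by linear_combination ν * q1 + q0
      exact (mul_eq_zero.mp this).resolve_left hν'
    have h6 : pathVal z (n - 6) = 0 := by
      have : (ν ^ 2 - 1) * pathVal z (n - 6) = 0 := by linear_combination ν * q6 + q5
      exact (mul_eq_zero.mp this).resolve_left hν'
    have b0 : z (hArm 0 0) = 0 := by
      have : (ν ^ 2 - 1) * z (hArm 0 0) = 0 := by linear_combination ν * a00 + a01
      exact (mul_eq_zero.mp this).resolve_left hν'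
    have b1 : z (hArm 1 0) = 0 := by
      have : (ν ^ 2 - 1) * z (hArm 1 0) = 0 := by linear_combination ν * a10 + a11
      exact (mul_eq_zero.mp this).resolve_left hν'
    rw [h1] at q1
    rw [h6] at q6
    rw [b0] at a00
    rw [b1] at a10
    funext v
    revert v
    refine hVert_cases (fun k hk => ?_) (fun i j => ?_)
    · rw [← pathVal_of_lt z hk, Pi.zero_apply]
      rcases (by omega : k = 0 ∨ k = 1 ∨ (2 ≤ k ∧ k ≤ n - 7) ∨ k = n - 6 ∨ k = n - 5) with
        rfl | rfl | h | rfl | rfl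
      · linarith
      · exact h1
      · exact h0 k h.1 h.2
      · exact h6
      · linarith
    · rw [Pi.zero_apply]
      fin_cases i <;> fin_cases j
      · exact b0
      · change z (hArm 0 1) = 0
        linarith
      · exact b1
      · change z (hArm 1 1) = 0
        linarith

/-- Between the branch vertices an eigenvector for `2` is affine, and the conditions at the two
branch vertices are compatible for `n = 15` only. -/
lemma not_isEig_two_hTree (hn : 11 ≤ n) (h15 : n ≠ 15) : ¬ IsEig (hTree n) 2 := by
  rintro ⟨z, hz0, hz⟩
  obtain ⟨e1, e2, e3, e4⟩ := hTree_eigenvector hn (by norm_num) hz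
  refine hz0 (e4 ?_)
  -- the values on the path form an arithmetic progression
  have hlin : ∀ j, j ≤ n - 9 → 3 * pathVal z (j + 2) = (3 - j) * pathVal z 2 ∧
      (j + 1 ≤ n - 9 → 3 * pathVal z (j + 3) = (3 - (j + 1)) * pathVal z 2) := by
    intro j
    induction j with
    | zero =>
      intro _
      refine ⟨by norm_num, fun _ => ?_⟩
      norm_num at e1 ⊢
      linarith
    | succ j ih =>
      intro hj
      obtain ⟨i1, i2⟩ := ih (by omega)
      have i2 := i2 hj
      refine ⟨by push_cast; exact i2, fun hj' => ?_⟩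
      have := e3 (j + 3) (by omega) (by omega)
      rw [show j + 3 - 1 = j + 2 by omega] at this
      push_cast
      rw [show j + 1 + 3 = j + 3 + 1 by ring]
      linarith
  have l1 := (hlin (n - 9) le_rfl).1
  have l2 := (hlin (n - 10) (by omega)).1
  rw [show n - 9 + 2 = n - 7 by omega, Nat.cast_sub (by omega)] at l1
  rw [show n - 10 + 2 = n - 8 by omega, Nat.cast_sub (by omega)] at l2
  push_cast at l1 l2
  have h15' : (15 : ℝ) - n ≠ 0 := sub_ne_zero.mpr (by exact_mod_cast h15.symm)
  have h0 : pathVal z 2 = 0 := by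
    have : (15 - (n : ℝ)) * pathVal z 2 = 0 := by linear_combination 3 * e2 - 3 * l2 + 2 * l1
    exact (mul_eq_zero.mp this).resolve_left h15'
  intro k hk hk'
  have := (hlin (k - 2) (by omega)).1
  rw [h0, mul_zero, show k - 2 + 2 = k by omega] at this
  linarith

/-- The largest eigenvalue of a hexagon with one pendant vertex is no eigenvalue of
`hTree 11` and `hTree 12`. -/
lemma not_isEig_hTree_small (hn : n = 11 ∨ n = 12) {ν : ℝ} (hν : ν ^ 4 - 6 * ν ^ 2 + 7 = 0) :
    ¬ IsEig (hTree n) ν := by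
  rintro ⟨z, hz0, hz⟩
  have hy1 : ν ^ 2 ≠ 1 := by
    intro h
    have : ν ^ 4 = (ν ^ 2) ^ 2 := by ring
    rw [this, h] at hν
    norm_num at hν
  obtain ⟨e1, e2, e3, e4⟩ := hTree_eigenvector (by omega) hy1 hz
  refine hz0 (e4 ?_)
  -- `ν ^ 2` is irrational, so `ν ^ 2 - a` can be cancelled for each rational `a`
  have hy : (ν ^ 2) ^ 2 - 6 * ν ^ 2 + 7 = 0 := by linear_combination hν
  have hroot : ∀ a : ℝ, a ^ 2 - 6 * a + 7 ≠ 0 → ν ^ 2 - a ≠ 0 := by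
    intro a ha h
    rw [sub_eq_zero.mp h] at hy
    exact ha hy
  have y1 := hroot 1 (by norm_num)
  have y3 := hroot 3 (by norm_num)
  have y4 := hroot 4 (by norm_num)
  have y5 := hroot 5 (by norm_num)
  have y0 : ν ≠ 0 := by
    rintro rfl
    norm_num at hν
  rcases hn with rfl | rfl
  · norm_num at e1 e2 e3
    have r3 := e3 3 le_rfl le_rfl
    norm_num at r3
    have h24 : pathVal z 4 = pathVal z 2 :=
      mul_left_cancel₀ (mul_ne_zero y0 y3) (e2.symm.trans e1)
    have h2 : pathVal z 2 = 0 := by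
      have : (ν ^ 2 - 5) * pathVal z 2 = 0 := by
        rw [h24] at r3
        linear_combination (-ν) * e1 + (ν ^ 2 - 1) * r3 - hν * pathVal z 2
      exact (mul_eq_zero.mp this).resolve_left y5
    have h3 : pathVal z 3 = 0 := by
      rw [h2, mul_zero] at e1
      exact (mul_eq_zero.mp e1).resolve_left y1
    intro k hk hk'
    norm_num at hk'
    interval_cases k
    exacts [h2, h3, h24.trans h2]
  · norm_num at e1 e2 e3
    have r3 := e3 3 le_rfl (by norm_num)
    have r4 := e3 4 (by norm_num) le_rfl
    norm_num at r3 r4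
    have s2 : 2 * (ν ^ 2 - 3) * pathVal z 2 = ν * (ν ^ 2 - 3) * pathVal z 5 := by
      linear_combination (-ν) * e1 + (ν ^ 2 - 1) * r3 + e2 - hν * pathVal z 2
    have s5 : 2 * (ν ^ 2 - 3) * pathVal z 5 = ν * (ν ^ 2 - 3) * pathVal z 2 := by
      linear_combination (-ν) * e2 + (ν ^ 2 - 1) * r4 + e1 - hν * pathVal z 5
    have t2 : 2 * pathVal z 2 = ν * pathVal z 5 :=
      mul_left_cancel₀ y3 (by linear_combination s2)
    have t5 : 2 * pathVal z 5 = ν * pathVal z 2 :=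
      mul_left_cancel₀ y3 (by linear_combination s5)
    have h2 : pathVal z 2 = 0 := by
      have : (ν ^ 2 - 4) * pathVal z 2 = 0 := by linear_combination (-2) * t2 - ν * t5
      exact (mul_eq_zero.mp this).resolve_left y4
    have h5 : pathVal z 5 = 0 := by
      rw [h2] at t5; linarith
    have h3 : pathVal z 3 = 0 := by
      rw [h2, mul_zero] at e1
      exact (mul_eq_zero.mp e1).resolve_left y1
    have h4 : pathVal z 4 = 0 := by
      rw [h5, mul_zero] at e2
      exact (mul_eq_zero.mp e2).resolve_left y1
    intro k hk hk'
    norm_num at hk'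
    interval_cases k
    exacts [h2, h3, h4, h5]

end HTreeSpectrum

/-! ### Degrees and short cycles of a cospectral graph -/

section Mates

open scoped Classical

/-- `G` is a graph cospectral with `hTree n`, where `n` is none of the exceptional orders. -/
structure HMate {V : Type*} [Fintype V] (n : ℕ) (G : SimpleGraph V) : Prop where
  le : 11 ≤ n
  ne13 : n ≠ 13
  ne15 : n ≠ 15
  spec : adjSpectrum G = adjSpectrum (hTree n)

lemma pow_apply_eq_zero_of_parity {V : Type*} [Fintype V] {G : SimpleGraph V} (l : V → ℕ)
    (hl : ∀ a b, G.Adj a b → (l a + l b) % 2 = 1) (k : ℕ) (i j : V)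
    (h : (l i + l j + k) % 2 = 1) : (G.adjMatrix ℝ ^ k) i j = 0 := by
  induction k generalizing j with
  | zero =>
    rw [pow_zero, Matrix.one_apply_ne]
    rintro rfl
    omega
  | succ k ih =>
    rw [pow_succ, SimpleGraph.mul_adjMatrix_apply]
    refine Finset.sum_eq_zero fun m hm => ih m ?_
    have := hl j m (by simpa using hm)
    omega

lemma trace_pow_eq_zero_of_parity {V : Type*} [Fintype V] {G : SimpleGraph V} (l : V → ℕ)
    (hl : ∀ a b, G.Adj a b → (l a + l b) % 2 = 1) {k : ℕ} (hk : k % 2 = 1) :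
    (G.adjMatrix ℝ ^ k).trace = 0 :=
  Finset.sum_eq_zero fun i _ => pow_apply_eq_zero_of_parity l hl k i i (by omega)

lemma hLevel_parity {n : ℕ} (a b : HVert n) (h : (hTree n).Adj a b) :
    (hLevel a + hLevel b) % 2 = 1 := by
  revert a b
  rintro (a | ⟨i, a⟩) (b | ⟨j, b⟩) h
  · have := SimpleGraph.pathGraph_adj.mp h
    simp only [hLevel]; omega
  · have : (a : ℕ) = (![2, n - 7] : Fin 2 → ℕ) j ∧ (b : ℕ) = 0 := h
    simp only [hLevel]; omega
  · have : (b : ℕ) = (![2, n - 7] : Fin 2 → ℕ) i ∧ (a : ℕ) = 0 := h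
    simp only [hLevel]; omega
  · have : i = j ∧ ((a : ℕ) + 1 = b ∨ (b : ℕ) + 1 = a) := h
    obtain ⟨rfl, h⟩ := this
    simp only [hLevel]; omega

variable {V : Type*} [Fintype V] {n : ℕ} {G : SimpleGraph V}

lemma nbSum_one (G : SimpleGraph V) (v : V) : nbSum G (fun _ => 1) v = G.degree v :=
  (degree_eq_nbSum G v).symm

lemma eigLe_two_of_degree_le (h : ∀ v, G.degree v ≤ 2) : EigLe G 2 := fun _ hν =>
  hν.le_of_supersolution (z := fun _ => 1) (fun _ => one_pos) fun v => by
    rw [nbSum_one, mul_one]; exact_mod_cast h v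

namespace HMate

lemma card_eq (h : HMate n G) : Fintype.card V = n := by
  have := h.le
  rw [card_eq_of_adjSpectrum_eq h.spec, card_hVert (by omega)]

lemma exists_root (h : HMate n G) : ∃ t : ℝ, 0 < t ∧ t < 1 ∧
    1 - t ^ 2 - t ^ 4 = t ^ (n - 9) * (t ^ 2 * (1 + t ^ 2 - t ^ 4)) ∧
    EigLe G (t + t⁻¹) ∧ IsEig G (t + t⁻¹) := by
  obtain ⟨t, ht0, ht1, ht⟩ := exists_hTree_root (n - 9)
  exact ⟨t, ht0, ht1, ht, (eigLe_hTree h.le ht0 ht).of_adjSpectrum_eq h.spec,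
    (isEig_hTree h.le ht0 ht).of_adjSpectrum_eq h.spec.symm⟩

/-- A lower bound `s` of the root `t` gives an upper bound `s + s⁻¹` for the eigenvalues. It is
used with numbers `s` slightly smaller than the roots for `n = 11`, `12` and `14`. -/
lemma eigLe_of_root_bound (h : HMate n G) {e : ℕ} (he : e ≤ n - 9) {s μ : ℝ} (hs0 : 0 < s)
    (hs1 : s < 1) (hs : s ^ e * (s ^ 2 * (1 + s ^ 2 - s ^ 4)) ≤ 1 - s ^ 2 - s ^ 4)
    (hμ : s + s⁻¹ ≤ μ) : EigLe G μ := by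
  obtain ⟨t, ht0, ht1, ht, hle, -⟩ := h.exists_root
  exact fun ν hν => ((hle ν hν).trans
    (add_inv_le_add_inv hs0 (le_hTree_root he hs0 hs1 ht0 ht hs) ht1)).trans hμ

lemma eigLe_of_eleven_le (h : HMate n G) : EigLe G 2.14 :=
  have := h.le
  h.eigLe_of_root_bound (e := 2) (by omega) (s := 0.69) (by norm_num) (by norm_num) (by norm_num)
    (by norm_num)

lemma eigLe_of_twelve_le (h : HMate n G) (hn : 12 ≤ n) : EigLe G 2.12 :=
  h.eigLe_of_root_bound (e := 3) (by omega) (s := 0.709) (by norm_num) (by norm_num) (by norm_num)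
    (by norm_num)

lemma eigLe_of_fourteen_le (h : HMate n G) (hn : 14 ≤ n) : EigLe G 2.092 :=
  h.eigLe_of_root_bound (e := 5) (by omega) (s := 0.7393) (by norm_num) (by norm_num)
    (by norm_num) (by norm_num)

lemma two_lt_add_inv {t : ℝ} (ht0 : 0 < t) (ht1 : t < 1) : 2 < t + t⁻¹ := by
  have : t + t⁻¹ - 2 = (1 - t) ^ 2 / t := by field_simp; ring
  have : 0 < (1 - t) ^ 2 / t := div_pos (pow_pos (by linarith) 2) ht0
  linarith

/-- The largest eigenvalue of `hTree 11`. -/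
lemma exists_eigLe_eleven (h : HMate 11 G) : ∃ μ : ℝ, 2 < μ ∧ μ ^ 4 - 5 * μ ^ 2 + 2 = 0 ∧
    EigLe G μ := by
  obtain ⟨t, ht0, ht1, ht, hle, -⟩ := h.exists_root
  refine ⟨_, two_lt_add_inv ht0 ht1, ?_, hle⟩
  norm_num at ht
  field_simp
  linear_combination ht

lemma not_isEig_two (h : HMate n G) : ¬ IsEig G 2 := fun h2 =>
  not_isEig_two_hTree h.le h.ne15 (h2.of_adjSpectrum_eq h.spec)

/-- The largest eigenvalue exceeds `2`. -/
lemma exists_two_lt_degree (h : HMate n G) : ∃ v, 2 < G.degree v := by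
  by_contra! hle
  obtain ⟨t, ht0, ht1, -, -, he⟩ := h.exists_root
  exact absurd (eigLe_two_of_degree_le hle _ he) (not_le.mpr (two_lt_add_inv ht0 ht1))

lemma not_cycIn_of_odd (h : HMate n G) {g : ℕ} (hg : g % 2 = 1) (c : ℕ → V) : ¬ CycIn G g c := by
  intro hc
  have := hc.trace_pow_pos
  rw [trace_pow_eq_of_adjSpectrum_eq h.spec,
    trace_pow_eq_zero_of_parity hLevel hLevel_parity hg] at this
  exact lt_irrefl _ this

lemma sum_degree (h : HMate n G) : ∑ v, (G.degree v : ℝ) = 2 * n - 2 := by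
  have := h.le
  rw [← trace_adjMatrix_sq, trace_pow_eq_of_adjSpectrum_eq h.spec, trace_adjMatrix_sq,
    sum_hTree_degree (by omega) (fun k => (k : ℝ))]
  push_cast
  ring

lemma sum_degree_sq (h : HMate n G) :
    2 * ∑ v, (G.degree v : ℝ) ^ 2 + quadDefect G = 2 * (4 * n - 2) := by
  have := h.le
  have h4 := trace_pow_eq_of_adjSpectrum_eq h.spec 4
  rw [trace_adjMatrix_pow_four, trace_adjMatrix_pow_four, h.sum_degree, quadDefect_hTree,
    sum_hTree_degree (by omega) (fun k => (k : ℝ)),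
    sum_hTree_degree (by omega) (fun k => (k : ℝ) ^ 2)] at h4
  push_cast at h4
  linarith

/-- The summands are nonnegative, and vanish for the degrees `1` and `2`, so that few vertices have
other degrees. -/
lemma sum_degree_quadratic (h : HMate n G) :
    ∑ v, ((G.degree v : ℝ) - 1) * (G.degree v - 2) + quadDefect G / 2 = 4 := by
  have h1 := h.sum_degree
  have h2 := h.sum_degree_sq
  have h3 : ∑ v, ((G.degree v : ℝ) - 1) * (G.degree v - 2)
      = ∑ v, (G.degree v : ℝ) ^ 2 - 3 * ∑ v, (G.degree v : ℝ) + 2 * Fintype.card V := by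
    rw [Finset.mul_sum, ← Finset.sum_sub_distrib, Fintype.card, ← nsmul_one, ← Finset.sum_const,
      Finset.mul_sum, ← Finset.sum_add_distrib]
    exact Finset.sum_congr rfl fun v _ => by ring
  rw [h.card_eq] at h3
  linarith

lemma sub_one_mul_sub_two_nonneg (k : ℕ) : (0 : ℝ) ≤ ((k : ℝ) - 1) * (k - 2) := by
  rcases (by omega : k = 0 ∨ k = 1 ∨ 2 ≤ k) with rfl | rfl | hk
  · norm_num
  · norm_num
  · have : (2 : ℝ) ≤ k := by exact_mod_cast hk
    exact mul_nonneg (by linarith) (by linarith)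

/-- A vertex of degree at least `3` contributes at least `2` to the sum in `sum_degree_quadratic`,
which leaves no room for a `4`-cycle. -/
lemma quadDefect_eq_zero (h : HMate n G) : quadDefect G = 0 := by
  by_contra hq
  have h8 := eight_le_quadDefect hq
  have hs := h.sum_degree_quadratic
  obtain ⟨v, hv⟩ := h.exists_two_lt_degree
  have h1 : ((G.degree v : ℝ) - 1) * (G.degree v - 2)
      ≤ ∑ v, ((G.degree v : ℝ) - 1) * (G.degree v - 2) :=
    Finset.single_le_sum (f := fun v => ((G.degree v : ℝ) - 1) * (G.degree v - 2))
      (fun w _ => sub_one_mul_sub_two_nonneg _) (Finset.mem_univ v)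
  have : (3 : ℝ) ≤ G.degree v := by exact_mod_cast hv
  nlinarith

lemma not_cycIn_four (h : HMate n G) (c : ℕ → V) : ¬ CycIn G 4 c := by
  intro hc
  obtain ⟨i, j, hij, hcn⟩ := cycIn_four_iff_two_le_cn.mp ⟨c, hc⟩
  have h0 := h.quadDefect_eq_zero
  have hnn : ∀ i j, 0 ≤ (if i = j then (0 : ℝ) else (cn G i j : ℝ) * (cn G i j - 1)) := by
    intro i j
    split_ifs
    exacts [le_rfl, nat_mul_sub_one_nonneg _]
  have h1 := (Finset.sum_eq_zero_iff_of_nonneg fun i _ =>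
    Finset.sum_nonneg fun j _ => hnn i j).mp h0 i (Finset.mem_univ _)
  have h2 := (Finset.sum_eq_zero_iff_of_nonneg fun j _ => hnn i j).mp h1 j (Finset.mem_univ _)
  rw [if_neg hij] at h2
  have : (2 : ℝ) ≤ cn G i j := by exact_mod_cast hcn
  nlinarith

lemma six_or_eight_le (h : HMate n G) {g : ℕ} {c : ℕ → V} (hc : CycIn G g c) :
    g = 6 ∨ 8 ≤ g := by
  have h3 := hc.three_le
  by_contra! hg
  obtain ⟨h6, h8⟩ := hg
  interval_cases g
  · exact h.not_cycIn_of_odd rfl c hc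
  · exact h.not_cycIn_four c hc
  · exact h.not_cycIn_of_odd rfl c hc
  · exact h6 rfl
  · exact h.not_cycIn_of_odd rfl c hc

lemma degree_le_three (h : HMate n G) (v : V) : G.degree v ≤ 3 := by
  by_contra! hv
  have hs := h.sum_degree_quadratic
  rw [h.quadDefect_eq_zero] at hs
  have h1 : ((G.degree v : ℝ) - 1) * (G.degree v - 2)
      ≤ ∑ v, ((G.degree v : ℝ) - 1) * (G.degree v - 2) :=
    Finset.single_le_sum (f := fun v => ((G.degree v : ℝ) - 1) * (G.degree v - 2))
      (fun w _ => sub_one_mul_sub_two_nonneg _) (Finset.mem_univ v)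
  have : (4 : ℝ) ≤ G.degree v := by exact_mod_cast hv
  nlinarith

/-- The set of vertices of degree `k`. -/
noncomputable def degSet {V : Type*} [Fintype V] (G : SimpleGraph V) (k : ℕ) : Finset V :=
  Finset.univ.filter fun v => G.degree v = k

lemma mem_degSet {k : ℕ} {v : V} : v ∈ degSet G k ↔ G.degree v = k := by simp [degSet]

lemma sum_degree_fun (h : HMate n G) (φ : ℕ → ℝ) : ∑ v, φ (G.degree v)
    = (degSet G 0).card * φ 0 + (degSet G 1).card * φ 1 + (degSet G 2).card * φ 2
      + (degSet G 3).card * φ 3 := by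
  have hmap : ∀ v ∈ (Finset.univ : Finset V), G.degree v ∈ Finset.range 4 := fun v _ => by
    have := h.degree_le_three v
    simp; omega
  rw [← Finset.sum_fiberwise_of_maps_to hmap]
  have : ∀ k, ∑ v ∈ Finset.univ.filter (fun v => G.degree v = k), φ (G.degree v)
      = (degSet G k).card * φ k := by
    intro k
    rw [← nsmul_eq_mul, ← Finset.sum_const]
    exact Finset.sum_congr rfl fun v hv => by rw [(Finset.mem_filter.mp hv).2]
  simp only [this, Finset.sum_range_succ, Finset.sum_range_zero, zero_add]

/-- A graph cospectral with `hTree n` either has the same degrees as `hTree n`, or a single vertex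
of degree `3`, a single leaf and a single isolated vertex. -/
lemma degree_cases (h : HMate n G) :
    ((degSet G 0).card = 0 ∧ (degSet G 1).card = 4 ∧ (degSet G 3).card = 2) ∨
    ((degSet G 0).card = 1 ∧ (degSet G 1).card = 1 ∧ (degSet G 3).card = 1) := by
  have hn := h.le
  have e0 := h.sum_degree_fun fun _ => 1
  have e1 := h.sum_degree_fun fun k => (k : ℝ)
  have e2 := h.sum_degree_fun fun k => ((k : ℝ) - 1) * (k - 2)
  have hs := h.sum_degree_quadratic
  rw [h.quadDefect_eq_zero, e2] at hs
  rw [h.sum_degree] at e1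
  rw [Finset.sum_const, Finset.card_univ, h.card_eq, nsmul_one] at e0
  have hpos : 0 < (degSet G 3).card := by
    obtain ⟨v, hv⟩ := h.exists_two_lt_degree
    exact Finset.card_pos.mpr ⟨v, mem_degSet.mpr (le_antisymm (h.degree_le_three v) hv)⟩
  generalize (degSet G 0).card = a at *
  generalize (degSet G 1).card = b at *
  generalize (degSet G 2).card = c at *
  generalize (degSet G 3).card = d at *
  have f2 : 2 * a + 2 * d = 4 := by
    have : (2 * a + 2 * d : ℝ) = 4 := by push_cast at hs; linarith
    exact_mod_cast this
  have f0 : n = a + b + c + d := by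
    have : (n : ℝ) = a + b + c + d := by linarith
    exact_mod_cast this
  have f1 : 2 * n = b + 2 * c + 3 * d + 2 := by
    have : (2 * n : ℝ) = b + 2 * c + 3 * d + 2 := by push_cast at e1; linarith
    exact_mod_cast this
  omega

/-- The equality of the sixth traces. -/
lemma trace_six (h : HMate n G) :
    3 * edgeExcess G + 2 * ∑ v, (G.degree v : ℝ) ^ 3 + hexDefect G = 16 * n + 20 := by
  have hn := h.le
  have h6 := trace_pow_eq_of_adjSpectrum_eq h.spec 6
  have h2 := h.sum_degree_sq
  rw [h.quadDefect_eq_zero] at h2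
  rw [trace_adjMatrix_pow_six h.not_cycIn_four, trace_adjMatrix_pow_six (hTree_not_cycIn 4),
    h.sum_degree, hexDefect_hTree, edgeExcess_hTree h.le,
    sum_hTree_degree (by omega) (fun k => (k : ℝ)),
    sum_hTree_degree (by omega) (fun k => (k : ℝ) ^ 2),
    sum_hTree_degree (by omega) (fun k => (k : ℝ) ^ 3)] at h6
  push_cast at h6
  linarith

lemma exists_hexagon_of_hexDefect_ne_zero (h : HMate n G) (hh : hexDefect G ≠ 0) :
    ∃ c, CycIn G 6 c :=
  cycIn_six_of_hexDefect_ne_zero (h.not_cycIn_of_odd rfl) h.not_cycIn_four hh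

/-- With a single branch vertex and a single leaf, `edgeExcess` cannot be positive, which forces a
hexagon. -/
lemma exists_hexagon (h : HMate n G) (h1 : (degSet G 1).card = 1) (h3 : (degSet G 3).card = 1)
    (h0 : (degSet G 0).card = 1) : ∃ c, CycIn G 6 c := by
  apply h.exists_hexagon_of_hexDefect_ne_zero
  have hn := h.le
  have hW : edgeExcess G ≤ 0 := by
    refine Finset.sum_nonpos fun a _ => Finset.sum_nonpos fun b _ => ?_
    split_ifs with hab
    · have hpos : ∀ x y, G.Adj x y → 1 ≤ G.degree x := fun x y hxy =>
        (SimpleGraph.degree_pos_iff_exists_adj _ _).mpr ⟨y, hxy⟩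
      have ha1 := hpos a b hab
      have hb1 := hpos b a hab.symm
      have ha3 := h.degree_le_three a
      have hb3 := h.degree_le_three b
      by_cases hd : G.degree a = G.degree b
      · have h2 : G.degree a = 2 := by
          by_contra hne
          rcases (by omega : G.degree a = 1 ∨ G.degree a = 3) with hd1 | hd3
          · exact hab.ne (Finset.card_le_one.mp h1.le a (mem_degSet.mpr hd1) b
              (mem_degSet.mpr (hd ▸ hd1)))
          · exact hab.ne (Finset.card_le_one.mp h3.le a (mem_degSet.mpr hd3) b
              (mem_degSet.mpr (hd ▸ hd3)))
        rw [h2]; norm_num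
      · generalize G.degree a = x at *
        generalize G.degree b = y at *
        interval_cases x <;> interval_cases y <;> first | omega | norm_num
    · exact le_rfl
  have hs := h.trace_six
  have e0 := h.sum_degree_fun fun _ => 1
  rw [Finset.sum_const, Finset.card_univ, h.card_eq, nsmul_one] at e0
  rw [h.sum_degree_fun fun k => (k : ℝ) ^ 3] at hs
  rw [h1, h3, h0] at hs e0
  push_cast at hs e0
  intro hM
  rw [hM] at hs
  linarith

/-- When `G` has two branch vertices `u` and `v`, the number of hexagons is determined by the
adjacencies between vertices of odd degree. -/
lemma hexDefect_eq (h : HMate n G) (h0 : (degSet G 0).card = 0) (h1 : (degSet G 1).card = 4)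
    {u v : V} (huv : u ≠ v) (h3 : degSet G 3 = {u, v}) :
    hexDefect G = 6 * ((G.neighborFinset u ∩ degSet G 1).card
        + (G.neighborFinset v ∩ degSet G 1).card) - 6 * (if G.Adj u v then 1 else 0)
      - 3 * ∑ l ∈ degSet G 1, ((G.neighborFinset l ∩ degSet G 1).card : ℝ) := by
  have hd : ∀ a, (G.degree a : ℝ) - 2
      = (if a ∈ degSet G 3 then 1 else 0) - (if a ∈ degSet G 1 then 1 else 0) := by
    intro a
    have ha0 : G.degree a ≠ 0 := fun h' => by
      rw [Finset.card_eq_zero] at h0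
      exact Finset.notMem_empty a (h0 ▸ mem_degSet.mpr h')
    have ha3 := h.degree_le_three a
    simp only [mem_degSet]
    generalize G.degree a = x at *
    interval_cases x <;> first | omega | norm_num
  have hE : ∀ X Y : Finset V, ∑ i, ∑ j, (if G.Adj i j then (if i ∈ X then (1 : ℝ) else 0) *
      (if j ∈ Y then 1 else 0) else 0) = ∑ i ∈ X, ((G.neighborFinset i ∩ Y).card : ℝ) := by
    intro X Y
    rw [← Finset.sum_filter_add_sum_filter_not Finset.univ (· ∈ X), Finset.filter_univ_mem]
    rw [Finset.sum_eq_zero (s := Finset.univ.filter fun i => i ∉ X), add_zero]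
    · refine Finset.sum_congr rfl fun i hi => ?_
      rw [← Finset.filter_mem_eq_inter, SimpleGraph.neighborFinset_eq_filter, Finset.filter_filter,
        ← Finset.sum_boole]
      refine Finset.sum_congr rfl fun j _ => ?_
      rw [if_pos hi, one_mul]
      split_ifs <;> simp_all
    · intro i hi
      rw [Finset.mem_filter] at hi
      refine Finset.sum_eq_zero fun j _ => ?_
      rw [if_neg hi.2, zero_mul, ite_self]
  have hsymm : ∀ X Y : Finset V, ∑ i ∈ X, ((G.neighborFinset i ∩ Y).card : ℝ)
      = ∑ i ∈ Y, ((G.neighborFinset i ∩ X).card : ℝ) := by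
    intro X Y
    rw [← hE, ← hE, Finset.sum_comm]
    refine Finset.sum_congr rfl fun i _ => Finset.sum_congr rfl fun j _ => ?_
    rw [mul_comm]
    simp only [SimpleGraph.adj_comm]
  have hW : edgeExcess G = ∑ i ∈ degSet G 3, ((G.neighborFinset i ∩ degSet G 3).card : ℝ)
      - 2 * ∑ i ∈ degSet G 3, ((G.neighborFinset i ∩ degSet G 1).card : ℝ)
      + ∑ i ∈ degSet G 1, ((G.neighborFinset i ∩ degSet G 1).card : ℝ) := by
    have e : edgeExcess G = ∑ i ∈ degSet G 3, ((G.neighborFinset i ∩ degSet G 3).card : ℝ)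
        - ∑ i ∈ degSet G 3, ((G.neighborFinset i ∩ degSet G 1).card : ℝ)
        - ∑ i ∈ degSet G 1, ((G.neighborFinset i ∩ degSet G 3).card : ℝ)
        + ∑ i ∈ degSet G 1, ((G.neighborFinset i ∩ degSet G 1).card : ℝ) := by
      simp only [← hE, ← Finset.sum_sub_distrib, ← Finset.sum_add_distrib, edgeExcess, hd]
      refine Finset.sum_congr rfl fun i _ => Finset.sum_congr rfl fun j _ => ?_
      by_cases hij : G.Adj i j
      · simp only [hij, if_true]; ring
      · simp only [hij, if_false]; ring
    rw [e, hsymm (degSet G 1) (degSet G 3)]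
    ring
  have hN : ∀ a b, G.degree a = 3 → (degSet G 3 = {a, b}) →
      ((G.neighborFinset a ∩ degSet G 3).card : ℝ) = if G.Adj a b then 1 else 0 := by
    intro a b _ hab
    have : G.neighborFinset a ∩ degSet G 3 = if G.Adj a b then {b} else ∅ := by
      ext w
      rw [hab, Finset.mem_inter, SimpleGraph.mem_neighborFinset, Finset.mem_insert,
        Finset.mem_singleton]
      split_ifs with hadj
      · rw [Finset.mem_singleton]
        refine ⟨fun hw => hw.2.resolve_left ?_, ?_⟩
        · rintro rfl
          exact G.loopless.irrefl _ hw.1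
        · rintro rfl
          exact ⟨hadj, Or.inr rfl⟩
      · refine ⟨fun hw => ?_, fun hw => absurd hw (Finset.notMem_empty w)⟩
        rcases hw with ⟨h1, rfl | rfl⟩
        · exact absurd h1 (G.loopless.irrefl _)
        · exact absurd h1 hadj
    rw [this]
    split_ifs <;> simp
  have hu : G.degree u = 3 := mem_degSet.mp (by rw [h3]; simp)
  have hv : G.degree v = 3 := mem_degSet.mp (by rw [h3]; simp)
  have hs := h.trace_six
  have e0 := h.sum_degree_fun fun _ => 1
  rw [Finset.sum_const, Finset.card_univ, h.card_eq, nsmul_one] at e0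
  rw [h.sum_degree_fun fun k => (k : ℝ) ^ 3] at hs
  have h3c : (degSet G 3).card = 2 := by rw [h3, Finset.card_pair huv]
  rw [h1, h3c, h0] at hs e0
  have hvu : G.Adj v u ↔ G.Adj u v := G.adj_comm v u
  have hsum3 : ∀ f : V → ℝ, ∑ i ∈ degSet G 3, f i = f u + f v := fun f => by
    rw [h3, Finset.sum_pair huv]
  rw [hW, hsum3, hsum3, hN u v hu h3, hN v u hv (by rw [h3, Finset.pair_comm])] at hs
  simp only [hvu] at hs
  push_cast at hs e0
  linarith

end HMate

end Mates

/-! ### Test functions on cycles with attached vertices -/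

section DecoratedCycles

open scoped Classical

variable {V : Type*} {G : SimpleGraph V} {ι : Type*}

/-- The neighbours in a cycle of length `g` together with extra vertices indexed by `ι`: the extra
vertices `P i` are attached to the vertex `i` of the cycle, and `R` records the adjacencies among
the extra vertices. -/
noncomputable def decoNbr (g : ℕ) (P : ℕ → Finset ι) (R : ι → Finset ι) :
    Fin g ⊕ ι → Finset (Fin g ⊕ ι)
  | .inl i => ({⟨(i + 1) % g, Nat.mod_lt _ i.pos⟩, ⟨(i + (g - 1)) % g, Nat.mod_lt _ i.pos⟩} :
      Finset (Fin g)).disjSum (P i)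
  | .inr j => (Finset.univ.filter fun i : Fin g => j ∈ P i).disjSum (R j)

/-- The map into `V` describing a cycle with extra vertices. -/
def decoMap (g : ℕ) (c : ℕ → V) (w : ι → V) : Fin g ⊕ ι → V
  | .inl i => c i
  | .inr j => w j

/-- The function on a cycle with extra vertices with the given values. -/
def decoFun (g : ℕ) (X : ℕ → ℝ) (Y : ι → ℝ) : Fin g ⊕ ι → ℝ
  | .inl i => X i
  | .inr j => Y j

lemma decoMap_injective {g : ℕ} {c : ℕ → V} (hc : CycIn G g c) {w : ι → V}
    (hw : ∀ j, ∀ i < g, c i ≠ w j) (hwi : Function.Injective w) :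
    Function.Injective (decoMap g c w) := by
  rintro (i | i) (j | j) h
  · exact congrArg _ (Fin.ext (hc.inj i i.2 j j.2 h))
  · exact absurd h (hw j i i.2)
  · exact absurd h.symm (hw i j j.2)
  · exact congrArg _ (hwi h)

lemma CycIn.adj_prev {g : ℕ} {c : ℕ → V} (hc : CycIn G g c) {i : ℕ} (hi : i < g) :
    G.Adj (c i) (c ((i + (g - 1)) % g)) := by
  have h3 := hc.three_le
  have := hc.adj_mod (Nat.mod_lt (i + (g - 1)) (by omega : 0 < g))
  rw [Nat.mod_add_mod, show i + (g - 1) + 1 = i + g by omega, Nat.add_mod_right,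
    Nat.mod_eq_of_lt hi] at this
  exact this.symm

lemma decoNbr_adj {g : ℕ} {c : ℕ → V} (hc : CycIn G g c) {w : ι → V} {P : ℕ → Finset ι}
    (hP : ∀ i < g, ∀ j ∈ P i, G.Adj (c i) (w j)) {R : ι → Finset ι}
    (hR : ∀ i, ∀ j ∈ R i, G.Adj (w i) (w j)) (a : Fin g ⊕ ι) :
    ∀ b ∈ decoNbr g P R a, G.Adj (decoMap g c w a) (decoMap g c w b) := by
  rcases a with i | j <;> rintro (k | k) hk <;>
    simp only [decoNbr, Finset.inl_mem_disjSum, Finset.inr_mem_disjSum, Finset.mem_insert,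
      Finset.mem_singleton, Finset.mem_filter, Finset.mem_univ, true_and] at hk
  · rcases hk with rfl | rfl
    · exact hc.adj_mod i.2
    · exact hc.adj_prev i.2
  · exact hP i i.2 k hk
  · exact (hP k k.2 j hk).symm
  · exact hR j k hk

lemma mod_succ_ne_mod_pred {g i : ℕ} (hg : 3 ≤ g) : (i + 1) % g ≠ (i + (g - 1)) % g := by
  intro h
  have h2 : 1 ≡ g - 1 [MOD g] := Nat.ModEq.add_left_cancel' i h
  rw [Nat.ModEq, Nat.mod_eq_of_lt (by omega), Nat.mod_eq_of_lt (by omega)] at h2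
  omega

lemma card_decoNbr_inl {g : ℕ} (hg : 3 ≤ g) (P : ℕ → Finset ι) (R : ι → Finset ι) (i : Fin g) :
    (decoNbr g P R (.inl i)).card = 2 + (P i).card := by
  rw [decoNbr, Finset.card_disjSum, Finset.card_pair]
  exact fun h => mod_succ_ne_mod_pred hg (congrArg Fin.val h)

lemma sum_decoNbr_inl {g : ℕ} (hg : 3 ≤ g) (P : ℕ → Finset ι) (R : ι → Finset ι) (X : ℕ → ℝ)
    (Y : ι → ℝ) (i : Fin g) : ∑ b ∈ decoNbr g P R (.inl i), decoFun g X Y b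
      = X ((i + 1) % g) + X ((i + (g - 1)) % g) + ∑ j ∈ P i, Y j := by
  rw [decoNbr, Finset.sum_disjSum, Finset.sum_pair]
  · rfl
  · exact fun h => mod_succ_ne_mod_pred hg (congrArg Fin.val h)

lemma sum_decoNbr_inr {g : ℕ} (P : ℕ → Finset ι) (R : ι → Finset ι) (X : ℕ → ℝ)
    (Y : ι → ℝ) (j : ι) : ∑ b ∈ decoNbr g P R (.inr j), decoFun g X Y b
      = (∑ i ∈ Finset.range g, if j ∈ P i then X i else 0) + ∑ k ∈ R j, Y k := by
  rw [decoNbr, Finset.sum_disjSum, Finset.sum_filter,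
    ← Fin.sum_univ_eq_sum_range (fun i => if j ∈ P i then X i else 0)]
  rfl

/-- The data of a positive subsolution for `μ` on a cycle of length `g` with extra vertices. The
values `X i` on the cycle are extended by `X g = X 0`. -/
structure DecoSub (g : ℕ) (P : ℕ → Finset ι) (R : ι → Finset ι) (μ : ℝ) (X : ℕ → ℝ)
    (Y : ι → ℝ) : Prop where
  per : X g = X 0
  posX : ∀ i < g, 0 < X i
  posY : ∀ j, 0 < Y j
  zero : μ * X 0 ≤ X 1 + X (g - 1) + ∑ j ∈ P 0, Y j
  succ : ∀ i, i + 1 < g → μ * X (i + 1) ≤ X (i + 2) + X i + ∑ j ∈ P (i + 1), Y j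
  extra : ∀ j, μ * Y j ≤ (∑ i ∈ Finset.range g, if j ∈ P i then X i else 0) + ∑ k ∈ R j, Y k

lemma DecoSub.pos {g : ℕ} {P : ℕ → Finset ι} {R : ι → Finset ι} {μ : ℝ} {X : ℕ → ℝ} {Y : ι → ℝ}
    (h : DecoSub g P R μ X Y) (a : Fin g ⊕ ι) : 0 < decoFun g X Y a := by
  rcases a with i | j
  · exact h.posX i i.2
  · exact h.posY j

lemma sum_decoNbr_zero {g : ℕ} (hg : 3 ≤ g) (P : ℕ → Finset ι) (R : ι → Finset ι) (X : ℕ → ℝ)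
    (Y : ι → ℝ) (h0 : 0 < g) : ∑ b ∈ decoNbr g P R (.inl ⟨0, h0⟩), decoFun g X Y b
      = X 1 + X (g - 1) + ∑ j ∈ P 0, Y j := by
  rw [sum_decoNbr_inl hg, Nat.mod_eq_of_lt (by simp only; omega),
    Nat.mod_eq_of_lt (by simp only; omega)]
  simp

lemma sum_decoNbr_succ {g : ℕ} (hg : 3 ≤ g) (P : ℕ → Finset ι) (R : ι → Finset ι) {X : ℕ → ℝ}
    (hX : X g = X 0) (Y : ι → ℝ) {i : ℕ} (hi : i + 1 < g) :
    ∑ b ∈ decoNbr g P R (.inl ⟨i + 1, hi⟩), decoFun g X Y b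
      = X (i + 2) + X i + ∑ j ∈ P (i + 1), Y j := by
  have e1 : X ((i + 1 + 1) % g) = X (i + 2) := by
    rcases Nat.lt_or_ge (i + 2) g with h | h
    · rw [Nat.mod_eq_of_lt h]
    · obtain rfl : g = i + 2 := by omega
      rw [show i + 1 + 1 = i + 2 from rfl, Nat.mod_self, hX]
  have e2 : (i + 1 + (g - 1)) % g = i := by
    rw [show i + 1 + (g - 1) = i + g by omega, Nat.add_mod_right, Nat.mod_eq_of_lt (by omega)]
  rw [sum_decoNbr_inl hg]
  simp only [e1, e2]

lemma DecoSub.le_sum {g : ℕ} {P : ℕ → Finset ι} {R : ι → Finset ι} {μ : ℝ} {X : ℕ → ℝ}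
    {Y : ι → ℝ} (h : DecoSub g P R μ X Y) (hg : 3 ≤ g) (a : Fin g ⊕ ι) :
    μ * decoFun g X Y a ≤ ∑ b ∈ decoNbr g P R a, decoFun g X Y b := by
  rcases a with ⟨i, hi⟩ | j
  · rcases i with _ | i
    · rw [sum_decoNbr_zero hg]; exact h.zero
    · rw [sum_decoNbr_succ hg P R h.per Y hi]; exact h.succ i hi
  · rw [sum_decoNbr_inr]; exact h.extra j

variable [Fintype V] [Fintype ι]

lemma DecoSub.le_of_eigLe {g : ℕ} {P : ℕ → Finset ι} {R : ι → Finset ι} {μ ν : ℝ} {X : ℕ → ℝ}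
    {Y : ι → ℝ} (h : DecoSub g P R μ X Y) (hG : EigLe G ν) {c : ℕ → V} (hc : CycIn G g c)
    {w : ι → V} (hw : ∀ j, ∀ i < g, c i ≠ w j) (hwi : Function.Injective w)
    (hP : ∀ i < g, ∀ j ∈ P i, G.Adj (c i) (w j)) (hR : ∀ i, ∀ j ∈ R i, G.Adj (w i) (w j)) :
    μ ≤ ν := by
  have h3 := hc.three_le
  have : Nonempty (Fin g ⊕ ι) := ⟨.inl ⟨0, by omega⟩⟩
  exact hG.le_of_subsolution (decoMap_injective hc hw hwi) (decoNbr_adj hc hP hR) h.pos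
    (h.le_sum h3)

/-- If the eigenvalues of `G` are at most `μ`, a decorated cycle with a positive subsolution for `μ`
is a union of components of `G`. -/
lemma DecoSub.neighborFinset_eq {g : ℕ} {P : ℕ → Finset ι} {R : ι → Finset ι} {μ : ℝ}
    {X : ℕ → ℝ} {Y : ι → ℝ} (h : DecoSub g P R μ X Y) (hG : EigLe G μ) {c : ℕ → V}
    (hc : CycIn G g c) {w : ι → V} (hw : ∀ j, ∀ i < g, c i ≠ w j) (hwi : Function.Injective w)
    (hP : ∀ i < g, ∀ j ∈ P i, G.Adj (c i) (w j)) (hR : ∀ i, ∀ j ∈ R i, G.Adj (w i) (w j))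
    (a : Fin g ⊕ ι) :
    G.neighborFinset (decoMap g c w a) = (decoNbr g P R a).image (decoMap g c w) :=
  hG.neighborFinset_eq_image (decoMap_injective hc hw hwi) (decoNbr_adj hc hP hR) h.pos
    (h.le_sum hc.three_le) a

/-- A cycle with a pendant path of two vertices, for which the largest eigenvalue exceeds
`2.093` whatever the length of the cycle. Along the cycle the function is a combination of
`t ^ i` and `t ^ (-i)` with `t + t⁻¹ ≥ 2.093`, which is more than the largest eigenvalue of
`hTree n` for `n ≥ 14`. -/
lemma decoSub_tail {g : ℕ} (hg : 3 ≤ g) : DecoSub g (fun i => if i = 0 then {0} else ∅)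
    (![{1}, {0}] : Fin 2 → Finset (Fin 2)) 2.093
    (fun i => (0.737 : ℝ) ^ i + 0.737 ^ (g - i))
    ![0.61911 * (1 + 0.737 ^ g), 0.2958 * (1 + 0.737 ^ g)] where
  per := by simp [add_comm]
  posX i _ := by positivity
  posY j := by fin_cases j <;> simp <;> positivity
  zero := by
    obtain ⟨m, rfl⟩ : ∃ m, g = m + 1 := ⟨g - 1, by omega⟩
    have : (0 : ℝ) < 0.737 ^ m := by positivity
    simp only [if_true, Finset.sum_singleton, Matrix.cons_val_zero, pow_zero, Nat.sub_zero,
      Nat.add_sub_cancel, Nat.add_sub_cancel_left, pow_succ, one_mul]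
    linarith
  succ i hi := by
    obtain ⟨m, rfl⟩ : ∃ m, g = i + m + 2 := ⟨g - i - 2, by omega⟩
    have h1 : (0 : ℝ) < 0.737 ^ i := by positivity
    have h2 : (0 : ℝ) < 0.737 ^ m := by positivity
    rw [if_neg (by omega), Finset.sum_empty, show i + m + 2 - (i + 1) = m + 1 by omega,
      show i + m + 2 - (i + 2) = m by omega, show i + m + 2 - i = m + 2 by omega]
    simp only [pow_succ]
    linarith
  extra j := by
    have h1 : (0 : ℝ) < 0.737 ^ g := by positivity
    fin_cases j
    · rw [Finset.sum_eq_single_of_mem 0 (by simp; omega)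
        (fun i _ hi => by rw [if_neg hi]; simp)]
      simp
      linarith
    · rw [Finset.sum_eq_zero (fun i _ => by split_ifs <;> simp_all)]
      simp
      linarith

/-- A cycle with pendant vertices at the adjacent vertices `0` and `g - 1`. The largest eigenvalue
exceeds `2.145`, hence that of `hTree n` for `n ≥ 11`, whatever the length of the cycle. -/
lemma decoSub_pendants {g : ℕ} (hg : 3 ≤ g) :
    DecoSub g (fun i => if i = 0 then {0} else if i = g - 1 then {1} else ∅)
    (fun _ : Fin 2 => ∅) 2.145
    (fun i => if i = g then 1 + (0.68 : ℝ) ^ (g - 1) else 0.68 ^ i + 0.68 ^ (g - 1 - i))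
    (fun _ => 0.466 * (1 + 0.68 ^ (g - 1))) where
  per := by rw [if_pos rfl, if_neg (by omega)]; simp
  posX i _ := by
    split_ifs <;> positivity
  posY j := by positivity
  zero := by
    obtain ⟨m, rfl⟩ : ∃ m, g = m + 2 := ⟨g - 2, by omega⟩
    have : (0 : ℝ) < 0.68 ^ m := by positivity
    rw [if_neg (by omega), if_neg (by omega), if_neg (by omega)]
    simp only [if_true, Finset.sum_singleton, pow_zero, Nat.sub_zero,
      show m + 2 - 1 = m + 1 by omega, show m + 1 - 1 = m by omega, Nat.sub_self, pow_succ,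
      one_mul]
    linarith
  succ i hi := by
    rw [if_neg (by omega : i + 1 ≠ g), if_neg (by omega : i ≠ g), if_neg (by omega : i + 1 ≠ 0)]
    by_cases hlast : i + 2 = g
    · subst hlast
      have : (0 : ℝ) < 0.68 ^ i := by positivity
      rw [if_pos rfl, if_pos (by omega), Finset.sum_singleton]
      simp only [show i + 2 - 1 = i + 1 by omega, Nat.sub_self, Nat.add_sub_cancel_left, pow_zero,
        pow_succ, one_mul]
      linarith
    · rw [if_neg hlast, if_neg (by omega), Finset.sum_empty]
      obtain ⟨m, rfl⟩ : ∃ m, g = i + m + 3 := ⟨g - i - 3, by omega⟩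
      have h1 : (0 : ℝ) < 0.68 ^ i := by positivity
      have h2 : (0 : ℝ) < 0.68 ^ m := by positivity
      rw [show i + m + 3 - 1 - (i + 1) = m + 1 by omega,
        show i + m + 3 - 1 - (i + 2) = m by omega, show i + m + 3 - 1 - i = m + 2 by omega]
      simp only [pow_succ]
      linarith
  extra j := by
    have h1 : (0 : ℝ) < 0.68 ^ (g - 1) := by positivity
    fin_cases j
    · rw [Finset.sum_eq_single_of_mem 0 (by simp; omega)
        (fun i _ hi => by apply if_neg; rw [if_neg hi]; split_ifs <;> simp)]
      simp [show (0 : ℕ) ≠ g by omega]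
      linarith
    · rw [Finset.sum_eq_single_of_mem (g - 1) (by simp; omega)
        (fun i _ hi => by apply if_neg; split_ifs <;> simp)]
      simp [show g - 1 ≠ 0 by omega, show g - 1 ≠ g by omega]
      linarith

/-- Six prescribed values, continued periodically. -/
def hexVal (a0 a1 a2 a3 a4 a5 : ℝ) : ℕ → ℝ
  | 0 => a0 | 1 => a1 | 2 => a2 | 3 => a3 | 4 => a4 | 5 => a5 | _ => a0

/-- A hexagon with a pendant path of two vertices; the function is an eigenvector. -/
lemma decoSub_hexagon_tail {μ : ℝ} (h2 : 2.13 < μ) (hμ : μ ^ 4 - 5 * μ ^ 2 + 2 = 0) :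
    DecoSub 6 (fun i => if i = 0 then {0} else ∅)
    (![{1}, {0}] : Fin 2 → Finset (Fin 2)) μ
    (hexVal (μ ^ 2 - 1) (μ * (μ ^ 2 - 2) / 2) (μ ^ 2 / 2) μ (μ ^ 2 / 2) (μ * (μ ^ 2 - 2) / 2))
    ![μ, 1] := by
  have hp1 : 0 < μ ^ 2 - 1 := by nlinarith
  have hp2 : 0 < μ ^ 2 - 2 := by nlinarith
  refine ⟨rfl, fun i hi => ?_, fun j => ?_, ?_, fun i hi => ?_, fun j => ?_⟩
  · interval_cases i <;> simp only [hexVal] <;> positivity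
  · fin_cases j <;> simp
    linarith
  · simp [hexVal]
    linarith
  · have : i < 5 := by omega
    interval_cases i <;> simp [hexVal] <;> linarith
  · fin_cases j <;> simp [Finset.sum_range_succ, hexVal]
    linarith

/-- A hexagon with a pendant vertex; the function is an eigenvector. -/
lemma decoSub_hexagon_pendant {μ : ℝ} (h2 : 2 < μ) (hμ : μ ^ 4 - 6 * μ ^ 2 + 7 = 0) :
    DecoSub 6 (fun i => if i = 0 then {0} else ∅)
    (fun _ : Fin 1 => ∅) μ
    (hexVal μ ((μ ^ 2 - 1) / 2) (μ * (μ ^ 2 - 3) / 2) (μ ^ 2 - 3) (μ * (μ ^ 2 - 3) / 2)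
      ((μ ^ 2 - 1) / 2)) (fun _ => 1) := by
  have hp1 : 0 < μ ^ 2 - 1 := by nlinarith
  have hp2 : 0 < μ ^ 2 - 3 := by nlinarith
  refine ⟨rfl, fun i hi => ?_, fun j => ?_, ?_, fun i hi => ?_, fun j => ?_⟩
  · interval_cases i <;> simp only [hexVal] <;> positivity
  · exact one_pos
  · simp [hexVal]
    linarith
  · have : i < 5 := by omega
    interval_cases i <;> simp [hexVal] <;> linarith
  · fin_cases j
    simp [Finset.sum_range_succ, hexVal]

lemma hexVal_pendant_eq {μ : ℝ} (hμ : μ ^ 4 - 6 * μ ^ 2 + 7 = 0) (a : Fin 6 ⊕ Fin 1) :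
    ∑ b ∈ decoNbr 6 (fun i => if i = 0 then {0} else ∅) (fun _ : Fin 1 => ∅) a,
      decoFun 6 (hexVal μ ((μ ^ 2 - 1) / 2) (μ * (μ ^ 2 - 3) / 2) (μ ^ 2 - 3)
        (μ * (μ ^ 2 - 3) / 2) ((μ ^ 2 - 1) / 2)) (fun _ => 1) b
      = μ * decoFun 6 (hexVal μ ((μ ^ 2 - 1) / 2) (μ * (μ ^ 2 - 3) / 2) (μ ^ 2 - 3)
        (μ * (μ ^ 2 - 3) / 2) ((μ ^ 2 - 1) / 2)) (fun _ => 1) a := by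
  rcases a with ⟨i, hi⟩ | j
  · rcases i with _ | i
    · rw [sum_decoNbr_zero (by norm_num)]
      simp [hexVal, decoFun]
      linarith
    · rw [sum_decoNbr_succ (g := 6) (by norm_num) _ _ rfl _ hi]
      have : i < 5 := by omega
      interval_cases i <;> simp [hexVal, decoFun] <;> linarith
  · rw [sum_decoNbr_inr]
    fin_cases j
    simp [Finset.sum_range_succ, hexVal, decoFun]

/-- A hexagon with pendant vertices at two vertices at distance `2`. -/
lemma decoSub_hexagon_two : DecoSub 6 (fun i => if i = 0 then {0} else if i = 2 then {1} else ∅)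
    (fun _ : Fin 2 => ∅) 2.145 (hexVal 1 0.932 1 0.77 0.717 0.77) (fun _ => 0.466) := by
  refine ⟨rfl, fun i hi => ?_, fun j => by norm_num, ?_, fun i hi => ?_, fun j => ?_⟩
  · interval_cases i <;> simp only [hexVal] <;> norm_num
  · simp [hexVal]; norm_num
  · have : i < 5 := by omega
    interval_cases i <;> simp [hexVal] <;> norm_num
  · fin_cases j <;> simp [Finset.sum_range_succ, hexVal] <;> norm_num

/-- A hexagon with pendant vertices at opposite vertices. -/
lemma decoSub_hexagon_three : DecoSub 6 (fun i => if i = 0 then {0} else if i = 3 then {1} else ∅)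
    (fun _ : Fin 2 => ∅) 2.145 (hexVal 1 0.87 0.87 1 0.87 0.87) (fun _ => 0.466) := by
  refine ⟨rfl, fun i hi => ?_, fun j => by norm_num, ?_, fun i hi => ?_, fun j => ?_⟩
  · interval_cases i <;> simp only [hexVal] <;> norm_num
  · simp [hexVal]; norm_num
  · have : i < 5 := by omega
    interval_cases i <;> simp [hexVal] <;> norm_num
  · fin_cases j <;> simp [Finset.sum_range_succ, hexVal] <;> norm_num

/-- In a graph whose eigenvalues are at most `2.14`, no cycle carries pendant neighbours at two
adjacent vertices, and no hexagon carries pendant neighbours at two vertices. -/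
lemma CycIn.false_of_two_pendants (hG : EigLe G 2.14) {g : ℕ} {c : ℕ → V} (hc : CycIn G g c)
    {k : ℕ} (hk0 : 1 ≤ k) (hkg : k < g) (hk : k = 1 ∨ k = g - 1 ∨ g = 6) {w0 w1 : V}
    (hne : w0 ≠ w1) (hw0 : ∀ i < g, c i ≠ w0) (hw1 : ∀ i < g, c i ≠ w1)
    (h0 : G.Adj (c 0) w0) (h1 : G.Adj (c k) w1) : False := by
  have hg := hc.three_le
  have hinj : Function.Injective ![w0, w1] := by
    intro i j hij
    fin_cases i <;> fin_cases j <;> simp_all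
  have main : ∀ c' : ℕ → V, CycIn G g c' → (∀ i < g, c' i ≠ w0) → (∀ i < g, c' i ≠ w1) →
      ∀ k, k ≠ 0 → G.Adj (c' 0) w0 → G.Adj (c' k) w1 → ∀ X Y,
      DecoSub g (fun i => if i = 0 then {0} else if i = k then {1} else ∅)
        (fun _ : Fin 2 => ∅) 2.145 X Y → False := by
    intro c' hc' hw0 hw1 k hk h0 h1 X Y hD
    have := hD.le_of_eigLe hG hc' (w := ![w0, w1])
      (by intro j; fin_cases j; exacts [hw0, hw1]) hinj
      (fun i hi j hj => by
        split_ifs at hj with e0 e1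
        · rw [Finset.mem_singleton] at hj; subst e0 hj; exact h0
        · rw [Finset.mem_singleton] at hj; subst e1 hj; exact h1
        · simp at hj) (by simp)
    norm_num at this
  have hrev : ∀ w, (∀ i < g, c i ≠ w) → ∀ i < g, (if i = 0 then c 0 else c (g - i)) ≠ w := by
    intro w hw i hi
    split_ifs with hi0
    exacts [hw 0 (by omega), hw _ (by omega)]
  by_cases e1 : k = g - 1
  · subst e1
    exact main c hc hw0 hw1 _ (by omega) h0 h1 _ _ (decoSub_pendants hg)
  by_cases e2 : k = 1
  · subst e2
    refine main _ hc.reverse (hrev w0 hw0) (hrev w1 hw1) (g - 1) (by omega) h0 ?_ _ _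
      (decoSub_pendants hg)
    rw [if_neg (by omega), show g - (g - 1) = 1 by omega]
    exact h1
  obtain rfl : g = 6 := by omega
  rcases (by omega : k = 2 ∨ k = 3 ∨ k = 4) with rfl | rfl | rfl
  · exact main c hc hw0 hw1 _ (by omega) h0 h1 _ _ decoSub_hexagon_two
  · exact main c hc hw0 hw1 _ (by omega) h0 h1 _ _ decoSub_hexagon_three
  · exact main _ hc.reverse (hrev w0 hw0) (hrev w1 hw1) 2 (by omega) h0 h1 _ _
      decoSub_hexagon_two

end DecoratedCycles

/-! ### Shortest cycles and the vertices attached to them -/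

section CyclicMates

open scoped Classical

variable {V : Type*} [Fintype V] {n : ℕ} {G : SimpleGraph V}

lemma CycIn.two_le_degree {g : ℕ} {c : ℕ → V} (hc : CycIn G g c) {i : ℕ} (hi : i < g) :
    2 ≤ G.degree (c i) := by
  have h3 := hc.three_le
  rw [← SimpleGraph.card_neighborFinset_eq_degree, ← Nat.lt_iff_add_one_le, Finset.one_lt_card]
  refine ⟨c ((i + 1) % g), by simpa using hc.adj_mod hi, c ((i + (g - 1)) % g),
    by simpa using hc.adj_prev hi, fun h => mod_succ_ne_mod_pred h3
      (hc.inj _ (Nat.mod_lt _ (by omega)) _ (Nat.mod_lt _ (by omega)) h)⟩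

lemma CycIn.three_le_degree {g : ℕ} {c : ℕ → V} (hc : CycIn G g c) {i : ℕ} (hi : i < g) {w : V}
    (hadj : G.Adj (c i) w) (h1 : w ≠ c ((i + 1) % g)) (h2 : w ≠ c ((i + (g - 1)) % g)) :
    3 ≤ G.degree (c i) := by
  have h3 := hc.three_le
  rw [← SimpleGraph.card_neighborFinset_eq_degree, ← Nat.lt_iff_add_one_le, Finset.two_lt_card]
  refine ⟨w, by simpa using hadj, c ((i + 1) % g), by simpa using hc.adj_mod hi,
    c ((i + (g - 1)) % g), by simpa using hc.adj_prev hi, h1, h2,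
    fun h => mod_succ_ne_mod_pred h3
      (hc.inj _ (Nat.mod_lt _ (by omega)) _ (Nat.mod_lt _ (by omega)) h)⟩

lemma CycIn.three_le_degree_of_off {g : ℕ} {c : ℕ → V} (hc : CycIn G g c) {i : ℕ} (hi : i < g)
    {w : V} (hadj : G.Adj (c i) w) (hw : ∀ j < g, c j ≠ w) : 3 ≤ G.degree (c i) := by
  have h3 := hc.three_le
  exact hc.three_le_degree hi hadj (hw _ (Nat.mod_lt _ (by omega))).symm
    (hw _ (Nat.mod_lt _ (by omega))).symm

/-- A neighbour of a cycle vertex other than its two neighbours along the cycle. -/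
lemma CycIn.exists_third {g : ℕ} {c : ℕ → V} (hc : CycIn G g c) (hd : G.degree (c 0) = 3) :
    ∃ w, G.Adj (c 0) w ∧ w ≠ c 1 ∧ w ≠ c (g - 1) ∧
      ∀ x, G.Adj (c 0) x → x = c 1 ∨ x = c (g - 1) ∨ x = w := by
  have h3 := hc.three_le
  have hne : c 1 ≠ c (g - 1) := fun h => by
    have := hc.inj _ (by omega) _ (by omega) h
    omega
  rw [← SimpleGraph.card_neighborFinset_eq_degree] at hd
  have h1 : c 1 ∈ G.neighborFinset (c 0) := by simpa using hc.adj 0 (by omega)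
  have h2 : c (g - 1) ∈ (G.neighborFinset (c 0)).erase (c 1) := by
    rw [Finset.mem_erase, SimpleGraph.mem_neighborFinset]
    exact ⟨hne.symm, hc.close.symm⟩
  have hcard : (((G.neighborFinset (c 0)).erase (c 1)).erase (c (g - 1))).card = 1 := by
    rw [Finset.card_erase_of_mem h2, Finset.card_erase_of_mem h1, hd]
  obtain ⟨w, hw⟩ := Finset.card_eq_one.mp hcard
  have hmem : ∀ x, (x ≠ c (g - 1) ∧ x ≠ c 1 ∧ G.Adj (c 0) x) ↔ x = w := by
    intro x
    rw [← Finset.mem_singleton, ← hw, Finset.mem_erase, Finset.mem_erase,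
      SimpleGraph.mem_neighborFinset]
  obtain ⟨hw1, hw2, hw3⟩ := (hmem w).mpr rfl
  refine ⟨w, hw3, hw2, hw1, fun x hx => ?_⟩
  by_cases e1 : x = c 1
  · exact Or.inl e1
  by_cases e2 : x = c (g - 1)
  · exact Or.inr (Or.inl e2)
  · exact Or.inr (Or.inr ((hmem x).mp ⟨e2, e1, hx⟩))

/-- The vertices of a cycle. -/
noncomputable def cycVerts {V : Type*} (g : ℕ) (c : ℕ → V) : Finset V :=
  (Finset.range g).image c

lemma mem_cycVerts {V : Type*} {g : ℕ} {c : ℕ → V} {v : V} :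
    v ∈ cycVerts g c ↔ ∃ i < g, c i = v := by
  simp [cycVerts]

lemma CycIn.card_cycVerts {V : Type*} {G : SimpleGraph V} {g : ℕ} {c : ℕ → V}
    (hc : CycIn G g c) : (cycVerts g c).card = g := by
  rw [cycVerts, Finset.card_image_of_injOn, Finset.card_range]
  intro i hi j hj hij
  exact hc.inj i (by simpa using hi) j (by simpa using hj) hij

lemma CycIn.mem_cycVerts_of_adj {g : ℕ} {c : ℕ → V} (hc : CycIn G g c) {i : ℕ} (hi : i < g)
    (hd : G.degree (c i) = 2) {w : V} (hw : G.Adj (c i) w) : w ∈ cycVerts g c := by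
  by_contra h
  rw [mem_cycVerts] at h
  push Not at h
  have := hc.three_le_degree_of_off hi hw h
  omega

lemma exists_adj_ne_of_two_le_degree {w a : V} (hd : 2 ≤ G.degree w) :
    ∃ x, G.Adj w x ∧ x ≠ a := by
  rw [← SimpleGraph.card_neighborFinset_eq_degree] at hd
  obtain ⟨x, hx, hxa⟩ := Finset.exists_mem_ne hd a
  exact ⟨x, by simpa using hx, hxa⟩

lemma eq_of_adj_of_degree_one {w a b : V} (hd : G.degree w = 1) (ha : G.Adj w a)
    (hb : G.Adj w b) : a = b := by
  rw [← SimpleGraph.card_neighborFinset_eq_degree] at hd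
  exact Finset.card_le_one.mp hd.le a (by simpa using ha) b (by simpa using hb)

lemma CycIn.exists_shortest {V : Type*} {G : SimpleGraph V} {g : ℕ} {c : ℕ → V}
    (hc : CycIn G g c) : ∃ g c, CycIn G g c ∧ ∀ g' c', CycIn G g' c' → g ≤ g' := by
  have h : ∃ g, ∃ c, CycIn G g c := ⟨g, c, hc⟩
  obtain ⟨c', hc'⟩ := Nat.find_spec h
  exact ⟨_, c', hc', fun g' c'' hc'' => Nat.find_min' h ⟨c'', hc''⟩⟩

/-- A shortest cycle has no chord. -/
lemma CycIn.off_cycle_of_shortest {V : Type*} {G : SimpleGraph V} {g : ℕ} {c : ℕ → V}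
    (hc : CycIn G g c)
    (hmin : ∀ g' c', CycIn G g' c' → g ≤ g') {w : V} (hw : G.Adj (c 0) w) (h1 : w ≠ c 1)
    (h2 : w ≠ c (g - 1)) : ∀ j < g, c j ≠ w := by
  rintro j hj rfl
  have hj0 : j ≠ 0 := by rintro rfl; exact hw.ne rfl
  have hj1 : j ≠ 1 := by rintro rfl; exact h1 rfl
  have hj2 : j ≠ g - 1 := by rintro rfl; exact h2 rfl
  have := hmin _ _ (hc.chord (by omega) hj hw)
  omega

/-- A vertex off a shortest cycle has only one neighbour on it: two neighbours would give two
cycles whose lengths add up to `g + 4`. -/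
lemma CycIn.eq_zero_of_shortest {V : Type*} {G : SimpleGraph V} {g : ℕ} {c : ℕ → V}
    (hc : CycIn G g c)
    (hmin : ∀ g' c', CycIn G g' c' → g ≤ g') (hg : 5 ≤ g) {w : V} (hw : G.Adj (c 0) w)
    (hoff : ∀ j < g, c j ≠ w) {j : ℕ} (hj : j < g) (hjw : G.Adj (c j) w) : j = 0 := by
  by_contra hj0
  have h1 := hmin _ _ (hc.detour (by omega) hj hoff hw hjw)
  have h2 := hmin _ _ (hc.reverse.detour (j := g - j) (by omega) (by omega) (w := w)
    (fun i hi => by split_ifs; exacts [hoff 0 (by omega), hoff _ (by omega)]) hw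
    (by rw [if_neg (by omega), show g - (g - j) = j by omega]; exact hjw))
  omega

/-- The largest eigenvalue `μ` of `hTree 11` is that of `G` if `n = 11`; otherwise the eigenvalues
of `G` are at most `2.12`, which is less than `μ`. -/
lemma HMate.exists_root_eleven (h : HMate n G) : ∃ μ : ℝ, 2.13 < μ ∧
    μ ^ 4 - 5 * μ ^ 2 + 2 = 0 ∧ (n = 11 ∧ EigLe G μ ∨ EigLe G 2.12) := by
  have hn := h.le
  rcases Nat.lt_or_ge n 12 with h12 | h12
  · obtain rfl : n = 11 := by omega
    obtain ⟨μ, h2, hμ, hle⟩ := h.exists_eigLe_eleven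
    refine ⟨μ, ?_, hμ, Or.inl ⟨rfl, hle⟩⟩
    by_contra! hlt
    have h4 : 4 < μ ^ 2 := by nlinarith
    have h5 : μ ^ 2 ≤ 4.5369 := by nlinarith
    nlinarith
  · have h17 : (4.12 : ℝ) < √17 := Real.lt_sqrt_of_sq_lt (by norm_num)
    have hsq : √17 ^ 2 = (17 : ℝ) := Real.sq_sqrt (by norm_num)
    refine ⟨√((5 + √17) / 2), Real.lt_sqrt_of_sq_lt (by linarith), ?_,
      Or.inr (h.eigLe_of_twelve_le h12)⟩
    have : √((5 + √17) / 2) ^ 2 = (5 + √17) / 2 := Real.sq_sqrt (by linarith)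
    rw [show √((5 + √17) / 2) ^ 4 = (√((5 + √17) / 2) ^ 2) ^ 2 by ring, this]
    linarith

namespace HMate

/-- Otherwise the cycle would be a component, and `2` an eigenvalue. -/
lemma exists_branch_on_cycle (h : HMate n G) {g : ℕ} {c : ℕ → V} (hc : CycIn G g c) :
    ∃ i < g, G.degree (c i) = 3 := by
  by_contra! hno
  have h3 := hc.three_le
  have hd : ∀ i < g, G.degree (c i) = 2 := fun i hi => by
    have := hc.two_le_degree hi
    have := h.degree_le_three (c i)
    have := hno i hi
    omega
  refine h.not_isEig_two (isEig_two_of_closed (S := cycVerts g c)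
    ⟨c 0, mem_cycVerts.mpr ⟨0, by omega, rfl⟩⟩ ?_ ?_)
  · intro v hv
    obtain ⟨i, hi, rfl⟩ := mem_cycVerts.mp hv
    exact hd i hi
  · intro v hv w hvw
    obtain ⟨i, hi, rfl⟩ := mem_cycVerts.mp hv
    exact hc.mem_cycVerts_of_adj hi (hd i hi) hvw

/-- The degrees in a cycle with a pendant path of two vertices. -/
lemma card_decoNbr_tail {g : ℕ} (hg : 3 ≤ g) :
    (∀ i : Fin g, (decoNbr g (fun i => if i = 0 then {0} else ∅)
        (![{1}, {0}] : Fin 2 → Finset (Fin 2)) (.inl i)).card = if (i : ℕ) = 0 then 3 else 2) ∧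
      (decoNbr g (fun i => if i = 0 then {0} else ∅)
        (![{1}, {0}] : Fin 2 → Finset (Fin 2)) (.inr 0)).card = 2 ∧
      (decoNbr g (fun i => if i = 0 then {0} else ∅)
        (![{1}, {0}] : Fin 2 → Finset (Fin 2)) (.inr 1)).card = 1 := by
  refine ⟨fun i => ?_, ?_, ?_⟩
  · rw [card_decoNbr_inl hg]
    split_ifs <;> simp
  · rw [decoNbr, Finset.card_disjSum, Finset.card_eq_one.mpr ⟨⟨0, by omega⟩, ?_⟩]
    · rfl
    · ext i
      by_cases hi : (i : ℕ) = 0 <;> simp [hi, Fin.ext_iff]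
  · rw [decoNbr, Finset.card_disjSum, Finset.card_eq_zero.mpr ?_]
    · rfl
    · ext i
      by_cases hi : (i : ℕ) = 0 <;> simp [hi]

/-- If `n = 11`, then `G` has no component on eight vertices with a single leaf and a single branch
vertex, such as a hexagon with a pendant path of two vertices. Either the remaining three vertices
would have to include three leaves and a branch vertex, or, apart from an isolated vertex, they
would all have degree `2`. -/
lemma false_of_closed_hexagon_tail (h : HMate 11 G) {I : Finset V} (hIc : I.card = 8)
    (hcl : ∀ v ∈ I, ∀ x, G.Adj v x → x ∈ I) {x1 x3 : V} (hx1 : x1 ∈ I) (hx3 : x3 ∈ I)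
    (hx1d : G.degree x1 = 1) (hx3d : G.degree x3 = 3)
    (hd3 : ∀ v ∈ I, G.degree v = 3 → v = x3) (hd1 : ∀ v ∈ I, G.degree v = 1 → v = x1) :
    False := by
  have hcompl : Iᶜ.card = 3 := by
    rw [Finset.card_compl, h.card_eq, hIc]
  rcases h.degree_cases with ⟨-, hL, hB⟩ | ⟨hZ, hL, hB⟩
  · have hsub : (degSet G 1).erase x1 ∪ (degSet G 3).erase (x3) ⊆ Iᶜ := by
      intro v hv
      rw [Finset.mem_compl]
      intro hvI
      rcases Finset.mem_union.mp hv with hv | hv <;>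
        rw [Finset.mem_erase, HMate.mem_degSet] at hv
      · exact hv.1 (hd1 v hvI hv.2)
      · exact hv.1 (hd3 v hvI hv.2)
    have hdisj : Disjoint ((degSet G 1).erase x1) ((degSet G 3).erase (x3)) := by
      rw [Finset.disjoint_left]
      intro v hv hv'
      rw [Finset.mem_erase, HMate.mem_degSet] at hv hv'
      omega
    have := Finset.card_le_card hsub
    rw [Finset.card_union_of_disjoint hdisj, hcompl] at this
    have e1 := Finset.pred_card_le_card_erase (s := degSet G 1) (a := x1)
    have e2 := Finset.pred_card_le_card_erase (s := degSet G 3) (a := x3)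
    omega
  · refine h.not_isEig_two (isEig_two_of_closed (S := Iᶜ \ degSet G 0) ?_ ?_ ?_)
    · rw [← Finset.card_pos]
      have := Finset.le_card_sdiff (degSet G 0) Iᶜ
      omega
    · intro v hv
      rw [Finset.mem_sdiff, Finset.mem_compl, HMate.mem_degSet] at hv
      have := h.degree_le_three v
      by_contra hd
      rcases (by omega : G.degree v = 1 ∨ G.degree v = 3) with hd1 | hd3
      · exact hv.1 (Finset.card_le_one.mp hL.le v (HMate.mem_degSet.mpr hd1) x1
          (HMate.mem_degSet.mpr hx1d) ▸ hx1)
      · exact hv.1 (Finset.card_le_one.mp hB.le v (HMate.mem_degSet.mpr hd3) x3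
          (HMate.mem_degSet.mpr hx3d) ▸ hx3)
    · intro v hv x hvx
      rw [Finset.mem_sdiff, Finset.mem_compl, HMate.mem_degSet] at hv ⊢
      refine ⟨fun hx => hv.1 (hcl x hx v hvx.symm), ?_⟩
      have : 0 < G.degree x := (SimpleGraph.degree_pos_iff_exists_adj _ _).mpr ⟨v, hvx.symm⟩
      omega

/-- No cycle of `G` carries a pendant path with two vertices. For `n ≥ 14` the eigenvalue would be
too large. For `n = 11` and `n = 12` the cycle is a hexagon, whose eigenvalue is that of
`hTree 11`; this is too large for `n = 12`, and for `n = 11` makes the hexagon and the path a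
component, too few vertices remaining for the other vertices of odd degree. -/
lemma false_of_tail (h : HMate n G) {g : ℕ} {c : ℕ → V} (hc : CycIn G g c) {w w' : V}
    (hw : ∀ i < g, c i ≠ w) (hw' : ∀ i < g, c i ≠ w') (h0 : G.Adj (c 0) w) (h1 : G.Adj w w')
    (hww : w' ≠ c 0) (hg : g = 6 ∨ (degSet G 1).card = 4) : False := by
  have hn := h.le
  have hn13 := h.ne13
  have hne : w ≠ w' := h1.ne
  have hinj : Function.Injective ![w, w'] := by
    intro i j hij
    fin_cases i <;> fin_cases j <;> simp_all
  have hoff : ∀ j, ∀ i < g, c i ≠ (![w, w'] : Fin 2 → V) j := by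
    intro j; fin_cases j; exacts [hw, hw']
  have hP : ∀ i < g, ∀ j ∈ (if i = 0 then {0} else ∅ : Finset (Fin 2)),
      G.Adj (c i) ((![w, w'] : Fin 2 → V) j) := by
    intro i _ j hj
    split_ifs at hj with e
    · rw [Finset.mem_singleton] at hj; subst e hj; exact h0
    · simp at hj
  have hR : ∀ i, ∀ j ∈ (![{1}, {0}] : Fin 2 → Finset (Fin 2)) i,
      G.Adj ((![w, w'] : Fin 2 → V) i) ((![w, w'] : Fin 2 → V) j) := by
    intro i j hj
    fin_cases i <;> fin_cases j <;> simp_all [h1.symm]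
  rcases Nat.lt_or_ge n 14 with h14 | h14
  swap
  · have := (decoSub_tail hc.three_le).le_of_eigLe (h.eigLe_of_fourteen_le h14) hc hoff hinj hP hR
    norm_num at this
  have hwd : 2 ≤ G.degree w := by
    rw [← SimpleGraph.card_neighborFinset_eq_degree, ← Nat.lt_iff_add_one_le, Finset.one_lt_card]
    exact ⟨c 0, by simpa using h0.symm, w', by simpa using h1, hww.symm⟩
  obtain rfl : g = 6 := by
    by_contra hg6
    have h8 : 8 ≤ g := (h.six_or_eight_le hc).resolve_left hg6
    have hL := hg.resolve_left hg6
    -- neither the cycle nor `w` contains any of the four leaves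
    have hdisj : Disjoint (insert w (cycVerts g c)) (degSet G 1) := by
      rw [Finset.disjoint_left]
      intro v hv hv1
      rw [HMate.mem_degSet] at hv1
      rcases Finset.mem_insert.mp hv with rfl | hv
      · omega
      · obtain ⟨i, hi, rfl⟩ := mem_cycVerts.mp hv
        have := hc.two_le_degree hi
        omega
    have hwc : w ∉ cycVerts g c := by
      rw [mem_cycVerts]
      push Not
      exact hw
    have hcard := Finset.card_le_univ (insert w (cycVerts g c) ∪ degSet G 1)
    rw [Finset.card_union_of_disjoint hdisj, Finset.card_insert_of_notMem hwc, hc.card_cycVerts,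
      hL, h.card_eq] at hcard
    omega
  obtain ⟨μ, hμ2, hμ, ⟨rfl, hle⟩ | hle⟩ := h.exists_root_eleven
  swap
  · have := (decoSub_hexagon_tail hμ2 hμ).le_of_eigLe hle hc hoff hinj hP hR
    linarith
  -- the copy of the decorated hexagon is a union of components, with a single branch vertex
  have hN := (decoSub_hexagon_tail hμ2 hμ).neighborFinset_eq hle hc hoff hinj hP hR
  have hfi := decoMap_injective hc hoff hinj
  set I := Finset.univ.image (decoMap 6 c ![w, w']) with hI
  have hIc : I.card = 8 := by
    rw [hI, Finset.card_image_of_injective _ hfi]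
    simp
  have hcl : ∀ v ∈ I, ∀ x, G.Adj v x → x ∈ I := by
    intro v hv x hx
    obtain ⟨a, -, rfl⟩ := Finset.mem_image.mp hv
    rw [← SimpleGraph.mem_neighborFinset, hN] at hx
    exact Finset.image_subset_image (Finset.subset_univ _) hx
  have hdeg : ∀ a, G.degree (decoMap 6 c ![w, w'] a) = (decoNbr 6
      (fun i => if i = 0 then {0} else ∅) (![{1}, {0}] : Fin 2 → Finset (Fin 2)) a).card := by
    intro a
    rw [← SimpleGraph.card_neighborFinset_eq_degree, hN, Finset.card_image_of_injective _ hfi]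
  have hin : ∀ a, decoMap 6 c ![w, w'] a ∈ I :=
    fun a => Finset.mem_image_of_mem _ (Finset.mem_univ a)
  have hd3 : ∀ v ∈ I, G.degree v = 3 → v = c 0 := by
    intro v hv hd
    obtain ⟨a, -, rfl⟩ := Finset.mem_image.mp hv
    rw [hdeg] at hd
    rcases a with i | j
    · rw [(card_decoNbr_tail (by norm_num)).1] at hd
      split_ifs at hd with hi
      · exact congrArg c hi
      · omega
    · have hj : j = 0 ∨ j = 1 := by fin_cases j <;> simp
      rcases hj with rfl | rfl
      · rw [(card_decoNbr_tail (by norm_num)).2.1] at hd; omega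
      · rw [(card_decoNbr_tail (by norm_num)).2.2] at hd; omega
  have hd1 : ∀ v ∈ I, G.degree v = 1 → v = w' := by
    intro v hv hd
    obtain ⟨a, -, rfl⟩ := Finset.mem_image.mp hv
    rw [hdeg] at hd
    rcases a with i | j
    · rw [(card_decoNbr_tail (by norm_num)).1] at hd
      split_ifs at hd <;> omega
    · have hj : j = 0 ∨ j = 1 := by fin_cases j <;> simp
      rcases hj with rfl | rfl
      · rw [(card_decoNbr_tail (by norm_num)).2.1] at hd; omega
      · rfl
  exact h.false_of_closed_hexagon_tail hIc hcl (hin (.inr 1)) (hin (.inl 0))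
    (by rw [hdeg, (card_decoNbr_tail (by norm_num)).2.2])
    (by rw [hdeg, (card_decoNbr_tail (by norm_num)).1]; rfl) hd3 hd1

/-- On a shortest cycle, the neighbour off the cycle of a branch vertex is a leaf. -/
lemma exists_leaf_off_cycle (h : HMate n G) {g : ℕ} {c : ℕ → V} (hc : CycIn G g c)
    (hmin : ∀ g' c', CycIn G g' c' → g ≤ g') (hg : g = 6 ∨ (degSet G 1).card = 4) {i : ℕ}
    (hi : i < g) (hd : G.degree (c i) = 3) :
    ∃ w, G.Adj (c i) w ∧ (∀ j < g, c j ≠ w) ∧ G.degree w = 1 ∧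
      ∀ x, G.Adj (c i) x → x = w ∨ x ∈ cycVerts g c := by
  obtain ⟨c', hc', h0, hmem⟩ := hc.exists_rotate hi
  have hg5 : 5 ≤ g := by rcases h.six_or_eight_le hc with h' | h' <;> omega
  rw [← h0] at hd ⊢
  obtain ⟨w, hw, hw1, hw2, hall⟩ := hc'.exists_third hd
  have hoff := hc'.off_cycle_of_shortest hmin hw hw1 hw2
  refine ⟨w, hw, fun j hj hjw => ?_, ?_, fun x hx => ?_⟩
  · obtain ⟨k, hk, hkw⟩ := (hmem w).mpr ⟨j, hj, hjw⟩
    exact hoff k hk hkw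
  · by_contra hd1
    have hpos : 0 < G.degree w := (SimpleGraph.degree_pos_iff_exists_adj _ _).mpr ⟨_, hw.symm⟩
    obtain ⟨w', hww', hne⟩ := exists_adj_ne_of_two_le_degree (G := G) (w := w) (a := c' 0)
      (by omega)
    refine h.false_of_tail hc' hoff (fun j hj hjw => ?_) hw hww' hne hg
    have := hc'.eq_zero_of_shortest hmin hg5 hw hoff hj (by rw [hjw]; exact hww'.symm)
    subst this
    exact hne hjw.symm
  · rcases hall x hx with rfl | rfl | rfl
    · exact Or.inr (mem_cycVerts.mpr ((hmem _).mp ⟨1, by omega, rfl⟩))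
    · exact Or.inr (mem_cycVerts.mpr ((hmem _).mp ⟨g - 1, by omega, rfl⟩))
    · exact Or.inl rfl

/-- With a single branch vertex, the component containing it would be a hexagon with a pendant
vertex, and all others but one would be cycles. -/
lemma degSet_zero_empty (h : HMate n G) :
    (degSet G 0).card = 0 ∧ (degSet G 1).card = 4 ∧ (degSet G 3).card = 2 := by
  refine h.degree_cases.resolve_right fun ⟨hZ, hL, hB⟩ => ?_
  have hn := h.le
  obtain ⟨c6, hc6⟩ := h.exists_hexagon hL hB hZ
  obtain ⟨g, c, hc, hmin⟩ := hc6.exists_shortest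
  have hg6 := hmin _ _ hc6
  obtain rfl : g = 6 := by rcases h.six_or_eight_le hc with h' | h' <;> omega
  obtain ⟨i, hi, hd⟩ := h.exists_branch_on_cycle hc
  obtain ⟨w, hw, hoff, hw1, hall⟩ := h.exists_leaf_off_cycle hc hmin (Or.inl rfl) hi hd
  have hB' : ∀ v, G.degree v = 3 → v = c i := fun v hv =>
    Finset.card_le_one.mp hB.le v (HMate.mem_degSet.mpr hv) _ (HMate.mem_degSet.mpr hd)
  have hL' : ∀ v, G.degree v = 1 → v = w := fun v hv =>
    Finset.card_le_one.mp hL.le v (HMate.mem_degSet.mpr hv) _ (HMate.mem_degSet.mpr hw1)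
  have hcl : ∀ v ∈ insert w (cycVerts 6 c), ∀ x, G.Adj v x → x ∈ insert w (cycVerts 6 c) := by
    intro v hv x hx
    rcases Finset.mem_insert.mp hv with rfl | hv
    · rw [eq_of_adj_of_degree_one hw1 hx hw.symm]
      exact Finset.mem_insert_of_mem (mem_cycVerts.mpr ⟨i, hi, rfl⟩)
    · obtain ⟨j, hj, rfl⟩ := mem_cycVerts.mp hv
      by_cases hdj : G.degree (c j) = 3
      · rw [hB' _ hdj] at hx
        rcases hall x hx with rfl | hx
        · exact Finset.mem_insert_self _ _
        · exact Finset.mem_insert_of_mem hx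
      · have := hc.two_le_degree hj
        have := h.degree_le_three (c j)
        exact Finset.mem_insert_of_mem (hc.mem_cycVerts_of_adj hj (by omega) hx)
  have hcard : (insert w (cycVerts 6 c)).card ≤ 7 := by
    have := Finset.card_insert_le w (cycVerts 6 c)
    rw [hc.card_cycVerts] at this
    exact this
  refine h.not_isEig_two (isEig_two_of_closed
    (S := (insert w (cycVerts 6 c))ᶜ \ degSet G 0) ?_ ?_ ?_)
  · rw [← Finset.card_pos]
    have h1 := Finset.le_card_sdiff (degSet G 0) (insert w (cycVerts 6 c))ᶜ
    rw [Finset.card_compl, h.card_eq] at h1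
    omega
  · intro v hv
    rw [Finset.mem_sdiff, Finset.mem_compl, HMate.mem_degSet] at hv
    have := h.degree_le_three v
    by_contra hd'
    rcases (by omega : G.degree v = 1 ∨ G.degree v = 3) with hd1 | hd3
    · exact hv.1 (hL' v hd1 ▸ Finset.mem_insert_self _ _)
    · exact hv.1 (hB' v hd3 ▸ Finset.mem_insert_of_mem (mem_cycVerts.mpr ⟨i, hi, rfl⟩))
  · intro v hv x hvx
    rw [Finset.mem_sdiff, Finset.mem_compl, HMate.mem_degSet] at hv ⊢
    refine ⟨fun hx => hv.1 (hcl x hx v hvx.symm), ?_⟩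
    have : 0 < G.degree x := (SimpleGraph.degree_pos_iff_exists_adj _ _).mpr ⟨v, hvx.symm⟩
    omega

end HMate

end CyclicMates

/-! ### Absence of cycles -/

section NoCycles

open scoped Classical

variable {V : Type*} [Fintype V] {n : ℕ} {G : SimpleGraph V}

lemma exists_eq_pair_of_mem {α : Type*} {s : Finset α} (hs : s.card = 2) {a : α} (ha : a ∈ s) :
    ∃ b, a ≠ b ∧ s = {a, b} := by
  obtain ⟨x, y, hxy, rfl⟩ := Finset.card_eq_two.mp hs
  rcases Finset.mem_insert.mp ha with rfl | ha
  · exact ⟨y, hxy, rfl⟩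
  · rw [Finset.mem_singleton] at ha
    subst ha
    exact ⟨x, hxy.symm, Finset.pair_comm _ _⟩

lemma card_inter_degSet_one_le {l : V} (hl : G.degree l = 1) (S : Finset V) :
    (G.neighborFinset l ∩ S).card ≤ 1 := by
  rw [← hl, ← SimpleGraph.card_neighborFinset_eq_degree]
  exact Finset.card_le_card Finset.inter_subset_left

lemma card_inter_degSet_one_eq_zero {l a : V} (hl : G.degree l = 1) (ha : G.Adj l a)
    {S : Finset V} (haS : a ∉ S) : (G.neighborFinset l ∩ S).card = 0 := by
  rw [Finset.card_eq_zero, Finset.eq_empty_iff_forall_notMem]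
  intro x hx
  rw [Finset.mem_inter, SimpleGraph.mem_neighborFinset] at hx
  exact haS (eq_of_adj_of_degree_one hl hx.1 ha ▸ hx.2)

namespace HMate

/-- The number of ordered pairs of adjacent leaves is bounded by the number of leaves not in a
set `D` of leaves that are adjacent to other vertices. -/
lemma sum_leaf_leaf_le {D : Finset V} (hD : D ⊆ degSet G 1)
    (hD0 : ∀ l ∈ D, ∃ a, G.Adj l a ∧ a ∉ degSet G 1) :
    ∑ l ∈ degSet G 1, (G.neighborFinset l ∩ degSet G 1).card + D.card ≤ (degSet G 1).card := by
  rw [← Finset.sum_sdiff hD, ← Finset.card_sdiff_add_card_eq_card hD]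
  have h1 : ∑ l ∈ D, (G.neighborFinset l ∩ degSet G 1).card = 0 :=
    Finset.sum_eq_zero fun l hl => by
      obtain ⟨a, ha, ha1⟩ := hD0 l hl
      exact card_inter_degSet_one_eq_zero (mem_degSet.mp (hD hl)) ha ha1
  have h2 := Finset.sum_le_card_nsmul (degSet G 1 \ D)
    (fun l => (G.neighborFinset l ∩ degSet G 1).card) 1 fun l hl =>
      card_inter_degSet_one_le (mem_degSet.mp (Finset.mem_sdiff.mp hl).1) _
  rw [smul_eq_mul, mul_one] at h2
  omega

lemma card_nbr_inter_leaves_eq_one {g : ℕ} {c : ℕ → V} (hc : CycIn G g c) {a w : V}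
    (hw : G.Adj a w) (hw1 : G.degree w = 1) (hall : ∀ x, G.Adj a x → x = w ∨ x ∈ cycVerts g c) :
    (G.neighborFinset a ∩ degSet G 1).card = 1 := by
  rw [Finset.card_eq_one]
  refine ⟨w, Finset.ext fun x => ?_⟩
  rw [Finset.mem_inter, SimpleGraph.mem_neighborFinset, mem_degSet, Finset.mem_singleton]
  refine ⟨fun hx => (hall x hx.1).resolve_right fun hxc => ?_, ?_⟩
  · obtain ⟨i, hi, rfl⟩ := mem_cycVerts.mp hxc
    have := hc.two_le_degree hi
    omega
  · rintro rfl
    exact ⟨hw, hw1⟩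

/-- A shortest cycle does not contain both branch vertices. -/
lemma false_of_two_branches_on_cycle (h : HMate n G) {g : ℕ} {c : ℕ → V} (hc : CycIn G g c)
    (hmin : ∀ g' c', CycIn G g' c' → g ≤ g') {k : ℕ} (hk0 : 1 ≤ k) (hk : k < g)
    (hd0 : G.degree (c 0) = 3) (hdk : G.degree (c k) = 3) : False := by
  obtain ⟨hZ, hL, hB⟩ := h.degSet_zero_empty
  have h3 := hc.three_le
  have hne : c 0 ≠ c k := fun h' => by
    have := hc.inj _ (by omega) _ hk h'
    omega
  have hbr : degSet G 3 = {c 0, c k} := by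
    refine (Finset.eq_of_subset_of_card_le (fun x hx => ?_) ?_).symm
    · rw [Finset.mem_insert, Finset.mem_singleton] at hx
      rcases hx with rfl | rfl <;> rwa [mem_degSet]
    · rw [hB, Finset.card_pair hne]
  obtain ⟨w, hw, hoff, hw1, hall⟩ :=
    h.exists_leaf_off_cycle hc hmin (Or.inr hL) (show 0 < g by omega) hd0
  obtain ⟨w', hw', hoff', hw1', hall'⟩ := h.exists_leaf_off_cycle hc hmin (Or.inr hL) hk hdk
  have hww : w ≠ w' := by
    rintro rfl
    exact hne (eq_of_adj_of_degree_one hw1 hw.symm hw'.symm)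
  have hM := h.hexDefect_eq hZ hL hne hbr
  rw [card_nbr_inter_leaves_eq_one hc hw hw1 hall, card_nbr_inter_leaves_eq_one hc hw' hw1' hall']
    at hM
  have hcyc : ∀ i < g, c i ∉ degSet G 1 := fun i hi hi1 => by
    have := hc.two_le_degree hi
    rw [mem_degSet] at hi1
    omega
  have hle := sum_leaf_leaf_le (G := G) (D := {w, w'})
    (by
      intro x hx
      rw [Finset.mem_insert, Finset.mem_singleton] at hx
      rcases hx with rfl | rfl <;> rwa [mem_degSet])
    (by
      intro x hx
      rw [Finset.mem_insert, Finset.mem_singleton] at hx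
      rcases hx with rfl | rfl
      exacts [⟨_, hw.symm, hcyc 0 (by omega)⟩, ⟨_, hw'.symm, hcyc k hk⟩])
  rw [Finset.card_pair hww, hL] at hle
  -- without hexagons the branch vertices are adjacent
  refine hc.false_of_two_pendants h.eigLe_of_eleven_le hk0 hk ?_ hww hoff hoff' hw hw'
  by_cases hM0 : hexDefect G = 0
  · have hadj : G.Adj (c 0) (c k) := by
      by_contra hadj
      rw [if_neg hadj, hM0] at hM
      have hB : (∑ l ∈ degSet G 1, ((G.neighborFinset l ∩ degSet G 1).card : ℝ)) ≤ 2 := by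
        exact_mod_cast (by omega : ∑ l ∈ degSet G 1, (G.neighborFinset l ∩ degSet G 1).card ≤ 2)
      push_cast at hM
      linarith
    by_contra! hno
    have := hmin _ _ (hc.chord (by omega) hk hadj)
    omega
  · obtain ⟨c', hc'⟩ := h.exists_hexagon_of_hexDefect_ne_zero hM0
    have := hmin _ _ hc'
    rcases h.six_or_eight_le hc with h' | h' <;> omega

/-- A hexagon with a single pendant vertex is not a component. -/
lemma false_of_hexagon_pendant (h : HMate n G) {c : ℕ → V} (hc : CycIn G 6 c) {w : V}
    (hw : G.Adj (c 0) w) (hoff : ∀ i < 6, c i ≠ w) (hw1 : G.degree w = 1)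
    (hd0 : G.degree (c 0) = 3) (hd : ∀ i < 6, i ≠ 0 → G.degree (c i) = 2) : False := by
  have hs : (0 : ℝ) ≤ √2 := Real.sqrt_nonneg 2
  have hs2 : (1.41 : ℝ) < √2 := Real.lt_sqrt_of_sq_lt (by norm_num)
  have hsq : √2 ^ 2 = (2 : ℝ) := Real.sq_sqrt (by norm_num)
  obtain ⟨μ, hμ2, hμ⟩ : ∃ μ : ℝ, 2.1 < μ ∧ μ ^ 4 - 6 * μ ^ 2 + 7 = 0 := by
    refine ⟨√(3 + √2), Real.lt_sqrt_of_sq_lt (by linarith), ?_⟩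
    have : √(3 + √2) ^ 2 = 3 + √2 := Real.sq_sqrt (by linarith)
    rw [show √(3 + √2) ^ 4 = (√(3 + √2) ^ 2) ^ 2 by ring, this]
    linear_combination hsq
  have hD := decoSub_hexagon_pendant (by linarith) hμ
  have hf : Function.Injective (decoMap 6 c fun _ : Fin 1 => w) :=
    decoMap_injective hc (fun _ => hoff) (Function.injective_of_subsingleton _)
  have hadj := decoNbr_adj hc (w := fun _ : Fin 1 => w)
    (P := fun i => if i = 0 then {0} else ∅) (R := fun _ => ∅)
    (by
      intro i _ j hj
      split_ifs at hj with e
      · subst e; exact hw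
      · simp at hj) (by simp)
  have hcard : ∀ a, G.degree (decoMap 6 c (fun _ : Fin 1 => w) a)
      ≤ (decoNbr 6 (fun i => if i = 0 then {0} else ∅) (fun _ : Fin 1 => ∅) a).card := by
    rintro (⟨i, hi⟩ | j)
    · rw [card_decoNbr_inl (by norm_num)]
      by_cases hi0 : i = 0
      · subst hi0
        exact hd0.le
      · exact (hd i hi hi0).le.trans (Nat.le_add_right _ _)
    · refine hw1.le.trans (Finset.card_pos.mpr ⟨.inl 0, ?_⟩)
      simp [decoNbr, Subsingleton.elim j 0]
  have hN : ∀ a v, G.Adj (decoMap 6 c (fun _ : Fin 1 => w) a) v ↔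
      ∃ b ∈ decoNbr 6 (fun i => if i = 0 then {0} else ∅) (fun _ : Fin 1 => ∅) a,
        decoMap 6 c (fun _ : Fin 1 => w) b = v := by
    intro a v
    have : (decoNbr 6 (fun i => if i = 0 then {0} else ∅) (fun _ : Fin 1 => ∅) a).image
        (decoMap 6 c (fun _ : Fin 1 => w)) = G.neighborFinset (decoMap 6 c (fun _ => w) a) := by
      refine Finset.eq_of_subset_of_card_le (fun x hx => ?_) ?_
      · obtain ⟨b, hb, rfl⟩ := Finset.mem_image.mp hx
        rw [SimpleGraph.mem_neighborFinset]
        exact hadj a b hb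
      · rw [Finset.card_image_of_injective _ hf, SimpleGraph.card_neighborFinset_eq_degree]
        exact hcard a
    rw [← SimpleGraph.mem_neighborFinset, ← this, Finset.mem_image]
  have hE : IsEig G μ := isEig_of_closed hf hN hD.pos (hexVal_pendant_eq hμ)
  have hn := h.le
  rcases Nat.lt_or_ge n 14 with h14 | h14
  · have := h.ne13
    exact not_isEig_hTree_small (by omega) hμ (hE.of_adjSpectrum_eq h.spec)
  · have := h.eigLe_of_fourteen_le h14 μ hE
    linarith

/-- If the branch vertex `v` has no leaf as a neighbour, then there is no cycle avoiding the other
branch vertex `u`: it would contain `v`, and carry a pendant path of two vertices at `v`. -/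
lemma false_of_branch_without_leaf (h : HMate n G) {u v : V}
    (hbr : degSet G 3 = {u, v}) (hv : (G.neighborFinset v ∩ degSet G 1).card = 0) {g : ℕ}
    {c : ℕ → V} (hc : CycIn G g c) (hu : ∀ i < g, c i ≠ u) : False := by
  have hbr' : ∀ x, 3 ≤ G.degree x → x ≠ u → x = v := by
    intro x hx hxu
    have : x ∈ degSet G 3 := mem_degSet.mpr (le_antisymm (h.degree_le_three x) hx)
    rw [hbr, Finset.mem_insert, Finset.mem_singleton] at this
    exact this.resolve_left hxu
  obtain ⟨i, hi, hd⟩ := h.exists_branch_on_cycle hc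
  have hi' := hbr' _ hd.ge (hu i hi)
  obtain ⟨c', hc', h0, hmem⟩ := hc.exists_rotate hi
  have h3 := hc.three_le
  have hu' : ∀ i < g, c' i ≠ u := fun j hj hju => by
    obtain ⟨k, hk, hku⟩ := (hmem u).mp ⟨j, hj, hju⟩
    exact hu k hk hku
  rw [← h0] at hd hi'
  obtain ⟨x, hx, hx1, hx2, -⟩ := hc'.exists_third hd
  have hoff : ∀ j < g, c' j ≠ x := by
    rintro j hj rfl
    have hj0 : j ≠ 0 := by rintro rfl; exact hx.ne rfl
    have hj1 : j ≠ 1 := by rintro rfl; exact hx1 rfl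
    have hj2 : j ≠ g - 1 := by rintro rfl; exact hx2 rfl
    have hd3 := hc'.three_le_degree hj hx.symm
      (fun e => by
        have := hc'.inj _ (by omega) _ (Nat.mod_lt _ (by omega)) e
        rw [Nat.mod_eq_of_lt (by omega)] at this
        omega)
      (fun e => by
        have := hc'.inj _ (by omega) _ (Nat.mod_lt _ (by omega)) e
        rw [show j + (g - 1) = j - 1 + g by omega, Nat.add_mod_right,
          Nat.mod_eq_of_lt (by omega)] at this
        omega)
    exact hx.ne (hi'.trans (hbr' _ hd3 (hu' j hj)).symm)
  have hxd : 2 ≤ G.degree x := by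
    have hpos : 0 < G.degree x := (SimpleGraph.degree_pos_iff_exists_adj _ _).mpr ⟨_, hx.symm⟩
    by_contra hlt
    rw [Finset.card_eq_zero, Finset.eq_empty_iff_forall_notMem] at hv
    refine hv x ?_
    rw [Finset.mem_inter, SimpleGraph.mem_neighborFinset, mem_degSet, ← hi']
    exact ⟨hx, by omega⟩
  obtain ⟨x', hxx', hne⟩ := exists_adj_ne_of_two_le_degree (a := c' 0) hxd
  refine h.false_of_tail hc' hoff ?_ hx hxx' hne (Or.inr h.degSet_zero_empty.2.1)
  rintro j hj rfl
  have hd3 := hc'.three_le_degree_of_off hj hxx'.symm hoff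
  exact hne ((hbr' _ hd3 (hu' j hj)).trans hi'.symm)

/-- A graph cospectral with `hTree n` is a forest. -/
lemma not_cycIn (h : HMate n G) (g : ℕ) (c : ℕ → V) : ¬ CycIn G g c := by
  intro hc0
  obtain ⟨hZ, hL, hB⟩ := h.degSet_zero_empty
  obtain ⟨g, c, hc1, hmin⟩ := hc0.exists_shortest
  obtain ⟨i, hi, hd⟩ := h.exists_branch_on_cycle hc1
  obtain ⟨c, hc, h0, -⟩ := hc1.exists_rotate hi
  rw [← h0] at hd
  have h3 := hc.three_le
  obtain ⟨w, hw, hoff, hw1, hall⟩ :=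
    h.exists_leaf_off_cycle hc hmin (Or.inr hL) (show 0 < g by omega) hd
  obtain ⟨v, huv, hbr⟩ := exists_eq_pair_of_mem hB (mem_degSet.mpr hd)
  have hdv : G.degree v = 3 := mem_degSet.mp (by rw [hbr]; simp)
  by_cases hvc : ∃ k < g, c k = v
  · obtain ⟨k, hk, rfl⟩ := hvc
    refine h.false_of_two_branches_on_cycle hc hmin (k := k) ?_ hk hd hdv
    rcases Nat.eq_zero_or_pos k with rfl | hk0
    · exact absurd rfl huv
    · exact hk0
  have hdi : ∀ i < g, i ≠ 0 → G.degree (c i) = 2 := by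
    intro i hi hi0
    have h2 := hc.two_le_degree hi
    have h3' := h.degree_le_three (c i)
    by_contra hne
    have hm : c i ∈ degSet G 3 := mem_degSet.mpr (by omega)
    rw [hbr, Finset.mem_insert, Finset.mem_singleton] at hm
    rcases hm with hm | hm
    · exact hi0 (hc.inj i hi 0 (by omega) hm)
    · exact hvc ⟨i, hi, hm⟩
  have hwc : w ∉ cycVerts g c := by
    rw [mem_cycVerts]
    push Not
    exact hoff
  have hcl : ∀ x ∈ insert w (cycVerts g c), ∀ y, G.Adj x y → y ∈ insert w (cycVerts g c) := by
    intro x hx y hxy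
    rcases Finset.mem_insert.mp hx with rfl | hx
    · rw [eq_of_adj_of_degree_one hw1 hxy hw.symm]
      exact Finset.mem_insert_of_mem (mem_cycVerts.mpr ⟨0, by omega, rfl⟩)
    · obtain ⟨j, hj, rfl⟩ := mem_cycVerts.mp hx
      by_cases hj0 : j = 0
      · subst hj0
        rcases hall y hxy with rfl | hy
        · exact Finset.mem_insert_self _ _
        · exact Finset.mem_insert_of_mem hy
      · exact Finset.mem_insert_of_mem (hc.mem_cycVerts_of_adj hj (hdi j hj hj0) hxy)
  have hvI : v ∉ insert w (cycVerts g c) := by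
    rw [Finset.mem_insert, mem_cycVerts, not_or]
    refine ⟨?_, hvc⟩
    rintro rfl
    omega
  have hnadj : ¬ G.Adj (c 0) v := fun hadj =>
    hvI (hcl _ (Finset.mem_insert_of_mem (mem_cycVerts.mpr ⟨0, by omega, rfl⟩)) _ hadj)
  -- The cycle and `w` form a component. If there is a hexagon, the cycle is one.
  by_cases hM0 : hexDefect G ≠ 0
  · obtain ⟨c', hc'⟩ := h.exists_hexagon_of_hexDefect_ne_zero hM0
    have := hmin _ _ hc'
    obtain rfl : g = 6 := by rcases h.six_or_eight_le hc with h' | h' <;> omega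
    exact h.false_of_hexagon_pendant hc hw hoff hw1 hd hdi
  -- Without hexagons, exactly two leaves are adjacent, and `v` has no leaf as a neighbour. The
  -- vertices outside of the two components known so far are as many as the edges between them.
  rw [not_not] at hM0
  have hM := h.hexDefect_eq hZ hL huv hbr
  rw [card_nbr_inter_leaves_eq_one hc hw hw1 hall, if_neg hnadj, hM0] at hM
  have hw_mem : w ∈ degSet G 1 := mem_degSet.mpr hw1
  have hc0 : c 0 ∉ degSet G 1 := fun h' => by rw [mem_degSet] at h'; omega
  have hle := sum_leaf_leaf_le (G := G) (D := {w}) (by simpa using hw_mem)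
    (by
      intro x hx
      rw [Finset.mem_singleton] at hx
      subst hx
      exact ⟨_, hw.symm, hc0⟩)
  rw [Finset.card_singleton, hL] at hle
  have hM' : 2 * (1 + (G.neighborFinset v ∩ degSet G 1).card)
      = ∑ l ∈ degSet G 1, (G.neighborFinset l ∩ degSet G 1).card := by
    have : (2 * (1 + (G.neighborFinset v ∩ degSet G 1).card) : ℝ)
        = ∑ l ∈ degSet G 1, ((G.neighborFinset l ∩ degSet G 1).card : ℝ) := by
      push_cast at hM
      linarith
    exact_mod_cast this
  have hv0 : (G.neighborFinset v ∩ degSet G 1).card = 0 := by omega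
  have hsum : ∑ l ∈ degSet G 1, (G.neighborFinset l ∩ degSet G 1).card = 2 := by omega
  -- the two leaves that are adjacent to each other form a component
  set T := (degSet G 1).filter fun l => ∃ l' ∈ degSet G 1, G.Adj l l' with hT
  have hTc : T.card = 2 := by
    rw [← hsum, hT, Finset.card_filter]
    refine Finset.sum_congr rfl fun l hl => ?_
    have hl1 := card_inter_degSet_one_le (mem_degSet.mp hl) (degSet G 1)
    split_ifs with hex
    · obtain ⟨l', hl', hll'⟩ := hex
      have : 0 < (G.neighborFinset l ∩ degSet G 1).card := Finset.card_pos.mpr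
        ⟨l', by rw [Finset.mem_inter, SimpleGraph.mem_neighborFinset]; exact ⟨hll', hl'⟩⟩
      omega
    · symm
      rw [Finset.card_eq_zero, Finset.eq_empty_iff_forall_notMem]
      intro l' hl'
      rw [Finset.mem_inter, SimpleGraph.mem_neighborFinset] at hl'
      exact hex ⟨l', hl'.2, hl'.1⟩
  have hTcl : ∀ x ∈ T, ∀ y, G.Adj x y → y ∈ T := by
    intro x hx y hxy
    obtain ⟨hx1, l', hl', hxl'⟩ := Finset.mem_filter.mp hx
    rw [eq_of_adj_of_degree_one (mem_degSet.mp hx1) hxy hxl']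
    exact Finset.mem_filter.mpr ⟨hl', x, hx1, hxl'.symm⟩
  have hTd : ∀ x ∈ T, G.degree x = 1 := fun x hx => mem_degSet.mp (Finset.mem_filter.mp hx).1
  have hdisj : Disjoint (insert w (cycVerts g c)) T := by
    rw [Finset.disjoint_left]
    intro x hx hxT
    rcases Finset.mem_insert.mp hx with rfl | hx
    · have := hTd _ (hTcl _ hxT _ hw.symm)
      omega
    · obtain ⟨j, hj, rfl⟩ := mem_cycVerts.mp hx
      have := hc.two_le_degree hj
      have := hTd _ hxT
      omega
  set S := (insert w (cycVerts g c) ∪ T)ᶜ with hS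
  have hvS : v ∈ S := by
    rw [hS, Finset.mem_compl, Finset.mem_union, not_or]
    refine ⟨hvI, fun hvT => ?_⟩
    have := hTd v hvT
    omega
  have hScl : ∀ x ∈ S, ∀ y, G.Adj x y → y ∈ S := by
    intro x hx y hxy
    rw [hS, Finset.mem_compl] at hx ⊢
    intro hy
    refine hx ?_
    rcases Finset.mem_union.mp hy with hy | hy
    · exact Finset.mem_union_left _ (hcl y hy x hxy.symm)
    · exact Finset.mem_union_right _ (hTcl y hy x hxy.symm)
  have hcyc : ∑ x ∈ cycVerts g c, G.degree x = 2 * g + 1 := by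
    rw [cycVerts, Finset.sum_image fun i hi j hj hij =>
      hc.inj i (by simpa using hi) j (by simpa using hj) hij,
      ← Nat.sub_add_cancel (by omega : 1 ≤ g), Finset.sum_range_succ', hd,
      Finset.sum_congr rfl fun i hi => hdi (i + 1)
        (by rw [Finset.mem_range] at hi; omega) (by omega)]
    rw [Finset.sum_const, Finset.card_range, smul_eq_mul]
    omega
  have hIsum : ∑ x ∈ insert w (cycVerts g c) ∪ T, G.degree x = 2 * g + 4 := by
    rw [Finset.sum_union hdisj, Finset.sum_insert hwc, hcyc, hw1, Finset.sum_congr rfl hTd,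
      Finset.sum_const, hTc, smul_eq_mul]
    omega
  have hIcard : (insert w (cycVerts g c) ∪ T).card = g + 3 := by
    rw [Finset.card_union_of_disjoint hdisj, Finset.card_insert_of_notMem hwc, hc.card_cycVerts,
      hTc]
  have htot : ∑ x, G.degree x + 2 = 2 * n := by
    have := h.sum_degree
    rw [eq_sub_iff_add_eq] at this
    exact_mod_cast this
  have hSsum : 2 * S.card ≤ ∑ x ∈ S, G.degree x := by
    have e := Finset.sum_add_sum_compl (insert w (cycVerts g c) ∪ T) fun x => G.degree x
    rw [← hS, hIsum] at e
    have hSc := Finset.card_add_card_compl (insert w (cycVerts g c) ∪ T)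
    rw [← hS, hIcard, h.card_eq] at hSc
    omega
  obtain ⟨g', c', hc', hc'S⟩ := exists_cycIn_of_closed ⟨v, hvS⟩ hScl hSsum
  refine h.false_of_branch_without_leaf hbr hv0 hc' fun i hi hiu => ?_
  have := hc'S i hi
  rw [hiu, hS, Finset.mem_compl] at this
  exact this (Finset.mem_union_left _
    (Finset.mem_insert_of_mem (mem_cycVerts.mpr ⟨0, by omega, rfl⟩)))

end HMate

end NoCycles

/-! ### Trees cospectral with `hTree n` -/

section Trees

open scoped Classical

variable {V : Type*} {G : SimpleGraph V}

/-- A homomorphism from a connected graph to a forest is injective as soon as it is injective on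
the neighbours of each vertex. -/
lemma injective_of_locally_injective {U : Type*} {H : SimpleGraph U} (hH : H.Connected)
    (hG : ∀ g c, ¬ CycIn G g c) {f : U → V} (hf : ∀ a b, H.Adj a b → G.Adj (f a) (f b))
    (hloc : ∀ a b c, H.Adj a b → H.Adj a c → f b = f c → b = c) : Function.Injective f := by
  intro a b hab
  obtain ⟨q, hq⟩ := (hH.preconnected a b).exists_isPath
  have hinj := injOn_of_nonbacktracking hG (L := q.length + 1) (p := fun i => f (q.getVert i))
    (fun i hi => hf _ _ (q.adj_getVert_succ (by omega)))
    (fun i hi he => by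
      have h1 := q.adj_getVert_succ (i := i) (by omega)
      have h2 := q.adj_getVert_succ (i := i + 1) (by omega)
      have := hq.getVert_injOn (by simp; omega) (by simp; omega) (hloc _ _ _ h1.symm h2 he)
      omega)
  have h0 := hinj 0 (by omega) q.length (by omega) (by simpa using hab)
  exact SimpleGraph.Walk.eq_of_length_eq_zero h0.symm

lemma mem_of_closed_of_connected (hG : G.Connected) {S : Set V} {a : V} (ha : a ∈ S)
    (hcl : ∀ v ∈ S, ∀ w, G.Adj v w → w ∈ S) (b : V) : b ∈ S := by
  obtain ⟨q⟩ := hG.preconnected a b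
  induction q with
  | nil => exact ha
  | cons hadj _ ih => exact ih (hcl _ ha _ hadj)

lemma hTree_connected {n : ℕ} (hn : 10 ≤ n) : (hTree n).Connected := by
  have : Nonempty (HVert n) := ⟨hArm 0 0⟩
  refine connected_of_not_cycIn hTree_not_cycIn ?_
  have h := sum_hTree_degree hn fun k => (k : ℝ)
  rw [card_hVert hn]
  have h' : (∑ v, ((hTree n).degree v : ℝ)) + 2 = 2 * n := by
    rw [h]
    push_cast
    ring
  exact_mod_cast h'

/-- The map from the vertices of `hTree m` given by the images `P` of the vertices of the straight
path and `A` of the vertices of the pendant paths. -/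
def hMap {m : ℕ} (P : ℕ → V) (A : Fin 2 → ℕ → V) : HVert m → V
  | .inl k => P k
  | .inr p => A p.1 p.2

lemma hMap_adj {m : ℕ} {P : ℕ → V} {A : Fin 2 → ℕ → V}
    (hP : ∀ k, k + 1 < m - 4 → G.Adj (P k) (P (k + 1)))
    (hA0 : ∀ i, G.Adj (P ((![2, m - 7] : Fin 2 → ℕ) i)) (A i 0))
    (hA1 : ∀ i, G.Adj (A i 0) (A i 1)) (a b : HVert m) (hab : (hTree m).Adj a b) :
    G.Adj (hMap P A a) (hMap P A b) := by
  have hll : ∀ k l, k < m - 4 → l < m - 4 → k + 1 = l ∨ l + 1 = k → G.Adj (P k) (P l) := by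
    rintro k l hk hl (rfl | rfl)
    exacts [hP k hl, (hP l hk).symm]
  have hla : ∀ (k : Fin (m - 4)) i j, (hTree m).Adj (hArm i j) (.inl k) →
      G.Adj (P k) (A i j) := by
    intro k i j h
    fin_cases j
    · have hk := (hTree_adj_hArm_inl i k).mp h
      rw [hk]
      exact hA0 i
    · exact absurd h (not_hTree_adj_hArm_one_inl i k)
  revert a b
  refine hVert_cases (fun k hk b hab => ?_) (fun i j b hab => ?_)
  · revert b
    refine hVert_cases (fun l hl hab => ?_) (fun i j hab => ?_)
    · exact hll k l hk hl (SimpleGraph.pathGraph_adj.mp hab)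
    · exact hla ⟨k, hk⟩ i j hab.symm
  · revert b
    refine hVert_cases (fun l hl hab => ?_) (fun i' j' hab => ?_)
    · exact (hla ⟨l, hl⟩ i j hab).symm
    · obtain ⟨rfl, hj⟩ := (hTree_adj_hArm_hArm _ _ _ _).mp hab
      fin_cases j <;> fin_cases j'
      exacts [absurd rfl hj, hA1 i, (hA1 i).symm, absurd rfl hj]

lemma hMap_injective {m : ℕ} (hm : 11 ≤ m) (hG : ∀ g c, ¬ CycIn G g c) {P : ℕ → V}
    {A : Fin 2 → ℕ → V} (hP : ∀ k, k + 1 < m - 4 → G.Adj (P k) (P (k + 1)))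
    (hA0 : ∀ i, G.Adj (P ((![2, m - 7] : Fin 2 → ℕ) i)) (A i 0))
    (hA1 : ∀ i, G.Adj (A i 0) (A i 1)) (hPn : ∀ k, k + 2 < m - 4 → P k ≠ P (k + 2))
    (hAn : ∀ i k, k = (![2, m - 7] : Fin 2 → ℕ) i + 1 ∨ k + 1 = (![2, m - 7] : Fin 2 → ℕ) i →
      A i 0 ≠ P k)
    (hAn1 : ∀ i, A i 1 ≠ P ((![2, m - 7] : Fin 2 → ℕ) i)) :
    Function.Injective (hMap P A : HVert m → V) := by
  refine injective_of_locally_injective (hTree_connected (by omega)) hG (hMap_adj hP hA0 hA1) ?_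
  have hpos : ∀ i i' : Fin 2, (![2, m - 7] : Fin 2 → ℕ) i = (![2, m - 7] : Fin 2 → ℕ) i' →
      i = i' := by
    intro i i' h
    fin_cases i <;> fin_cases i' <;> simp at h <;> first | rfl | omega
  have hla : ∀ (k l : Fin (m - 4)) i j, (hTree m).Adj (.inl k) (.inl l) →
      (hTree m).Adj (hArm i j) (.inl k) → A i j ≠ P l := by
    intro k l i j hkl h
    have hkl' : (k : ℕ) + 1 = l ∨ (l : ℕ) + 1 = k := SimpleGraph.pathGraph_adj.mp hkl
    fin_cases j
    · have hk := (hTree_adj_hArm_inl i k).mp h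
      exact hAn i l (by omega)
    · exact absurd h (not_hTree_adj_hArm_one_inl i k)
  have harm : ∀ (k : Fin (m - 4)) i j j', (hTree m).Adj (hArm i j) (.inl k) →
      (hTree m).Adj (hArm i j) (hArm i j') → A i j' ≠ P k := by
    intro k i j j' h h'
    have hjj := ((hTree_adj_hArm_hArm _ _ _ _).mp h').2
    fin_cases j
    · fin_cases j'
      · exact absurd rfl hjj
      · have hk := (hTree_adj_hArm_inl i k).mp h
        rw [hk]
        exact hAn1 i
    · exact absurd h (not_hTree_adj_hArm_one_inl i k)
  refine hVert_cases (fun k hk => ?_) (fun i j => ?_)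
  · refine hVert_cases (fun l hl => ?_) (fun i j => ?_) <;>
      refine hVert_cases (fun l' hl' h1 h2 he => ?_) (fun i' j' h1 h2 he => ?_)
    · have e1 : k + 1 = l ∨ l + 1 = k := SimpleGraph.pathGraph_adj.mp h1
      have e2 : k + 1 = l' ∨ l' + 1 = k := SimpleGraph.pathGraph_adj.mp h2
      by_contra hne
      have hne' : l ≠ l' := by rintro rfl; exact hne rfl
      change P l = P l' at he
      rcases (by omega : l' = l + 2 ∨ l = l' + 2) with rfl | rfl
      · exact hPn l hl' he
      · exact hPn l' hl he.symm
    · exact absurd he.symm (hla ⟨k, hk⟩ ⟨l, hl⟩ i' j' h1 h2.symm)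
    · exact absurd he (hla ⟨k, hk⟩ ⟨l', hl'⟩ i j h2 h1.symm)
    · fin_cases j
      · fin_cases j'
        · have e1 := (hTree_adj_hArm_inl _ _).mp h1.symm
          have e2 := (hTree_adj_hArm_inl _ _).mp h2.symm
          rw [hpos i i' (e1.symm.trans e2)]
        · exact absurd h2.symm (not_hTree_adj_hArm_one_inl _ _)
      · exact absurd h1.symm (not_hTree_adj_hArm_one_inl _ _)
  · refine hVert_cases (fun l hl => ?_) (fun i1 j1 => ?_) <;>
      refine hVert_cases (fun l' hl' h1 h2 he => ?_) (fun i' j' h1 h2 he => ?_)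
    · fin_cases j
      · have e1 := (hTree_adj_hArm_inl _ _).mp h1
        have e2 := (hTree_adj_hArm_inl _ _).mp h2
        exact congrArg _ (Fin.ext (e1.trans e2.symm))
      · exact absurd h1 (not_hTree_adj_hArm_one_inl _ _)
    · obtain ⟨rfl, -⟩ := (hTree_adj_hArm_hArm _ _ _ _).mp h2
      exact absurd he.symm (harm ⟨l, hl⟩ i j j' h1 h2)
    · obtain ⟨rfl, -⟩ := (hTree_adj_hArm_hArm _ _ _ _).mp h1
      exact absurd he (harm ⟨l', hl'⟩ i j j1 h2 h1)
    · obtain ⟨rfl, e1⟩ := (hTree_adj_hArm_hArm _ _ _ _).mp h1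
      obtain ⟨rfl, e2⟩ := (hTree_adj_hArm_hArm _ _ _ _).mp h2
      rw [(by omega : j1 = j')]

variable [Fintype V] {n : ℕ}

lemma exists_two_other_neighbors {u a : V} (hd : G.degree u = 3) (ha : G.Adj u a) :
    ∃ b c, b ≠ a ∧ c ≠ a ∧ b ≠ c ∧ G.Adj u b ∧ G.Adj u c := by
  rw [← SimpleGraph.card_neighborFinset_eq_degree] at hd
  have h2 : ((G.neighborFinset u).erase a).card = 2 := by
    rw [Finset.card_erase_of_mem (by simpa using ha), hd]
  obtain ⟨b, c, hbc, he⟩ := Finset.card_eq_two.mp h2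
  have hb : b ∈ (G.neighborFinset u).erase a := by rw [he]; simp
  have hc : c ∈ (G.neighborFinset u).erase a := by rw [he]; simp
  rw [Finset.mem_erase, SimpleGraph.mem_neighborFinset] at hb hc
  exact ⟨b, c, hb.1, hc.1, hbc, hb.2, hc.2⟩

lemma exists_tail {a w : V} (hw : G.Adj a w) (h1 : G.degree w ≠ 1) :
    ∃ w', G.Adj w w' ∧ w' ≠ a := by
  have hpos : 0 < G.degree w := (SimpleGraph.degree_pos_iff_exists_adj _ _).mpr ⟨_, hw.symm⟩
  exact exists_adj_ne_of_two_le_degree (by omega)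

/-- The neighbours in the tree obtained from `hTree 10` by removing a leaf: `0` and `1` are the
branch vertices. -/
def smallNbr : Fin 9 → Finset (Fin 9) :=
  ![{1, 2, 3}, {0, 5, 7}, {0}, {0, 4}, {3}, {1, 6}, {5}, {1, 8}, {7}]

/-- The tree obtained from `hTree 10` by removing a leaf. -/
def smallTree : SimpleGraph (Fin 9) where
  Adj a b := b ∈ smallNbr a
  symm := ⟨by decide⟩
  loopless := ⟨by decide⟩

lemma smallTree_connected : smallTree.Connected := by
  have h : ∀ a, smallTree.Reachable 0 a := by
    have step : ∀ a b, b ∈ smallNbr a → smallTree.Reachable 0 a → smallTree.Reachable 0 b :=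
      fun a b hab h => h.trans (SimpleGraph.Adj.reachable hab)
    have h1 := step 0 1 (by decide) (SimpleGraph.Reachable.refl _)
    have h3 := step 0 3 (by decide) (SimpleGraph.Reachable.refl _)
    have h5 := step 1 5 (by decide) h1
    have h7 := step 1 7 (by decide) h1
    intro a
    fin_cases a
    exacts [SimpleGraph.Reachable.refl _, h1,
      step 0 2 (by decide) (SimpleGraph.Reachable.refl _), h3, step 3 4 (by decide) h3, h5,
      step 5 6 (by decide) h5, h7, step 7 8 (by decide) h7]
  exact ⟨fun a b => (h a).symm.trans (h b)⟩

/-- The values of the positive eigenvector of the tree obtained from `hTree 10` by removing a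
leaf; it has the same largest eigenvalue as `hTree 11`. -/
noncomputable def smallVec (μ : ℝ) : Fin 9 → ℝ :=
  ![μ * (μ ^ 2 - 3), μ ^ 2 - 1, μ ^ 2 - 3, 2, μ * (5 - μ ^ 2), μ, 1, μ, 1]

lemma smallVec_pos {μ : ℝ} (h2 : 2 < μ) (hμ : μ ^ 4 - 5 * μ ^ 2 + 2 = 0) (a : Fin 9) :
    0 < smallVec μ a := by
  have hp1 : 0 < μ ^ 2 - 1 := by nlinarith
  have hp3 : 0 < μ ^ 2 - 3 := by nlinarith
  have hp5 : 0 < 5 - μ ^ 2 := by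
    by_contra! h
    nlinarith [mul_nonneg (sq_nonneg μ) (neg_nonneg.mpr h)]
  have h0 : 0 < μ := by linarith
  have hq3 := mul_pos h0 hp3
  have hq5 := mul_pos h0 hp5
  fin_cases a
  exacts [hq3, hp1, hp3, two_pos, hq5, h0, one_pos, h0, one_pos]

lemma sum_smallNbr {μ : ℝ} (hμ : μ ^ 4 - 5 * μ ^ 2 + 2 = 0) (a : Fin 9) :
    ∑ b ∈ smallNbr a, smallVec μ b = μ * smallVec μ a := by
  fin_cases a <;> simp [smallNbr, smallVec] <;> linarith

namespace HMate

lemma connected (h : HMate n G) : G.Connected := by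
  have hn := h.le
  have : Nonempty V := by
    rw [← Fintype.card_pos_iff, h.card_eq]
    omega
  refine connected_of_not_cycIn h.not_cycIn ?_
  have := h.sum_degree
  rw [eq_sub_iff_add_eq] at this
  rw [h.card_eq]
  exact_mod_cast this

/-- The branch vertices `u` and `v` of `G`; either they are not adjacent and have no leaf as a
neighbour, or they are adjacent, and have together one leaf as a neighbour. -/
lemma exists_branches (h : HMate n G) : ∃ u v, u ≠ v ∧ G.degree u = 3 ∧ G.degree v = 3 ∧
    (¬ G.Adj u v ∧ (G.neighborFinset u ∩ degSet G 1).card = 0 ∧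
        (G.neighborFinset v ∩ degSet G 1).card = 0 ∨
      G.Adj u v ∧ (G.neighborFinset u ∩ degSet G 1).card = 1 ∧
        (G.neighborFinset v ∩ degSet G 1).card = 0) := by
  obtain ⟨hZ, hL, hB⟩ := h.degSet_zero_empty
  obtain ⟨u, v, huv, hbr⟩ := Finset.card_eq_two.mp hB
  have hdu : G.degree u = 3 := mem_degSet.mp (by rw [hbr]; simp)
  have hdv : G.degree v = 3 := mem_degSet.mp (by rw [hbr]; simp)
  have hM := h.hexDefect_eq hZ hL huv hbr
  have hM0 : hexDefect G = 0 := by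
    by_contra hne
    obtain ⟨c, hc⟩ := h.exists_hexagon_of_hexDefect_ne_zero hne
    exact h.not_cycIn _ _ hc
  have hleaf : ∑ l ∈ degSet G 1, ((G.neighborFinset l ∩ degSet G 1).card : ℝ) = 0 := by
    refine Finset.sum_eq_zero fun l hl => ?_
    rw [Nat.cast_eq_zero, Finset.card_eq_zero, Finset.eq_empty_iff_forall_notMem]
    intro l' hl'
    rw [Finset.mem_inter, SimpleGraph.mem_neighborFinset, mem_degSet] at hl'
    rw [mem_degSet] at hl
    have hmem := mem_of_closed_of_connected h.connected (S := {l, l'}) (a := l) (by simp) (by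
      rintro x (rfl | rfl) y hxy
      · exact Or.inr (eq_of_adj_of_degree_one hl hxy hl'.1)
      · exact Or.inl (eq_of_adj_of_degree_one hl'.2 hxy hl'.1.symm)) u
    rcases hmem with rfl | rfl <;> omega
  rw [hM0, hleaf] at hM
  by_cases hadj : G.Adj u v
  · rw [if_pos hadj] at hM
    have h1 : (G.neighborFinset u ∩ degSet G 1).card + (G.neighborFinset v ∩ degSet G 1).card
        = 1 := by
      have : ((G.neighborFinset u ∩ degSet G 1).card : ℝ)
          + (G.neighborFinset v ∩ degSet G 1).card = 1 := by linarith
      exact_mod_cast this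
    rcases Nat.eq_zero_or_pos (G.neighborFinset v ∩ degSet G 1).card with h0 | h0
    · exact ⟨u, v, huv, hdu, hdv, Or.inr ⟨hadj, by omega, h0⟩⟩
    · exact ⟨v, u, huv.symm, hdv, hdu, Or.inr ⟨hadj.symm, by omega, by omega⟩⟩
  · rw [if_neg hadj] at hM
    have h1 : (G.neighborFinset u ∩ degSet G 1).card + (G.neighborFinset v ∩ degSet G 1).card
        = 0 := by
      have : ((G.neighborFinset u ∩ degSet G 1).card : ℝ)
          + (G.neighborFinset v ∩ degSet G 1).card = 0 := by linarith
      exact_mod_cast this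
    exact ⟨u, v, huv, hdu, hdv, Or.inl ⟨hadj, by omega, by omega⟩⟩

lemma degree_ne_one_of_adj {u x : V} (hu : (G.neighborFinset u ∩ degSet G 1).card = 0)
    (hx : G.Adj u x) : G.degree x ≠ 1 := by
  intro h1
  rw [Finset.card_eq_zero, Finset.eq_empty_iff_forall_notMem] at hu
  refine hu x ?_
  rw [Finset.mem_inter, SimpleGraph.mem_neighborFinset, mem_degSet]
  exact ⟨hx, h1⟩

/-- If the branch vertices were adjacent, then `G` would contain the tree `smallTree`, whose largest
eigenvalue is that of `hTree 11`. It is too large for `n ≥ 12`, and for `n = 11` it would make `G`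
equal to `smallTree`, which has only nine vertices. -/
lemma false_of_adj_branches (h : HMate n G) {u v : V} (hdu : G.degree u = 3)
    (hdv : G.degree v = 3) (huv : G.Adj u v) (hu : (G.neighborFinset u ∩ degSet G 1).card = 1)
    (hv : (G.neighborFinset v ∩ degSet G 1).card = 0) : False := by
  obtain ⟨x, y, hxu, hyu, hxy, hx, hy⟩ := exists_two_other_neighbors hdv huv.symm
  obtain ⟨x', hxx', hx'v⟩ := exists_tail hx (degree_ne_one_of_adj hv hx)
  obtain ⟨y', hyy', hy'v⟩ := exists_tail hy (degree_ne_one_of_adj hv hy)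
  obtain ⟨l, w, hlv, hwv, hlw, hl, hw, hw1⟩ : ∃ l w, l ≠ v ∧ w ≠ v ∧ l ≠ w ∧ G.Adj u l ∧
      G.Adj u w ∧ G.degree w ≠ 1 := by
    obtain ⟨b, c, hbv, hcv, hbc, hb, hc⟩ := exists_two_other_neighbors hdu huv
    by_cases hc1 : G.degree c = 1
    · refine ⟨c, b, hcv, hbv, hbc.symm, hc, hb, fun hb1 => hbc ?_⟩
      refine Finset.card_le_one.mp hu.le b ?_ c ?_ <;>
        rw [Finset.mem_inter, SimpleGraph.mem_neighborFinset, mem_degSet]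
      exacts [⟨hb, hb1⟩, ⟨hc, hc1⟩]
    · exact ⟨b, c, hbv, hcv, hbc, hb, hc, hc1⟩
  obtain ⟨w', hww', hw'u⟩ := exists_tail hw hw1
  set f : Fin 9 → V := ![u, v, l, w, w', x, x', y, y'] with hf
  have hN : ∀ a, ∀ b ∈ smallNbr a, G.Adj (f a) (f b) := by
    intro a b hb
    fin_cases a <;> simp [smallNbr] at hb
    · rcases hb with rfl | rfl | rfl
      exacts [huv, hl, hw]
    · rcases hb with rfl | rfl | rfl
      exacts [huv.symm, hx, hy]
    · subst hb; exact hl.symm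
    · rcases hb with rfl | rfl
      exacts [hw.symm, hww']
    · subst hb; exact hww'.symm
    · rcases hb with rfl | rfl
      exacts [hx.symm, hxx']
    · subst hb; exact hxx'.symm
    · rcases hb with rfl | rfl
      exacts [hy.symm, hyy']
    · subst hb; exact hyy'.symm
  have hinj : Function.Injective f := by
    refine injective_of_locally_injective smallTree_connected h.not_cycIn hN fun a => ?_
    have hloc : ∀ b ∈ smallNbr a, ∀ c ∈ smallNbr a, b < c → f b ≠ f c := by
      intro b hb c hc hbc
      fin_cases a <;> simp [smallNbr] at hb hc
      · rcases hb with rfl | rfl | rfl <;> rcases hc with rfl | rfl | rfl <;>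
          first | exact absurd hbc (by decide) | exact hlv.symm | exact hwv.symm | exact hlw
      · rcases hb with rfl | rfl | rfl <;> rcases hc with rfl | rfl | rfl <;>
          first | exact absurd hbc (by decide) | exact hxu.symm | exact hyu.symm | exact hxy
      · subst hb hc; exact absurd hbc (by decide)
      · rcases hb with rfl | rfl <;> rcases hc with rfl | rfl <;>
          first | exact absurd hbc (by decide) | exact hw'u.symm
      · subst hb hc; exact absurd hbc (by decide)
      · rcases hb with rfl | rfl <;> rcases hc with rfl | rfl <;>
          first | exact absurd hbc (by decide) | exact hx'v.symm
      · subst hb hc; exact absurd hbc (by decide)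
      · rcases hb with rfl | rfl <;> rcases hc with rfl | rfl <;>
          first | exact absurd hbc (by decide) | exact hy'v.symm
      · subst hb hc; exact absurd hbc (by decide)
    intro b c hb hc he
    by_contra hne
    rcases lt_or_gt_of_ne hne with hlt | hlt
    · exact hloc b hb c hc hlt he
    · exact hloc c hc b hb hlt he.symm
  obtain ⟨μ, hμ2, hμ, ⟨rfl, hle⟩ | hle⟩ := h.exists_root_eleven
  · have hnb := hle.neighborFinset_eq_image hinj hN (smallVec_pos (by linarith) hμ)
      (fun a => (sum_smallNbr hμ a).ge)
    have hmem := mem_of_closed_of_connected h.connected (S := Set.range f) (a := f 0) ⟨0, rfl⟩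
      (by
        rintro _ ⟨a, rfl⟩ z hz
        rw [← SimpleGraph.mem_neighborFinset, hnb] at hz
        obtain ⟨b, -, rfl⟩ := Finset.mem_image.mp hz
        exact ⟨b, rfl⟩)
    have := Fintype.card_le_of_surjective f hmem
    rw [h.card_eq, Fintype.card_fin] at this
    omega
  · have := hle.le_of_subsolution hinj hN (smallVec_pos (by linarith) hμ)
      (fun a => (sum_smallNbr hμ a).ge)
    linarith

lemma sum_neighborFinset {W : Type*} [Fintype W] (H : SimpleGraph W) (x : W → ℝ) (a : W) :
    ∑ b ∈ H.neighborFinset a, x b = nbSum H x a := by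
  rw [nbSum, SimpleGraph.neighborFinset_eq_filter, Finset.sum_filter]

/-- If `hTree m` embeds in `G`, then `G` is isomorphic to `hTree n`: the largest eigenvalue of
`hTree m` decreases strictly with `m`, so that `m = n`, and a proper supergraph of `hTree n` on the
same vertices has a larger largest eigenvalue. -/
lemma nonempty_iso_of_embedding (h : HMate n G) {m : ℕ} (hm : 11 ≤ m) {f : HVert m → V}
    (hf : Function.Injective f) (hadj : ∀ a b, (hTree m).Adj a b → G.Adj (f a) (f b)) :
    Nonempty (hTree n ≃g G) := by
  have hmn : m ≤ n := by
    have := Fintype.card_le_of_injective f hf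
    rwa [h.card_eq, card_hVert (by omega)] at this
  have hN : ∀ a, ∀ b ∈ (hTree m).neighborFinset a, G.Adj (f a) (f b) := fun a b hb =>
    hadj a b (by simpa using hb)
  obtain ⟨t, ht0, ht1, ht, hle, -⟩ := h.exists_root
  obtain ⟨s, hs0, hs1, hs⟩ := exists_hTree_root (m - 9)
  have hsub : ∀ a, (s + s⁻¹) * hVec m s a ≤ ∑ b ∈ (hTree m).neighborFinset a, hVec m s b := by
    intro a
    rw [sum_neighborFinset, nbSum_hVec hm hs0 hs]
  have : Nonempty (HVert m) := ⟨hArm 0 0⟩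
  have hst : s ≤ t := le_hTree_root (by omega : m - 9 ≤ n - 9) hs0 hs1 ht0 ht hs.ge
  have hst' : s + s⁻¹ ≤ t + t⁻¹ := hle.le_of_subsolution hf hN (hVec_pos hs0) hsub
  have hEq : s = t := by
    have hd : s + s⁻¹ - (t + t⁻¹) = (t - s) * (1 - s * t) / (s * t) := by field_simp; ring
    by_contra hne
    have hlt : s < t := lt_of_le_of_ne hst hne
    have : 0 < (t - s) * (1 - s * t) / (s * t) :=
      div_pos (mul_pos (sub_pos.mpr hlt) (by nlinarith)) (mul_pos hs0 ht0)
    linarith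
  subst hEq
  have hmn' : m - 9 = n - 9 := by
    have hpos : 0 < s ^ 2 * (1 + s ^ 2 - s ^ 4) := by
      have : s ^ 4 ≤ s ^ 2 := pow_le_pow_of_le_one hs0.le hs1.le (by norm_num)
      exact mul_pos (by positivity) (by linarith)
    exact pow_right_injective₀ hs0 hs1.ne (mul_right_cancel₀ hpos.ne' (hs.symm.trans ht))
  obtain rfl : m = n := by omega
  have hnb := hle.neighborFinset_eq_image hf hN (hVec_pos hs0) hsub
  have hbij : Function.Bijective f := (Fintype.bijective_iff_injective_and_card f).mpr
    ⟨hf, by rw [h.card_eq, card_hVert (by omega)]⟩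
  refine ⟨⟨Equiv.ofBijective f hbij, fun {a b} => ⟨fun hab => ?_, hadj a b⟩⟩⟩
  have hab' : f b ∈ G.neighborFinset (f a) := by simpa using hab
  rw [hnb] at hab'
  obtain ⟨b', hb', he⟩ := Finset.mem_image.mp hab'
  rw [← hf he]
  simpa using hb'

/-- A graph cospectral with `hTree n` whose branch vertices are not adjacent contains a copy of
`hTree m`, where `m - 9` is the distance of the branch vertices. -/
lemma exists_embedding (h : HMate n G) {u v : V} (hne : u ≠ v) (hdu : G.degree u = 3)
    (hdv : G.degree v = 3) (huv : ¬ G.Adj u v)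
    (hu : (G.neighborFinset u ∩ degSet G 1).card = 0)
    (hv : (G.neighborFinset v ∩ degSet G 1).card = 0) :
    ∃ m, 11 ≤ m ∧ ∃ f : HVert m → V, Function.Injective f ∧
      ∀ a b, (hTree m).Adj a b → G.Adj (f a) (f b) := by
  obtain ⟨q, hq⟩ := (h.connected.preconnected u v).exists_isPath
  set d := q.length with hd
  have hd0 : d ≠ 0 := fun h0 => hne (SimpleGraph.Walk.eq_of_length_eq_zero h0)
  have hd1 : d ≠ 1 := fun h1 => huv (SimpleGraph.Walk.adj_of_length_eq_one h1)
  have hq0 : q.getVert 0 = u := q.getVert_zero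
  have hqd : q.getVert d = v := q.getVert_length
  have hstep : ∀ i, i < d → G.Adj (q.getVert i) (q.getVert (i + 1)) := fun i hi =>
    q.adj_getVert_succ hi
  have hfst : G.Adj u (q.getVert 1) := by
    have := hstep 0 (by omega)
    rwa [hq0] at this
  have hlst : G.Adj v (q.getVert (d - 1)) := by
    have := hstep (d - 1) (by omega)
    rw [show d - 1 + 1 = d by omega, hqd] at this
    exact this.symm
  obtain ⟨w, x, hw1, hx1, hwx, hw, hx⟩ := exists_two_other_neighbors hdu hfst
  obtain ⟨z, y, hz1, hy1, hzy, hz, hy⟩ := exists_two_other_neighbors hdv hlst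
  obtain ⟨w', hww', hw'⟩ := exists_tail hw (degree_ne_one_of_adj hu hw)
  obtain ⟨x', hxx', hx'⟩ := exists_tail hx (degree_ne_one_of_adj hu hx)
  obtain ⟨y', hyy', hy'⟩ := exists_tail hy (degree_ne_one_of_adj hv hy)
  obtain ⟨z', hzz', hz'⟩ := exists_tail hz (degree_ne_one_of_adj hv hz)
  -- the straight path consists of `w'`, `w`, the path from `u` to `v`, `z` and `z'`
  set P : ℕ → V := fun k => if k = 0 then w' else if k = 1 then w else if k ≤ d + 2 then
    q.getVert (k - 2) else if k = d + 3 then z else z' with hP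
  set A : Fin 2 → ℕ → V := fun i j => if j = 0 then ![x, y] i else ![x', y'] i with hA
  have P0 : P 0 = w' := rfl
  have P1 : P 1 = w := rfl
  have P2 : ∀ k, k ≤ d → P (k + 2) = q.getVert k := by
    intro k hk
    simp only [hP]
    rw [if_neg (by omega), if_neg (by omega), if_pos (by omega)]
    rfl
  have P3 : P (d + 3) = z := by
    simp only [hP]
    rw [if_neg (by omega), if_neg (by omega), if_neg (by omega), if_pos True.intro]
  have P4 : P (d + 4) = z' := by
    simp only [hP]
    rw [if_neg (by omega), if_neg (by omega), if_neg (by omega), if_neg (by omega)]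
  have hPadj : ∀ k, k + 1 < d + 9 - 4 → G.Adj (P k) (P (k + 1)) := by
    intro k hk
    rcases (by omega : k = 0 ∨ k = 1 ∨ (2 ≤ k ∧ k - 2 < d) ∨ k = d + 2 ∨ k = d + 3)
      with rfl | rfl | ⟨h2, h3⟩ | rfl | rfl
    · exact hww'.symm
    · rw [P1, P2 0 (by omega), hq0]; exact hw.symm
    · obtain ⟨j, rfl⟩ : ∃ j, k = j + 2 := ⟨k - 2, by omega⟩
      rw [P2 j (by omega), show j + 2 + 1 = j + 1 + 2 by omega, P2 (j + 1) (by omega)]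
      exact hstep j (by omega)
    · rw [P2 d le_rfl, P3, hqd]; exact hz
    · rw [P3, P4]; exact hzz'
  have hPne : ∀ k, k + 2 < d + 9 - 4 → P k ≠ P (k + 2) := by
    intro k hk
    rcases (by omega : k = 0 ∨ k = 1 ∨ (2 ≤ k ∧ k ≤ d) ∨ k = d + 1 ∨ k = d + 2)
      with rfl | rfl | ⟨h2, h3⟩ | rfl | rfl
    · rw [P0, P2 0 (by omega), hq0]; exact hw'
    · rw [P1, P2 1 (by omega)]; exact hw1
    · obtain ⟨j, rfl⟩ : ∃ j, k = j + 2 := ⟨k - 2, by omega⟩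
      rw [P2 j (by omega), P2 (j + 2) (by omega)]
      intro he
      have := hq.getVert_injOn (by simp; omega) (by simp; omega) he
      omega
    · rw [show d + 1 = d - 1 + 2 by omega, P2 (d - 1) (by omega),
        show d - 1 + 2 + 2 = d + 3 by omega, P3]
      exact hz1.symm
    · rw [P2 d le_rfl, show d + 2 + 2 = d + 4 by omega, P4, hqd]
      exact hz'.symm
  have hA0 : ∀ i, G.Adj (P ((![2, d + 9 - 7] : Fin 2 → ℕ) i)) (A i 0) := by
    intro i
    fin_cases i
    · change G.Adj (P (0 + 2)) x
      rw [P2 0 (by omega), hq0]; exact hx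
    · change G.Adj (P (d + 2)) y
      rw [P2 d le_rfl, hqd]; exact hy
  have hA1 : ∀ i, G.Adj (A i 0) (A i 1) := by
    intro i
    fin_cases i
    exacts [hxx', hyy']
  refine ⟨d + 9, by omega, hMap P A, hMap_injective (by omega) h.not_cycIn hPadj hA0 hA1 hPne
    (fun i k hk => ?_) (fun i => ?_), hMap_adj hPadj hA0 hA1⟩
  · fin_cases i
    · change x ≠ P k
      change k = 3 ∨ k + 1 = 2 at hk
      rcases hk with rfl | hk
      · rw [P2 1 (by omega)]; exact hx1
      · rw [(by omega : k = 1), P1]; exact hwx.symm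
    · change y ≠ P k
      change k = d + 2 + 1 ∨ k + 1 = d + 2 at hk
      rcases hk with rfl | hk
      · rw [P3]; exact hzy.symm
      · rw [(by omega : k = d - 1 + 2), P2 (d - 1) (by omega)]; exact hy1
  · fin_cases i
    · change x' ≠ P (0 + 2)
      rw [P2 0 (by omega), hq0]; exact hx'
    · change y' ≠ P (d + 2)
      rw [P2 d le_rfl, hqd]; exact hy'

theorem nonempty_iso (h : HMate n G) : Nonempty (hTree n ≃g G) := by
  obtain ⟨u, v, hne, hdu, hdv, ⟨huv, hu, hv⟩ | ⟨huv, hu, hv⟩⟩ := h.exists_branches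
  · obtain ⟨m, hm, f, hf, hadj⟩ := h.exists_embedding hne hdu hdv huv hu hv
    exact h.nonempty_iso_of_embedding hm hf hadj
  · exact absurd (h.false_of_adj_branches hdu hdv huv hu hv) not_false

end HMate

end Trees

/-! ### The mates of orders 10, 13 and 15 -/

section CospectralMates

variable {V W : Type*} [Fintype V] [Fintype W]

/-- Graphs whose adjacency matrices are intertwined by an invertible matrix are cospectral. The
inverse of `P` is given by `Q`, up to the factor `c`. -/
lemma adjSpectrum_eq_of_intertwiner [DecidableEq V] {G : SimpleGraph V} {H : SimpleGraph W}
    [DecidableRel G.Adj] [DecidableRel H.Adj] (hcard : Fintype.card V = Fintype.card W)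
    (P : V → W → ℤ) (Q : W → V → ℤ) {c : ℤ} (hc : c ≠ 0)
    (h1 : ∀ i j, (∑ k, if G.Adj i k then P k j else 0) = ∑ k, if H.Adj k j then P i k else 0)
    (h2 : ∀ i j, ∑ k, P i k * Q k j = if i = j then c else 0) :
    adjSpectrum G = adjSpectrum H := by
  classical
  have e : V ≃ W := Fintype.equivOfCardEq hcard
  set A : Matrix V V ℝ := G.adjMatrix ℝ with hA
  set B : Matrix V V ℝ := Matrix.reindex e.symm e.symm (H.adjMatrix ℝ) with hB
  set P' : Matrix V V ℝ := Matrix.of fun i j => (P i (e j) : ℝ) with hP'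
  set Q' : Matrix V V ℝ := Matrix.of fun i j => (Q (e i) j : ℝ) with hQ'
  have hc' : (c : ℝ) ≠ 0 := by exact_mod_cast hc
  have hPQ : P' * ((c : ℝ)⁻¹ • Q') = 1 := by
    ext i j
    rw [Matrix.mul_smul, Matrix.smul_apply, Matrix.mul_apply, Matrix.one_apply, smul_eq_mul]
    have : ∑ k, P' i k * Q' k j = if i = j then (c : ℝ) else 0 := by
      have h := h2 i j
      rw [← e.sum_comp fun k => P i k * Q k j] at h
      simp only [hP', hQ', Matrix.of_apply]
      exact_mod_cast h
    rw [this]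
    split_ifs
    · exact inv_mul_cancel₀ hc'
    · exact mul_zero _
  have hAP : A * P' = P' * B := by
    ext i j
    rw [Matrix.mul_apply, Matrix.mul_apply]
    have h := h1 i (e j)
    rw [← e.sum_comp fun k => if H.Adj k (e j) then P i k else 0] at h
    have h' : (∑ k, if G.Adj i k then (P k (e j) : ℝ) else 0)
        = ∑ k, if H.Adj (e k) (e j) then (P i (e k) : ℝ) else 0 := by exact_mod_cast h
    simp only [hA, hB, hP', Matrix.of_apply, Matrix.reindex_apply, Matrix.submatrix_apply,
      Equiv.symm_symm, SimpleGraph.adjMatrix_apply, ite_mul, mul_ite, one_mul, zero_mul, mul_one,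
      mul_zero]
    exact h'
  have hQP : ((c : ℝ)⁻¹ • Q') * P' = 1 := mul_eq_one_comm.mp hPQ
  have hchar : A.charpoly = B.charpoly := by
    have hconj := Matrix.charpoly_units_conj ⟨P', _, hPQ, hQP⟩ B
    rw [← hconj]
    congr 1
    change A = P' * B * P'⁻¹
    rw [← hAP, Matrix.mul_assoc, Matrix.mul_nonsing_inv _ (Matrix.isUnit_det_of_right_inverse hPQ),
      Matrix.mul_one]
  rw [hB, Matrix.charpoly_reindex] at hchar
  unfold adjSpectrum
  convert congrArg Polynomial.roots hchar

instance {r : ℕ} : DecidableRel (SimpleGraph.pathGraph r).Adj := fun _ _ =>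
  decidable_of_iff _ SimpleGraph.pathGraph_adj.symm

instance {r t : ℕ} {B : SimpleGraph (Fin r)} [DecidableRel B.Adj] {m n : Fin t → ℕ} :
    DecidableRel (attachPaths B m n).Adj
  | .inl u, .inl v => inferInstanceAs (Decidable (B.Adj u v))
  | .inl u, .inr p => inferInstanceAs (Decidable ((u : ℕ) = m p.1 ∧ (p.2 : ℕ) = 0))
  | .inr p, .inl u => inferInstanceAs (Decidable ((u : ℕ) = m p.1 ∧ (p.2 : ℕ) = 0))
  | .inr p, .inr q => inferInstanceAs
      (Decidable (p.1 = q.1 ∧ ((p.2 : ℕ) + 1 = q.2 ∨ (q.2 : ℕ) + 1 = p.2)))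

instance {r t : ℕ} {m n : Fin t → ℕ} : DecidableRel (openQuipu r m n).Adj :=
  inferInstanceAs (DecidableRel (attachPaths (SimpleGraph.pathGraph r) m n).Adj)

instance {r t : ℕ} {m n : Fin t → ℕ} : DecidableRel (closedQuipu r m n).Adj :=
  inferInstanceAs (DecidableRel (attachPaths (SimpleGraph.cycleGraph r) m n).Adj)

instance {n : ℕ} : DecidableRel (hTree n).Adj :=
  inferInstanceAs (DecidableRel (openQuipu (n - 4) ![2, n - 7] ![2, 2]).Adj)

instance {V W : Type*} {G : SimpleGraph V} {H : SimpleGraph W} [DecidableRel G.Adj]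
    [DecidableRel H.Adj] : DecidableRel (G ⊕g H).Adj
  | .inl u, .inl v => inferInstanceAs (Decidable (G.Adj u v))
  | .inr u, .inr v => inferInstanceAs (Decidable (H.Adj u v))
  | .inl _, .inr _ => inferInstanceAs (Decidable (false = true))
  | .inr _, .inl _ => inferInstanceAs (Decidable (false = true))

/-- The position of a vertex of a graph with attached paths: the vertices of the base come first,
followed by those of the attached paths. -/
def attachIdx {r t : ℕ} {n : Fin t → ℕ} : Fin r ⊕ (Σ i : Fin t, Fin (n i)) → ℕ
  | .inl k => k
  | .inr p => r + (∑ i, if i < p.1 then n i else 0) + p.2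

/-- The position of a vertex of a disjoint union whose first part has `k` vertices. -/
def sumIdx {V W : Type*} (k : ℕ) (f : V → ℕ) (g : W → ℕ) : V ⊕ W → ℕ :=
  Sum.elim f fun w => k + g w

/-- The entry of a table, `0` outside of it. -/
def tableEntry (T : List (List ℤ)) (i j : ℕ) : ℤ :=
  (T.getD i []).getD j 0

/-- `hTree n` is connected, unlike a disjoint union. -/
lemma isEmpty_iso_sum {n : ℕ} (hn : 10 ≤ n) {V W : Type*} [Nonempty V] [Nonempty W]
    (G : SimpleGraph V) (H : SimpleGraph W) : IsEmpty (hTree n ≃g (G ⊕g H)) :=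
  ⟨fun e => SimpleGraph.not_connected_sum (e.connected_iff.mp (hTree_connected hn))⟩

/-- An invertible matrix intertwining the adjacency matrices of `hTree 10` and of its mate. -/
def intertwinerTen : List (List ℤ) :=
  [
   [0, 0, 0, 0, 0, 0, 0, 1, -1, 0],
   [0, 0, 0, 0, 0, 0, 1, 0, 0, 0],
   [0, 0, 0, 0, 0, 1, 0, 0, 1, 0],
   [0, 0, 1, 0, 0, 0, 0, 0, 0, 1],
   [0, 1, 0, 0, 0, 0, 0, 1, 0, 0],
   [1, 0, 0, 0, 0, 0, 1, 0, 0, -1],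
   [0, 0, 0, 0, 1, 0, 0, 0, 0, 0],
   [0, 0, 0, 1, 0, 0, 0, 0, -1, 0],
   [0, -1, 0, 1, 0, 0, 0, 0, 0, 0],
   [-1, 0, 0, 0, 1, 0, 0, 0, 0, -1]]

/-- The inverse of `intertwinerTen`, multiplied by `2`. -/
def intertwinerTenInv : List (List ℤ) :=
  [
   [0, -1, 0, 0, 0, 1, 1, 0, 0, -1],
   [-1, 0, 0, 0, 1, 0, 0, 1, -1, 0],
   [0, -1, 0, 2, 0, 1, -1, 0, 0, 1],
   [-1, 0, 0, 0, 1, 0, 0, 1, 1, 0],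
   [0, 0, 0, 0, 0, 0, 2, 0, 0, 0],
   [1, 0, 2, 0, -1, 0, 0, 1, -1, 0],
   [0, 2, 0, 0, 0, 0, 0, 0, 0, 0],
   [1, 0, 0, 0, 1, 0, 0, -1, 1, 0],
   [-1, 0, 0, 0, 1, 0, 0, -1, 1, 0],
   [0, 1, 0, 0, 0, -1, 1, 0, 0, -1]]

/-- An invertible matrix intertwining the adjacency matrices of `hTree 13` and of its mate. -/
def intertwinerThirteen : List (List ℤ) :=
  [
   [0, 0, 0, 1, 0, 0, 0, 0, 0, 0, 0, 1, 0],
   [0, 0, 1, 0, 0, 0, 1, 0, 0, 0, 1, 0, 0],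
   [0, 1, 0, 0, 0, 0, 0, 1, 0, 1, 0, 1, 1],
   [1, 0, 0, 0, 0, 0, 1, 0, 1, 0, 1, 0, 0],
   [0, 0, 0, 0, 0, 0, 0, 1, 0, 1, 0, 1, 0],
   [-1, 0, 0, 0, 0, 0, 1, 0, 1, 0, 1, 0, 0],
   [0, -1, 0, 0, 0, 0, 0, 1, 0, 1, 0, 1, 1],
   [0, 0, -1, 0, 0, 0, 1, 0, 0, 0, 1, 0, 0],
   [0, 0, 0, -1, 0, 0, 0, 0, 0, 0, 0, 1, 0],
   [0, 0, 0, 0, 1, 0, 1, 0, 1, 0, 0, 0, 0],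
   [0, 0, 0, 0, 0, 1, 0, 1, 0, 0, 0, 0, 0],
   [0, 0, 0, 0, -1, 0, 1, 0, 1, 0, 0, 0, 0],
   [0, 0, 0, 0, 0, -1, 0, 1, 0, 0, 0, 0, 0]]

/-- The inverse of `intertwinerThirteen`, multiplied by `2`. -/
def intertwinerThirteenInv : List (List ℤ) :=
  [
   [0, 0, 0, 1, 0, -1, 0, 0, 0, 0, 0, 0, 0],
   [0, 0, 1, 0, 0, 0, -1, 0, 0, 0, 0, 0, 0],
   [0, 1, 0, 0, 0, 0, 0, -1, 0, 0, 0, 0, 0],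
   [1, 0, 0, 0, 0, 0, 0, 0, -1, 0, 0, 0, 0],
   [0, 0, 0, 0, 0, 0, 0, 0, 0, 1, 0, -1, 0],
   [0, 0, 0, 0, 0, 0, 0, 0, 0, 0, 1, 0, -1],
   [0, 1, 0, -1, 0, -1, 0, 1, 0, 1, 0, 1, 0],
   [0, 0, 0, 0, 0, 0, 0, 0, 0, 0, 1, 0, 1],
   [0, -1, 0, 1, 0, 1, 0, -1, 0, 0, 0, 0, 0],
   [-1, 0, 0, 0, 2, 0, 0, 0, -1, 0, -1, 0, -1],
   [0, 0, 0, 1, 0, 1, 0, 0, 0, -1, 0, -1, 0],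
   [1, 0, 0, 0, 0, 0, 0, 0, 1, 0, 0, 0, 0],
   [0, 0, 1, 0, -2, 0, 1, 0, 0, 0, 0, 0, 0]]

/-- An invertible matrix intertwining the adjacency matrices of `hTree 15` and of its mate. -/
def intertwinerFifteen : List (List ℤ) :=
  [
   [0, 0, 0, 0, 0, -1, -1, 0, 1, 0, 0, 0, 1, 0, 0],
   [0, -1, 0, 0, -1, 0, 0, 1, 0, 0, 0, 1, 0, 1, 0],
   [-1, 0, -1, 0, 0, 0, 0, 0, 0, 0, 1, 0, 1, 0, 1],
   [0, 0, 0, -1, 0, 0, 0, 0, 0, 1, 0, 0, 0, 1, 0],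
   [1, 0, 0, 0, -1, 0, 0, -1, 0, 0, 0, 0, 0, 0, 1],
   [0, 1, 0, -1, 0, -1, 0, 0, -1, 0, 0, 0, 0, 0, 0],
   [0, 0, 0, 0, -1, 0, 1, -1, 0, 0, 0, 0, 0, 0, -1],
   [0, 0, 0, -1, 0, 0, 0, 0, 0, -1, 0, 0, 0, -1, 0],
   [0, 0, -1, 0, 0, 0, -1, 0, 0, 0, -1, 0, -1, 0, -1],
   [0, -1, 0, 0, 1, 0, 0, -1, 0, -1, 0, -1, 0, 0, 0],
   [-1, 0, 0, 0, 0, 1, 0, 0, -1, 0, -1, 0, 0, 0, 0],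
   [0, -1, 0, 0, 1, 0, 0, -1, 0, 1, 0, 1, 0, 0, 0],
   [0, 0, 0, 0, 0, 1, -1, 0, -1, 0, 1, 0, 0, 0, 0],
   [0, -1, 0, 0, -1, 0, 0, 1, 0, 0, 0, -1, 0, -1, 0],
   [-1, 0, 0, 0, 0, -1, 0, 0, 1, 0, 0, 0, -1, 0, 0]]

/-- The inverse of `intertwinerFifteen`, multiplied by `8`. -/
def intertwinerFifteenInv : List (List ℤ) :=
  [
   [-1, 0, -1, 0, 1, 0, -1, 0, 1, 0, -3, 0, -1, 0, -3],
   [0, -2, 0, 0, 0, 0, 0, 0, 0, -2, 0, -2, 0, -2, 0],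
   [2, 0, -4, 0, 0, 0, 0, 0, -4, 0, 2, 0, 2, 0, 2],
   [0, 0, 0, -4, 0, 0, 0, -4, 0, 0, 0, 0, 0, 0, 0],
   [-1, -1, 0, 0, -2, 0, -2, 0, 0, 1, -1, 1, -1, -1, -1],
   [-1, -1, 0, 2, 0, -4, 0, 2, 0, -1, 1, -1, 1, -1, -1],
   [-3, 0, 1, 0, -1, 0, 1, 0, -1, 0, -1, 0, -3, 0, -1],
   [-1, 1, 0, 0, -2, 0, -2, 0, 0, -1, -1, -1, -1, 1, -1],
   [1, -1, 0, 2, 0, -4, 0, 2, 0, -1, -1, -1, -1, -1, 1],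
   [0, -2, 0, 2, 0, 0, 0, -2, 0, -2, 0, 2, 0, 2, 0],
   [-1, 0, 1, 0, -1, 0, 1, 0, -1, 0, -3, 0, 3, 0, 1],
   [0, 2, 0, -2, 0, 0, 0, 2, 0, -2, 0, 2, 0, -2, 0],
   [3, 0, 1, 0, -1, 0, 1, 0, -1, 0, 1, 0, -1, 0, -3],
   [0, 2, 0, 2, 0, 0, 0, -2, 0, 2, 0, -2, 0, -2, 0],
   [-1, 0, 1, 0, 3, 0, -3, 0, -1, 0, 1, 0, -1, 0, 1]]

lemma cospectralMates_ten :
    CospectralMates (hTree 10) (SimpleGraph.pathGraph 2 ⊕g closedQuipu 6 ![0, 3] ![1, 1]) := by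
  refine ⟨isEmpty_iso_sum (by norm_num) _ _, ?_⟩
  refine adjSpectrum_eq_of_intertwiner (by decide +kernel)
    (fun i j => tableEntry intertwinerTen (attachIdx i) (sumIdx 2 Fin.val attachIdx j))
    (fun i j => tableEntry intertwinerTenInv (sumIdx 2 Fin.val attachIdx i) (attachIdx j))
    (c := 2) (by norm_num) ?_ ?_ <;> decide +kernel

lemma cospectralMates_thirteen :
    CospectralMates (hTree 13) (openQuipu 4 ![1] ![2] ⊕g closedQuipu 6 ![0] ![1]) := by
  refine ⟨isEmpty_iso_sum (by norm_num) _ _, ?_⟩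
  refine adjSpectrum_eq_of_intertwiner (by decide +kernel)
    (fun i j => tableEntry intertwinerThirteen (attachIdx i) (sumIdx 6 attachIdx attachIdx j))
    (fun i j => tableEntry intertwinerThirteenInv (sumIdx 6 attachIdx attachIdx i) (attachIdx j))
    (c := 2) (by norm_num) ?_ ?_ <;> decide +kernel

lemma cospectralMates_fifteen :
    CospectralMates (hTree 15) (openQuipu 6 ![1, 3] ![1, 2] ⊕g SimpleGraph.cycleGraph 6) := by
  refine ⟨isEmpty_iso_sum (by norm_num) _ _, ?_⟩
  refine adjSpectrum_eq_of_intertwiner (by decide +kernel)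
    (fun i j => tableEntry intertwinerFifteen (attachIdx i) (sumIdx 9 attachIdx Fin.val j))
    (fun i j => tableEntry intertwinerFifteenInv (sumIdx 9 attachIdx Fin.val i) (attachIdx j))
    (c := 8) (by norm_num) ?_ ?_ <;> decide +kernel

end CospectralMates

/-! ### The characterization of the orders -/

lemma CospectralMates.not_isDS {V : Type*} {W : Type} [Fintype V] [Fintype W]
    {G : SimpleGraph V} {H : SimpleGraph W} (h : CospectralMates G H) : ¬ IsDS G := fun hG =>
  h.1.elim (hG W H h.2).some

theorem mainTheorem1 :
    (∀ n : ℕ, 10 ≤ n → (IsDS (hTree n) ↔ n ∉ ({10, 13, 15} : Set ℕ))) ∧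
    CospectralMates (hTree 10) (SimpleGraph.pathGraph 2 ⊕g closedQuipu 6 ![0, 3] ![1, 1]) ∧
    CospectralMates (hTree 13) (openQuipu 4 ![1] ![2] ⊕g closedQuipu 6 ![0] ![1]) ∧
    CospectralMates (hTree 15) (openQuipu 6 ![1, 3] ![1, 2] ⊕g SimpleGraph.cycleGraph 6) := by
  refine ⟨fun n hn => ⟨fun hDS hmem => ?_, fun hmem W _ H hH => ?_⟩, cospectralMates_ten,
    cospectralMates_thirteen, cospectralMates_fifteen⟩
  · rcases hmem with rfl | rfl | rfl
    exacts [cospectralMates_ten.not_isDS hDS, cospectralMates_thirteen.not_isDS hDS,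
      cospectralMates_fifteen.not_isDS hDS]
  · simp only [Set.mem_insert_iff, Set.mem_singleton_iff, not_or] at hmem
    exact HMate.nonempty_iso ⟨by omega, hmem.2.1, hmem.2.2, hH.symm⟩
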